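/- **Conventions.** A (topological) quasi-operad $\mathcal O$ consists of topological spaces $\mathcal O(n)$, $n\ge 1$, with continuous $\mathbb S_n$-actions, and continuous compositions $\circ_i:\mathcal O(m)\times\mathcal O(n)\to\mathcal O(m+n-1)$, $1\le i\le m$, that are equivariant: $\sigma(a)\circ_{\sigma(i)}\tau(b)=(\sigma\circ_i\tau)(a\circ_i b)$, where $\sigma\circ_i\tau$ is the block permutation. No associativity and no unit is required; it is an operad if moreover, for $a\in\mathcal O(k)$, $b\in\mathcal O(l)$, $c\in\mathcal O(m)$, $$(a\circ_i b)\circ_j c=\begin{cases}(a\circ_j c)\circ_{i+m-1}b & 1\le j<i,\\ a\circ_i(b\circ_{j-i+1}c)& i\le j<i+l,\\ (a\circ_{j-l+1}c)\circ_i b& i+l\le j.\end{cases}$$ An equivalence of quasi-operads is a morphism (a family of continuous equivariant maps compatible with all $\circ_i$) that is an $\mathbb S_n$-equivariant homotopy equivalence in each arity $n$. Two quasi-operad structures on the same collection of $\mathbb S_n$-spaces are homotopic through quasi-operads if their compositions are joined by homotopies $\circ_i(t)$, $t\in[0,1]$, such that for each fixed $t$ the $\circ_i(t)$ form a quasi-operad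 structure. Two quasi-operads are homotopy equivalent if they are related by the equivalence relation generated by equivalences and by homotopies through quasi-operads. **Spineless cacti.** A spineless cactus with $n$ lobes is a planar tree-like configuration of $n$ labelled circles (lobes) of arbitrary positive radii, with a marked point (global zero) on its outside circle, the circle that runs once around the configuration and covers each arc once. It is determined by the sequence of the arcs of the outside circle, starting from the global zero, each arc being given by the label of its lobe and its length (a lobe of radius $r$ has length $r$ in our unit): these are the finite words in $\{1,\dots,n\}\times\mathbb R_{>0}$ in which neighbouring labels differ, all labels occur, and no two distinct labels $a,b$ interleave as $\dots a\dots b\dots a\dots b\dots$. Let $\mathcal Cact(n)$ be the set of spineless cacti and $\mathcal Cact^1(n)$ the subset of the normalized ones, where all radii are $1$. $\mathcal Cact^1(n)$ has the topology of the CW complex with one closed cell for each word of labels $\tau$ as above, namely the product over the lobes $a$ of the simplex of arc lengths on $a$ (nonnegative, with sum $1$), where a point in which some arcs have length $0$ is identified with the cactus in which these arcs are contracted. $\mathcal Cact(n)=\mathcal Cact^1(n)\times\mathbb R_{>0}^n$ by the radii. $\mathbb S_n$ permutes the labels. The composition $c\circ_i c'$ identifies the $i$-th lobe of $c$ with the outside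 circle of $c'$, the point of the lobe first reached by the outside circle of $c$ (its root point) being matched with the global zero of $c'$: in $\mathcal Cact$ the whole cactus $c'$ is first scaled so that its outside circle becomes as long as the $i$-th lobe of $c$; in $\mathcal Cact^1$ only the $i$-th lobe of $c$ is scaled, to the length of the outside circle of $c'$. **Cacti.** $\mathcal Cacti(n)=\mathcal Cact(n)\times(S^1)^n$ and $\mathcal Cacti^1(n)=\mathcal Cact^1(n)\times(S^1)^n$ are the spaces of cacti and of normalized cacti: there is in addition a marked point (local zero, spine) on each lobe, whose coordinate in $S^1=\mathbb R/\mathbb Z$ is the relative length of the arc from the root point of the lobe to it. The composition $c\circ_i c'$ has the same scalings as before, but matches the local zero of the $i$-th lobe of $c$ with the global zero of $c'$; all other local zeros keep their place. **Homology.** For a commutative ring $k$ and a topological quasi-operad $\mathcal O$ let $H_*(\mathcal O;k)$ be the graded quasi-operad of the singular homology modules $H_*(\mathcal O(n);k)$ with the induced actions and the compositions $H_p(\mathcal O(m))\otimes H_q(\mathcal O(n))\xrightarrow{\times}H_{p+q}(\mathcal O(m)\times\mathcal O(n))\xrightarrow{(\circ_i)_*}H_{p+q}(\mathcal O(m+n-1))$,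 where $\times$ is the homology cross product. It is a graded operad if the above associativity relations hold with the Koszul sign $(-1)^{|b||c|}$ in the first and in the third case. **Statement.** $\mathcal Cact$ and $\mathcal Cacti$ are topological operads, $\mathcal Cact^1$ and $\mathcal Cacti^1$ are topological quasi-operads, and: 1. Spineless cacti $\mathcal Cact$ and normalized spineless cacti $\mathcal Cact^1$ are homotopy equivalent as quasi-operads. For each commutative ring $k$, the homology quasi-operad $H_*(\mathcal Cact^1;k)$ is an operad, and it is isomorphic to the homology operad $H_*(\mathcal Cact;k)$. 2. Cacti $\mathcal Cacti$ and normalized cacti $\mathcal Cacti^1$ are homotopy equivalent as quasi-operads. For each commutative ring $k$, the homology quasi-operad $H_*(\mathcal Cacti^1;k)$ is an operad, and it is isomorphic to the homology operad $H_*(\mathcal Cacti;k)$. -/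

import Mathlib

/-! ### Arc words

The outside circle (perimeter) of a tree-like configuration of circles runs exactly once over
every arc of the configuration.  Reading off, from the global zero on and in the positive
direction, the lobe on which each arc lies and the length of the arc gives a word in pairs
(label of the lobe, length of the arc). -/

/-- A finite list of labelled arcs, with their lengths. -/
abbrev ArcWord (ι : Type) : Type := List (ι × ℝ)

/-- A word of labels is tree-like if no two different labels `i`, `j` interleave as
`… i … j … i … j …`.  Words without repeated neighbours with this property, in which each
label occurs, are the planar planted bipartite trees with white leaves, black root and white
vertices labelled by `ι`, read off by walking once around the tree: a white vertex `v` with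
`|v|` incoming edges is visited `|v| + 1` times. -/
def Treelike {ι : Type} (l : List ι) : Prop :=
  ∀ i j : ι, i ≠ j → ¬ List.Sublist [i, j, i, j] l

namespace ArcWord

/-- The word of labels. -/
def labels {ι : Type} (w : ArcWord ι) : List ι := w.map Prod.fst

/-- The length of the outside circle. -/
def length {ι : Type} (w : ArcWord ι) : ℝ := (w.map Prod.snd).sum

/-- The length of the lobe `i`. -/
def lobeLength {ι : Type} [DecidableEq ι] (w : ArcWord ι) (i : ι) : ℝ :=
  (w.map fun a => if a.1 = i then a.2 else 0).sum

/-- Put an arc in front of a word, merging it with the first arc if both lie on the same lobe. -/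
def push {ι : Type} [DecidableEq ι] (a : ι × ℝ) : ArcWord ι → ArcWord ι
  | [] => [a]
  | b :: w => if a.1 = b.1 then (a.1, a.2 + b.2) :: w else a :: b :: w

/-- Remove the arcs of length zero and merge neighbouring arcs on the same lobe. -/
noncomputable def reduce {ι : Type} [DecidableEq ι] : ArcWord ι → ArcWord ι
  | [] => []
  | a :: w => open scoped Classical in if a.2 = 0 then reduce w else push a (reduce w)

/-- Rescale the arcs on the lobe `i` by the factor `s i`. -/
def rescale {ι : Type} (s : ι → ℝ) (w : ArcWord ι) : ArcWord ι :=
  w.map fun a => (a.1, s a.1 * a.2)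

/-- Relabel the lobes. -/
def relabel {ι κ : Type} (e : ι → κ) (w : ArcWord ι) : ArcWord κ :=
  w.map fun a => (e a.1, a.2)

/-- Cut the outside circle at distance `u` from the global zero: the part before and the part
after the cut. -/
noncomputable def cut {ι : Type} : ℝ → ArcWord ι → ArcWord ι × ArcWord ι
  | _, [] => ([], [])
  | u, a :: w => open scoped Classical in
    if a.2 ≤ u then (a :: (cut (u - a.2) w).1, (cut (u - a.2) w).2)
    else ([(a.1, u)], (a.1, a.2 - u) :: w)

/-- Identify the lobe `i` of `w` with the outside circle of `d` (both of the same length, with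
the root point of the lobe `i` matching the global zero of `d`): whenever the outside circle of
`w` runs along an arc of the lobe `i`, run along the next piece of the outside circle of `d` of
the same length instead. -/
noncomputable def substitute {ι κ : Type} [DecidableEq ι] (i : ι) :
    ArcWord ι → ArcWord κ → ArcWord ({j : ι // j ≠ i} ⊕ κ)
  | [], _ => []
  | a :: w, d =>
    if h : a.1 = i then
      relabel Sum.inr (cut a.2 d).1 ++ substitute i w (cut a.2 d).2
    else (Sum.inl ⟨a.1, h⟩, a.2) :: substitute i w d

/-- Move the global zero by the distance `u` along the outside circle, in the positive
direction. -/
noncomputable def rotate {ι : Type} (u : ℝ) (w : ArcWord ι) : ArcWord ι :=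
  (cut u w).2 ++ (cut u w).1

/-- The arc words of the spineless cacti with lobes labelled by `ι`. -/
structure IsCactus {ι : Type} (w : ArcWord ι) : Prop where
  pos : ∀ a ∈ w, 0 < a.2
  adjacent : w.labels.IsChain (· ≠ ·)
  mem : ∀ i : ι, i ∈ w.labels
  treelike : Treelike w.labels

/-- Arc words that become the arc word of a spineless cactus under `reduce`. -/
structure IsWeakCactus {ι : Type} [DecidableEq ι] (w : ArcWord ι) : Prop where
  nonneg : ∀ a ∈ w, 0 ≤ a.2
  lobe_pos : ∀ i : ι, 0 < w.lobeLength i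
  treelike : Treelike w.labels

/-! #### The operations preserve cacti -/

@[simp] lemma labels_nil {ι : Type} : labels ([] : ArcWord ι) = [] := rfl

@[simp] lemma labels_cons {ι : Type} (a : ι × ℝ) (w : ArcWord ι) :
    labels (a :: w) = a.1 :: labels w := rfl

@[simp] lemma labels_append {ι : Type} (v w : ArcWord ι) :
    labels (v ++ w) = labels v ++ labels w := by simp [labels]

@[simp] lemma labels_rescale {ι : Type} (s : ι → ℝ) (w : ArcWord ι) :
    labels (rescale s w) = labels w := by simp [labels, rescale, Function.comp_def]

@[simp] lemma labels_relabel {ι κ : Type} (e : ι → κ) (w : ArcWord ι) :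
    labels (relabel e w) = (labels w).map e := by simp [labels, relabel, Function.comp_def]

@[simp] lemma lobeLength_nil {ι : Type} [DecidableEq ι] (i : ι) :
    lobeLength ([] : ArcWord ι) i = 0 := rfl

@[simp] lemma lobeLength_cons {ι : Type} [DecidableEq ι] (a : ι × ℝ) (w : ArcWord ι) (i : ι) :
    lobeLength (a :: w) i = (if a.1 = i then a.2 else 0) + lobeLength w i := by
  simp [lobeLength]

@[simp] lemma lobeLength_append {ι : Type} [DecidableEq ι] (v w : ArcWord ι) (i : ι) :
    lobeLength (v ++ w) i = lobeLength v i + lobeLength w i := by simp [lobeLength]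

@[simp] lemma length_nil {ι : Type} : length ([] : ArcWord ι) = 0 := rfl

@[simp] lemma length_cons {ι : Type} (a : ι × ℝ) (w : ArcWord ι) :
    length (a :: w) = a.2 + length w := by simp [length]

lemma lobeLength_rescale {ι : Type} [DecidableEq ι] (s : ι → ℝ) (w : ArcWord ι) (i : ι) :
    lobeLength (rescale s w) i = s i * lobeLength w i := by
  induction w with
  | nil => simp [rescale]
  | cons a w ih =>
    have : rescale s (a :: w) = (a.1, s a.1 * a.2) :: rescale s w := rfl
    rw [this, lobeLength_cons, lobeLength_cons, ih]
    by_cases h : a.1 = i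
    · subst h; simp; ring
    · simp [h]

lemma lobeLength_relabel {ι κ : Type} [DecidableEq ι] [DecidableEq κ] {e : ι → κ}
    (he : Function.Injective e) (w : ArcWord ι) (i : ι) :
    lobeLength (relabel e w) (e i) = lobeLength w i := by
  induction w with
  | nil => rfl
  | cons a w ih =>
    have : relabel e (a :: w) = (e a.1, a.2) :: relabel e w := rfl
    rw [this, lobeLength_cons, lobeLength_cons, ih]
    simp [he.eq_iff]

lemma lobeLength_relabel_of_ne {ι κ : Type} [DecidableEq κ] {e : ι → κ} {k : κ}
    (hk : ∀ i, e i ≠ k) (w : ArcWord ι) : lobeLength (relabel e w) k = 0 := by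
  induction w with
  | nil => rfl
  | cons a w ih =>
    have : relabel e (a :: w) = (e a.1, a.2) :: relabel e w := rfl
    rw [this, lobeLength_cons, ih]
    simp [hk]

lemma length_rescale {ι : Type} (s : ℝ) (w : ArcWord ι) :
    length (rescale (fun _ => s) w) = s * length w := by
  induction w with
  | nil => simp [rescale]
  | cons a w ih =>
    have : rescale (fun _ => s) (a :: w) = (a.1, s * a.2) :: rescale (fun _ => s) w := rfl
    rw [this, length_cons, length_cons, ih]; ring

lemma length_eq_sum {ι : Type} [Fintype ι] [DecidableEq ι] (w : ArcWord ι) :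
    length w = ∑ i, lobeLength w i := by
  induction w with
  | nil => simp
  | cons a w ih => simp [Finset.sum_add_distrib, ih]

lemma length_nonneg {ι : Type} {w : ArcWord ι} (h : ∀ a ∈ w, 0 ≤ a.2) : 0 ≤ length w :=
  List.sum_nonneg (by simpa using fun b a hab => h (a, b) hab)

lemma lobeLength_nonneg {ι : Type} [DecidableEq ι] {w : ArcWord ι} (h : ∀ a ∈ w, 0 ≤ a.2)
    (i : ι) : 0 ≤ lobeLength w i := by
  refine List.sum_nonneg ?_
  simp only [List.mem_map, forall_exists_index, and_imp]
  rintro x a ha rfl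
  split_ifs
  · exact h a ha
  · exact le_rfl

lemma lobeLength_eq_zero_of_length {ι : Type} [DecidableEq ι] {w : ArcWord ι}
    (h : ∀ a ∈ w, 0 ≤ a.2) (h0 : length w = 0) (i : ι) : lobeLength w i = 0 := by
  induction w with
  | nil => rfl
  | cons a w ih =>
    rw [length_cons] at h0
    have h1 := h a (by simp)
    have h2 := length_nonneg (w := w) fun b hb => h b (by simp [hb])
    rw [lobeLength_cons, ih (fun b hb => h b (by simp [hb])) (by linarith)]
    have : a.2 = 0 := by linarith
    simp [this]

lemma mem_labels_of_lobeLength {ι : Type} [DecidableEq ι] {w : ArcWord ι} {i : ι}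
    (h : lobeLength w i ≠ 0) : i ∈ labels w := by
  induction w with
  | nil => simp at h
  | cons a w ih =>
    by_cases hi : a.1 = i
    · simp [hi]
    · rw [lobeLength_cons, if_neg hi, zero_add] at h
      exact List.mem_cons_of_mem _ (ih h)

lemma lobeLength_pos {ι : Type} [DecidableEq ι] {w : ArcWord ι} (h : ∀ a ∈ w, 0 < a.2) {i : ι}
    (hi : i ∈ labels w) : 0 < lobeLength w i := by
  induction w with
  | nil => simp at hi
  | cons a w ih =>
    have h1 := h a (by simp)
    have h2 := lobeLength_nonneg (w := w) (fun b hb => (h b (by simp [hb])).le) i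
    rw [lobeLength_cons]
    by_cases hai : a.1 = i
    · simp only [hai, if_true]; linarith
    · have : i ∈ labels w := by simpa [Ne.symm hai] using hi
      simpa [hai] using ih (fun b hb => h b (by simp [hb])) this

lemma push_cons {ι : Type} [DecidableEq ι] (a b : ι × ℝ) (w : ArcWord ι) :
    push a (b :: w) = if a.1 = b.1 then (a.1, a.2 + b.2) :: w else a :: b :: w := rfl

lemma push_pos {ι : Type} [DecidableEq ι] {a : ι × ℝ} {w : ArcWord ι} (ha : 0 < a.2)
    (h : ∀ b ∈ w, 0 < b.2) : ∀ b ∈ push a w, 0 < b.2 := by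
  cases w with
  | nil => simpa [push] using ha
  | cons c w =>
    have hc := h c (by simp)
    rw [push_cons]
    split_ifs
    · simp only [List.mem_cons, forall_eq_or_imp]
      exact ⟨by linarith, fun b hb => h b (by simp [hb])⟩
    · simp only [List.mem_cons, forall_eq_or_imp]
      exact ⟨ha, hc, fun b hb => h b (by simp [hb])⟩

lemma push_chain {ι : Type} [DecidableEq ι] (a : ι × ℝ) {w : ArcWord ι}
    (h : w.labels.IsChain (· ≠ ·)) : (push a w).labels.IsChain (· ≠ ·) := by
  cases w with
  | nil => simp [push]
  | cons c w =>
    rw [push_cons]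
    split_ifs with hac
    · simpa [hac] using h
    · simp only [labels_cons] at h ⊢
      exact List.IsChain.cons_cons hac h

lemma push_sublist {ι : Type} [DecidableEq ι] (a : ι × ℝ) (w : ArcWord ι) :
    (push a w).labels.Sublist (a.1 :: w.labels) := by
  cases w with
  | nil => simp [push]
  | cons c w =>
    rw [push_cons]
    split_ifs with hac
    · simp only [labels_cons]
      exact (List.sublist_cons_self _ _).cons_cons _
    · simp

lemma push_lobeLength {ι : Type} [DecidableEq ι] (a : ι × ℝ) (w : ArcWord ι) (i : ι) :
    lobeLength (push a w) i = lobeLength (a :: w) i := by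
  cases w with
  | nil => rfl
  | cons c w =>
    rw [push_cons]
    split_ifs with hac
    · simp only [lobeLength_cons, hac]
      split_ifs <;> ring
    · rfl

@[simp] lemma reduce_nil {ι : Type} [DecidableEq ι] : reduce ([] : ArcWord ι) = [] := rfl

lemma reduce_cons {ι : Type} [DecidableEq ι] (a : ι × ℝ) (w : ArcWord ι) :
    reduce (a :: w) = open scoped Classical in
      if a.2 = 0 then reduce w else push a (reduce w) := rfl

lemma reduce_lobeLength {ι : Type} [DecidableEq ι] (w : ArcWord ι) (i : ι) :
    lobeLength (reduce w) i = lobeLength w i := by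
  induction w with
  | nil => rfl
  | cons a w ih =>
    rw [reduce_cons]
    split_ifs with h
    · simp [ih, h]
    · rw [push_lobeLength, lobeLength_cons, lobeLength_cons, ih]

lemma reduce_pos {ι : Type} [DecidableEq ι] {w : ArcWord ι} (h : ∀ a ∈ w, 0 ≤ a.2) :
    ∀ a ∈ reduce w, 0 < a.2 := by
  induction w with
  | nil => simp
  | cons a w ih =>
    have ih := ih fun b hb => h b (by simp [hb])
    rw [reduce_cons]
    split_ifs with h0
    · exact ih
    · exact push_pos (lt_of_le_of_ne (h a (by simp)) (Ne.symm h0)) ih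

lemma reduce_chain {ι : Type} [DecidableEq ι] (w : ArcWord ι) :
    (reduce w).labels.IsChain (· ≠ ·) := by
  induction w with
  | nil => simp
  | cons a w ih =>
    rw [reduce_cons]
    split_ifs with h0
    · exact ih
    · exact push_chain a ih

lemma reduce_sublist {ι : Type} [DecidableEq ι] (w : ArcWord ι) :
    (reduce w).labels.Sublist w.labels := by
  induction w with
  | nil => simp
  | cons a w ih =>
    rw [reduce_cons]
    split_ifs with h0
    · exact ih.cons _
    · exact (push_sublist _ _).trans (ih.cons_cons _)

lemma IsWeakCactus.reduce {ι : Type} [DecidableEq ι] {w : ArcWord ι} (h : IsWeakCactus w) :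
    IsCactus (ArcWord.reduce w) where
  pos := reduce_pos h.nonneg
  adjacent := reduce_chain w
  mem i := mem_labels_of_lobeLength (by rw [reduce_lobeLength]; exact (h.lobe_pos i).ne')
  treelike i j hij hs := h.treelike i j hij (hs.trans (reduce_sublist w))

lemma IsCactus.isWeakCactus {ι : Type} [DecidableEq ι] {w : ArcWord ι} (h : IsCactus w) :
    IsWeakCactus w where
  nonneg a ha := (h.pos a ha).le
  lobe_pos i := lobeLength_pos h.pos (h.mem i)
  treelike := h.treelike

lemma IsCactus.rescale {ι : Type} {w : ArcWord ι} (h : IsCactus w) {s : ι → ℝ}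
    (hs : ∀ i, 0 < s i) : IsCactus (ArcWord.rescale s w) where
  pos := by
    simp only [ArcWord.rescale, List.mem_map, forall_exists_index, and_imp]
    rintro b a ha rfl
    exact mul_pos (hs _) (h.pos a ha)
  adjacent := by simpa using h.adjacent
  mem := by simpa using h.mem
  treelike := by simpa using h.treelike

lemma IsCactus.relabel {ι κ : Type} {w : ArcWord ι} (h : IsCactus w) (e : ι ≃ κ) :
    IsCactus (ArcWord.relabel e w) where
  pos := by
    simp only [ArcWord.relabel, List.mem_map, forall_exists_index, and_imp]
    rintro b a ha rfl
    exact h.pos a ha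
  adjacent := by
    rw [labels_relabel, List.isChain_map]
    exact h.adjacent.imp fun a b hab => e.injective.ne hab
  mem k := by
    rw [labels_relabel, List.mem_map]
    exact ⟨e.symm k, h.mem _, by simp⟩
  treelike i j hij hs := by
    rw [labels_relabel] at hs
    have := hs.map e.symm
    simp only [List.map_cons, List.map_nil, List.map_map, Equiv.symm_comp_self, List.map_id]
      at this
    exact h.treelike _ _ (e.symm.injective.ne hij) this

lemma cut_nonneg {ι : Type} {u : ℝ} (hu : 0 ≤ u) {w : ArcWord ι} (h : ∀ a ∈ w, 0 ≤ a.2) :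
    (∀ a ∈ (cut u w).1, 0 ≤ a.2) ∧ ∀ a ∈ (cut u w).2, 0 ≤ a.2 := by
  induction w generalizing u with
  | nil => simp [cut]
  | cons a w ih =>
    have hw : ∀ b ∈ w, 0 ≤ b.2 := fun b hb => h b (by simp [hb])
    unfold cut
    split_ifs with hau
    · have := ih (u := u - a.2) (by linarith) hw
      refine ⟨?_, this.2⟩
      simp only [List.mem_cons, forall_eq_or_imp]
      exact ⟨h a (by simp), this.1⟩
    · simp only [List.mem_cons, forall_eq_or_imp, List.not_mem_nil, false_imp_iff, implies_true,
        and_true]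
      exact ⟨hu, by linarith, hw⟩

lemma cut_lobeLength {ι : Type} [DecidableEq ι] (u : ℝ) (w : ArcWord ι) (i : ι) :
    lobeLength (cut u w).1 i + lobeLength (cut u w).2 i = lobeLength w i := by
  induction w generalizing u with
  | nil => simp [cut]
  | cons a w ih =>
    unfold cut
    split_ifs with hau
    · simp only [lobeLength_cons]
      rw [← ih (u - a.2)]; ring
    · simp only [lobeLength_cons, lobeLength_nil]
      split_ifs <;> ring

lemma cut_length {ι : Type} {u : ℝ} {w : ArcWord ι} (hu : u ≤ length w) (hu0 : 0 ≤ u) :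
    length (cut u w).2 = length w - u := by
  induction w generalizing u with
  | nil => simp [cut] at hu ⊢; linarith
  | cons a w ih =>
    rw [length_cons] at hu
    unfold cut
    split_ifs with hau
    · simp only [length_cons]
      rw [ih (by linarith) (by linarith)]; ring
    · simp only [length_cons]; ring

lemma sublist_of_sublist_cons_cons {ι : Type} {p l : List ι} {k : ι}
    (hp : p.IsChain (· ≠ ·)) (h : p.Sublist (k :: k :: l)) : p.Sublist (k :: l) := by
  rcases List.sublist_cons_iff.1 h with h | ⟨r, rfl, h'⟩
  · exact h
  · rcases List.sublist_cons_iff.1 h' with h | ⟨r', rfl, h⟩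
    · exact h.cons_cons _
    · simp at hp

lemma sublist_of_sublist_replicate_append {ι : Type} {p l : List ι} {k : ι} (n : ℕ)
    (hp : p.IsChain (· ≠ ·)) (h : p.Sublist (List.replicate n k ++ l)) : p.Sublist (k :: l) := by
  induction n with
  | zero => exact List.Sublist.cons _ (by simpa using h)
  | succ n ih =>
    rw [List.replicate_succ, List.cons_append] at h
    rcases List.sublist_cons_iff.1 h with h | ⟨r, rfl, h'⟩
    · exact ih h
    · cases n with
      | zero => exact List.Sublist.cons_cons _ (by simpa using h')
      | succ n =>
        rw [List.replicate_succ, List.cons_append] at h'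
        apply ih
        rw [List.replicate_succ, List.cons_append]
        rcases List.sublist_cons_iff.1 h' with h | ⟨r', rfl, h⟩
        · exact h.cons_cons _
        · simp at hp

lemma sublist_of_sublist_cut {ι : Type} {p : List ι} (u : ℝ) {w : ArcWord ι}
    (hp : p.IsChain (· ≠ ·)) (h : p.Sublist ((cut u w).1.labels ++ (cut u w).2.labels)) :
    p.Sublist w.labels := by
  induction w generalizing u p with
  | nil => simpa [cut] using h
  | cons a w ih =>
    unfold cut at h
    split_ifs at h with hau
    · simp only [labels_cons, List.cons_append] at h
      rcases List.sublist_cons_iff.1 h with h | ⟨r, rfl, h'⟩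
      · exact (ih _ hp h).cons _
      · exact (ih _ hp.tail h').cons_cons _
    · simp only [labels_cons, labels_nil, List.cons_append, List.nil_append] at h
      exact sublist_of_sublist_cons_cons hp h

lemma isChain_pattern {ι : Type} {i j : ι} (h : i ≠ j) : List.IsChain (· ≠ ·) [i, j, i, j] := by
  simp [h, h.symm]

lemma IsWeakCactus.rotate {ι : Type} [DecidableEq ι] {w : ArcWord ι} (h : IsWeakCactus w) {u : ℝ}
    (hu : 0 ≤ u) : IsWeakCactus (ArcWord.rotate u w) where
  nonneg a ha := by
    rcases List.mem_append.1 ha with ha | ha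
    · exact (cut_nonneg hu h.nonneg).2 a ha
    · exact (cut_nonneg hu h.nonneg).1 a ha
  lobe_pos i := by
    rw [ArcWord.rotate, lobeLength_append, add_comm, cut_lobeLength]
    exact h.lobe_pos i
  treelike i j hij hs := by
    rw [ArcWord.rotate, labels_append] at hs
    obtain ⟨p, q, hpq, hp, hq⟩ := List.sublist_append_iff.1 hs
    have key : ∀ r : List ι, r = q ++ p → r.IsChain (· ≠ ·) → r.Sublist w.labels := by
      rintro r rfl hr
      exact sublist_of_sublist_cut u hr (hq.append hp)
    have h1 := isChain_pattern hij
    have h2 := isChain_pattern hij.symm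
    have hw1 := h.treelike i j hij
    have hw2 := h.treelike j i hij.symm
    rcases p with _ | ⟨a, _ | ⟨b, _ | ⟨c, _ | ⟨d, p⟩⟩⟩⟩
    · exact hw1 (key _ (by simpa using hpq) h1)
    · simp only [List.cons_append, List.nil_append, List.cons.injEq] at hpq
      obtain ⟨rfl, rfl⟩ := hpq
      exact hw2 (key _ rfl h2)
    · simp only [List.cons_append, List.nil_append, List.cons.injEq] at hpq
      obtain ⟨rfl, rfl, rfl⟩ := hpq
      exact hw1 (key _ rfl h1)
    · simp only [List.cons_append, List.nil_append, List.cons.injEq] at hpq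
      obtain ⟨rfl, rfl, rfl, rfl⟩ := hpq
      exact hw2 (key _ rfl h2)
    · simp only [List.cons_append, List.cons.injEq] at hpq
      obtain ⟨rfl, rfl, rfl, rfl, hpq⟩ := hpq
      obtain ⟨rfl, rfl⟩ := List.append_eq_nil_iff.1 hpq.symm
      exact hw1 (key _ rfl h1)

lemma substitute_cons_pos {ι κ : Type} [DecidableEq ι] {i : ι} {a : ι × ℝ} (h : a.1 = i)
    (w : ArcWord ι) (d : ArcWord κ) :
    substitute i (a :: w) d =
      relabel Sum.inr (cut a.2 d).1 ++ substitute i w (cut a.2 d).2 := by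
  rw [substitute, dif_pos h]

lemma substitute_cons_neg {ι κ : Type} [DecidableEq ι] {i : ι} {a : ι × ℝ} (h : a.1 ≠ i)
    (w : ArcWord ι) (d : ArcWord κ) :
    substitute i (a :: w) d = (Sum.inl ⟨a.1, h⟩, a.2) :: substitute i w d := by
  rw [substitute, dif_neg h]

lemma substitute_nonneg {ι κ : Type} [DecidableEq ι] (i : ι) {w : ArcWord ι} {d : ArcWord κ}
    (hw : ∀ a ∈ w, 0 ≤ a.2) (hd : ∀ a ∈ d, 0 ≤ a.2) : ∀ a ∈ substitute i w d, 0 ≤ a.2 := by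
  induction w generalizing d with
  | nil => simp [substitute]
  | cons a w ih =>
    have ha : 0 ≤ a.2 := hw a (by simp)
    have hw' : ∀ b ∈ w, 0 ≤ b.2 := fun b hb => hw b (by simp [hb])
    by_cases h : a.1 = i
    · rw [substitute_cons_pos h]
      intro b hb
      rcases List.mem_append.1 hb with hb | hb
      · simp only [relabel, List.mem_map] at hb
        obtain ⟨c, hc, rfl⟩ := hb
        exact (cut_nonneg ha hd).1 c hc
      · exact ih hw' (cut_nonneg ha hd).2 b hb
    · rw [substitute_cons_neg h]
      simp only [List.mem_cons, forall_eq_or_imp]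
      exact ⟨ha, ih hw' hd⟩

lemma substitute_lobeLength_inl {ι κ : Type} [DecidableEq ι] [DecidableEq κ] (i : ι)
    (w : ArcWord ι) (d : ArcWord κ) (k : {j : ι // j ≠ i}) :
    lobeLength (substitute i w d) (Sum.inl k) = lobeLength w k := by
  induction w generalizing d with
  | nil => simp [substitute]
  | cons a w ih =>
    by_cases h : a.1 = i
    · rw [substitute_cons_pos h, lobeLength_append, ih, lobeLength_cons,
        lobeLength_relabel_of_ne (by simp)]
      simp [h, k.2.symm]
    · rw [substitute_cons_neg h, lobeLength_cons, lobeLength_cons, ih]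
      simp [Subtype.ext_iff]

lemma substitute_lobeLength_inr {ι κ : Type} [DecidableEq ι] [DecidableEq κ] (i : ι)
    {w : ArcWord ι} {d : ArcWord κ} (hw : ∀ a ∈ w, 0 ≤ a.2) (hd : ∀ a ∈ d, 0 ≤ a.2)
    (hl : length d = lobeLength w i) (k : κ) :
    lobeLength (substitute i w d) (Sum.inr k) = lobeLength d k := by
  induction w generalizing d with
  | nil =>
    rw [lobeLength_nil] at hl
    simp [substitute, lobeLength_eq_zero_of_length hd hl]
  | cons a w ih =>
    have ha : 0 ≤ a.2 := hw a (by simp)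
    have hw' : ∀ b ∈ w, 0 ≤ b.2 := fun b hb => hw b (by simp [hb])
    have hwn := lobeLength_nonneg hw' i
    by_cases h : a.1 = i
    · rw [lobeLength_cons, if_pos h] at hl
      rw [substitute_cons_pos h, lobeLength_append, lobeLength_relabel Sum.inr_injective,
        ih hw' (cut_nonneg ha hd).2, cut_lobeLength]
      rw [cut_length (by linarith) ha]; linarith
    · rw [lobeLength_cons, if_neg h, zero_add] at hl
      rw [substitute_cons_neg h, lobeLength_cons, ih hw' hd hl]
      simp

lemma substitute_sublist_left {ι κ : Type} [DecidableEq ι] (i : ι) {p : List ι}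
    (hp : p.IsChain (· ≠ ·)) {w : ArcWord ι} {d : ArcWord κ}
    (h : p.Sublist ((substitute i w d).labels.map (Sum.elim Subtype.val fun _ => i))) :
    p.Sublist w.labels := by
  induction w generalizing d p with
  | nil => simpa [substitute] using h
  | cons a w ih =>
    by_cases hi : a.1 = i
    · rw [substitute_cons_pos hi] at h
      simp only [labels_append, labels_relabel, List.map_append, List.map_map] at h
      have hc : (Sum.elim Subtype.val fun _ => i : {j : ι // j ≠ i} ⊕ κ → ι) ∘ Sum.inr =
          Function.const κ i := rfl
      rw [hc, List.map_const] at h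
      have h := sublist_of_sublist_replicate_append _ hp h
      rw [labels_cons, hi]
      rcases List.sublist_cons_iff.1 h with h | ⟨r, rfl, h'⟩
      · exact (ih hp h).cons _
      · exact (ih hp.tail h').cons_cons _
    · rw [substitute_cons_neg hi] at h
      simp only [labels_cons, List.map_cons, Sum.elim_inl] at h
      rw [labels_cons]
      rcases List.sublist_cons_iff.1 h with h | ⟨r, rfl, h'⟩
      · exact (ih hp h).cons _
      · exact (ih hp.tail h').cons_cons _

lemma substitute_sublist_right {ι κ : Type} [DecidableEq ι] (i : ι) {p : List κ}
    (hp : p.IsChain (· ≠ ·)) {w : ArcWord ι} {d : ArcWord κ}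
    (h : p.Sublist ((substitute i w d).labels.filterMap Sum.getRight?)) :
    p.Sublist d.labels := by
  induction w generalizing d p with
  | nil =>
    simp only [substitute, labels_nil, List.filterMap_nil, List.sublist_nil] at h
    simp [h]
  | cons a w ih =>
    by_cases hi : a.1 = i
    · rw [substitute_cons_pos hi] at h
      simp only [labels_append, labels_relabel, List.filterMap_append, List.filterMap_map] at h
      have hc : (Sum.getRight? : {j : ι // j ≠ i} ⊕ κ → Option κ) ∘ Sum.inr = some := rfl
      rw [hc, List.filterMap_some] at h
      obtain ⟨q, r, rfl, hq, hr⟩ := List.sublist_append_iff.1 h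
      exact sublist_of_sublist_cut a.2 hp (hq.append (ih hp.right_of_append hr))
    · rw [substitute_cons_neg hi] at h
      rw [labels_cons, List.filterMap_cons_none (by rfl)] at h
      exact ih hp h

lemma IsWeakCactus.substitute {ι κ : Type} [DecidableEq ι] [DecidableEq κ] (i : ι)
    {w : ArcWord ι} {d : ArcWord κ} (hw : IsWeakCactus w) (hd : IsWeakCactus d)
    (hl : length d = lobeLength w i) : IsWeakCactus (ArcWord.substitute i w d) where
  nonneg := substitute_nonneg i hw.nonneg hd.nonneg
  lobe_pos := by
    rintro (k | k)
    · rw [substitute_lobeLength_inl]; exact hw.lobe_pos _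
    · rw [substitute_lobeLength_inr i hw.nonneg hd.nonneg hl]; exact hd.lobe_pos _
  treelike := by
    intro x y hxy hs
    have h1 := hs.map (Sum.elim Subtype.val fun _ => i : {j : ι // j ≠ i} ⊕ κ → ι)
    have h2 := hs.filterMap (Sum.getRight? : {j : ι // j ≠ i} ⊕ κ → Option κ)
    rcases x with x | x <;> rcases y with y | y
    · have hne : (x : ι) ≠ y := fun h => hxy (congrArg Sum.inl (Subtype.ext h))
      exact hw.treelike _ _ hne (substitute_sublist_left i (isChain_pattern hne) h1)
    · exact hw.treelike _ _ x.2 (substitute_sublist_left i (isChain_pattern x.2) h1)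
    · exact hw.treelike _ _ y.2.symm (substitute_sublist_left i (isChain_pattern y.2.symm) h1)
    · have hne : x ≠ y := fun h => hxy (congrArg Sum.inr h)
      exact hd.treelike _ _ hne (substitute_sublist_right i (isChain_pattern hne) h2)

end ArcWord

/-! ### Spineless cacti -/

/-- Spineless cacti with lobes labelled by `ι` and arbitrary radii, given by the arcs along the
outside circle.  All lengths are measured in units in which the length of a lobe is its
radius. -/
structure SpinelessCactus (ι : Type) [DecidableEq ι] where
  word : ArcWord ι
  isCactus : word.IsCactus

namespace SpinelessCactus

/-- The radius of the lobe `i`. -/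
def radius {ι : Type} [DecidableEq ι] (c : SpinelessCactus ι) (i : ι) : ℝ :=
  c.word.lobeLength i

lemma radius_pos {ι : Type} [DecidableEq ι] (c : SpinelessCactus ι) (i : ι) : 0 < c.radius i :=
  c.isCactus.isWeakCactus.lobe_pos i

/-- The radius of the outside circle. -/
def totalRadius {ι : Type} [DecidableEq ι] (c : SpinelessCactus ι) : ℝ := c.word.length

lemma totalRadius_eq_sum {ι : Type} [Fintype ι] [DecidableEq ι] (c : SpinelessCactus ι) :
    c.totalRadius = ∑ i, c.radius i := c.word.length_eq_sum

lemma totalRadius_nonneg {ι : Type} [DecidableEq ι] (c : SpinelessCactus ι) :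
    0 ≤ c.totalRadius := ArcWord.length_nonneg c.isCactus.isWeakCactus.nonneg

lemma totalRadius_pos {ι : Type} [Fintype ι] [Nonempty ι] [DecidableEq ι]
    (c : SpinelessCactus ι) : 0 < c.totalRadius := by
  rw [totalRadius_eq_sum]
  exact Finset.sum_pos (fun i _ => c.radius_pos i) Finset.univ_nonempty

/-- Relabel the lobes. -/
def relabel {ι κ : Type} [DecidableEq ι] [DecidableEq κ] (e : ι ≃ κ) (c : SpinelessCactus ι) :
    SpinelessCactus κ := ⟨c.word.relabel e, c.isCactus.relabel e⟩

lemma relabel_radius {ι κ : Type} [DecidableEq ι] [DecidableEq κ] (e : ι ≃ κ)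
    (c : SpinelessCactus ι) (k : κ) : (c.relabel e).radius k = c.radius (e.symm k) := by
  conv_lhs => rw [← e.apply_symm_apply k]
  exact ArcWord.lobeLength_relabel e.injective _ _

/-- Scale the lobe `i` by the factor `s i`. -/
def rescale {ι : Type} [DecidableEq ι] (s : ι → ℝ) (hs : ∀ i, 0 < s i) (c : SpinelessCactus ι) :
    SpinelessCactus ι := ⟨c.word.rescale s, c.isCactus.rescale hs⟩

lemma rescale_radius {ι : Type} [DecidableEq ι] (s : ι → ℝ) (hs : ∀ i, 0 < s i)
    (c : SpinelessCactus ι) (i : ι) : (c.rescale s hs).radius i = s i * c.radius i :=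
  ArcWord.lobeLength_rescale _ _ _

/-- For a cactus `c'` whose outside circle is as long as the lobe `i` of `c`, glue in `c'` by
identifying its outside circle with the lobe `i` of `c`. -/
noncomputable def plug {ι κ : Type} [DecidableEq ι] [DecidableEq κ] (c : SpinelessCactus ι)
    (i : ι) (c' : SpinelessCactus κ) (h : c'.totalRadius = c.radius i) :
    SpinelessCactus ({j : ι // j ≠ i} ⊕ κ) :=
  ⟨(ArcWord.substitute i c.word c'.word).reduce,
    (c.isCactus.isWeakCactus.substitute i c'.isCactus.isWeakCactus h).reduce⟩

lemma plug_radius_inl {ι κ : Type} [DecidableEq ι] [DecidableEq κ] (c : SpinelessCactus ι)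
    (i : ι) (c' : SpinelessCactus κ) (h : c'.totalRadius = c.radius i) (k : {j : ι // j ≠ i}) :
    (c.plug i c' h).radius (Sum.inl k) = c.radius k := by
  simp only [plug, radius]
  rw [ArcWord.reduce_lobeLength, ArcWord.substitute_lobeLength_inl]

lemma plug_radius_inr {ι κ : Type} [DecidableEq ι] [DecidableEq κ] (c : SpinelessCactus ι)
    (i : ι) (c' : SpinelessCactus κ) (h : c'.totalRadius = c.radius i) (k : κ) :
    (c.plug i c' h).radius (Sum.inr k) = c'.radius k := by
  simp only [plug, radius]
  rw [ArcWord.reduce_lobeLength, ArcWord.substitute_lobeLength_inr i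
    c.isCactus.isWeakCactus.nonneg c'.isCactus.isWeakCactus.nonneg h]

/-- The gluing of spineless cacti: scale the whole cactus `c'` such that its outside circle
becomes as long as the lobe `i` of `c`, and glue it in. -/
noncomputable def glue {ι κ : Type} [DecidableEq ι] [Fintype κ] [Nonempty κ] [DecidableEq κ]
    (c : SpinelessCactus ι) (i : ι) (c' : SpinelessCactus κ) :
    SpinelessCactus ({j : ι // j ≠ i} ⊕ κ) :=
  c.plug i
    (c'.rescale (fun _ => c.radius i / c'.totalRadius)
      fun _ => div_pos (c.radius_pos i) c'.totalRadius_pos)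
    (by
      have h : (c'.rescale (fun _ => c.radius i / c'.totalRadius)
          fun _ => div_pos (c.radius_pos i) c'.totalRadius_pos).totalRadius =
          c.radius i / c'.totalRadius * c'.totalRadius := ArcWord.length_rescale _ _
      rw [h, div_mul_cancel₀ _ c'.totalRadius_pos.ne'])

/-- The representative in `[0, 1)` of an element of `S¹ = ℝ / ℤ`. -/
noncomputable def turn (t : UnitAddCircle) : ℝ := (AddCircle.equivIco 1 0 t : ℝ)

lemma turn_nonneg (t : UnitAddCircle) : 0 ≤ turn t := (AddCircle.equivIco 1 0 t).2.1

/-- Move the global zero along the outside circle, in the positive direction, by the fraction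
`t` of the whole circle. -/
noncomputable def rotate {ι : Type} [DecidableEq ι] (c : SpinelessCactus ι) (t : UnitAddCircle) :
    SpinelessCactus ι :=
  ⟨(c.word.rotate (turn t * c.totalRadius)).reduce,
    (c.isCactus.isWeakCactus.rotate
      (mul_nonneg (turn_nonneg t) c.totalRadius_nonneg)).reduce⟩

lemma rotate_radius {ι : Type} [DecidableEq ι] (c : SpinelessCactus ι) (t : UnitAddCircle)
    (i : ι) : (c.rotate t).radius i = c.radius i := by
  simp only [rotate, radius]
  rw [ArcWord.reduce_lobeLength, ArcWord.rotate, ArcWord.lobeLength_append, add_comm,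
    ArcWord.cut_lobeLength]

/-- When the global zero is moved by `t` along the outside circle, it passes over this fraction
of the lobe `i`. -/
noncomputable def traversed {ι : Type} [DecidableEq ι] (c : SpinelessCactus ι)
    (t : UnitAddCircle) (i : ι) : UnitAddCircle :=
  ((ArcWord.lobeLength (ArcWord.cut (turn t * c.totalRadius) c.word).1 i / c.radius i : ℝ) :
    UnitAddCircle)

end SpinelessCactus

/-- Normalized spineless cacti: all lobes have radius one. -/
def NormalizedSpinelessCactus (ι : Type) [DecidableEq ι] : Type :=
  {c : SpinelessCactus ι // ∀ i, c.radius i = 1}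

namespace NormalizedSpinelessCactus

lemma totalRadius_eq {ι : Type} [Fintype ι] [DecidableEq ι] (c : NormalizedSpinelessCactus ι) :
    c.1.totalRadius = Fintype.card ι := by
  rw [SpinelessCactus.totalRadius_eq_sum]
  simp [c.2]

/-- Relabel the lobes. -/
def relabel {ι κ : Type} [DecidableEq ι] [DecidableEq κ] (e : ι ≃ κ)
    (c : NormalizedSpinelessCactus ι) : NormalizedSpinelessCactus κ :=
  ⟨c.1.relabel e, fun k => by rw [SpinelessCactus.relabel_radius]; exact c.2 _⟩

/-- Move the global zero. -/
noncomputable def rotate {ι : Type} [DecidableEq ι] (c : NormalizedSpinelessCactus ι)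
    (t : UnitAddCircle) : NormalizedSpinelessCactus ι :=
  ⟨c.1.rotate t, fun k => by rw [SpinelessCactus.rotate_radius]; exact c.2 _⟩

/-- The gluing of normalized spineless cacti: scale the lobe `i` of `c` to the length of the
outside circle of `c'`, which is the number of lobes of `c'`, and glue in `c'`. -/
noncomputable def glue {ι κ : Type} [DecidableEq ι] [Fintype κ] [Nonempty κ] [DecidableEq κ]
    (c : NormalizedSpinelessCactus ι) (i : ι) (c' : NormalizedSpinelessCactus κ) :
    NormalizedSpinelessCactus ({j : ι // j ≠ i} ⊕ κ) :=
  ⟨(c.1.rescale (fun k => if k = i then (Fintype.card κ : ℝ) else 1)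
      (fun k => by
        split_ifs
        · exact_mod_cast Fintype.card_pos
        · exact one_pos)).plug i c'.1
      (by simp [SpinelessCactus.rescale_radius, c.2, totalRadius_eq]), by
    rintro (k | k)
    · rw [SpinelessCactus.plug_radius_inl, SpinelessCactus.rescale_radius, c.2, if_neg k.2,
        one_mul]
    · rw [SpinelessCactus.plug_radius_inr, c'.2]⟩

end NormalizedSpinelessCactus

/-! #### Topology -/

/-- The topological types of normalized spineless cacti: planar planted bipartite trees with
white leaves, black root and white vertices labelled by `ι`, see `Treelike`.  The letters of the
word are the arcs of the cactus; the letter `i` occurs `|v| + 1` times, where `v` is the white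
vertex with label `i`. -/
def CactusType (ι : Type) : Type :=
  {l : List ι // l.IsChain (· ≠ ·) ∧ (∀ i, i ∈ l) ∧ Treelike l}

/-- The closed cell of a topological type: the product, over the white vertices, of the closed
simplices with one vertex for each arc on the lobe. -/
def CactusCell {ι : Type} [DecidableEq ι] (τ : CactusType ι) : Type :=
  {x : Fin τ.1.length → ℝ // (∀ a, 0 ≤ x a) ∧
    ∀ i, ∑ a, (if τ.1.get a = i then x a else 0) = 1}

instance {ι : Type} [DecidableEq ι] (τ : CactusType ι) : TopologicalSpace (CactusCell τ) :=
  instTopologicalSpaceSubtype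

/-- The arcs of a point of a closed cell, possibly with arcs of length zero. -/
def CactusCell.arcs {ι : Type} [DecidableEq ι] {τ : CactusType ι} (x : CactusCell τ) :
    ArcWord ι := List.ofFn fun a => (τ.1.get a, x.1 a)

lemma CactusCell.arcs_lobeLength {ι : Type} [DecidableEq ι] {τ : CactusType ι}
    (x : CactusCell τ) (i : ι) : x.arcs.lobeLength i = 1 := by
  rw [← x.2.2 i, ArcWord.lobeLength, CactusCell.arcs, List.map_ofFn, List.sum_ofFn]
  rfl

lemma CactusCell.arcs_isWeakCactus {ι : Type} [DecidableEq ι] {τ : CactusType ι}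
    (x : CactusCell τ) : x.arcs.IsWeakCactus where
  nonneg a ha := by
    obtain ⟨k, rfl⟩ := (List.mem_ofFn' _ _).1 ha
    exact x.2.1 k
  lobe_pos i := by rw [x.arcs_lobeLength]; exact one_pos
  treelike := by
    have h : x.arcs.labels = τ.1 := by
      rw [ArcWord.labels, CactusCell.arcs, List.map_ofFn]
      exact List.ofFn_get τ.1
    rw [h]; exact τ.2.2.2

/-- The cactus of a point of a closed cell.  At a boundary point the arcs of length zero are
contracted; this is the identification of the faces of the cell with cells of lower dimension by
the degenerations of cacti. -/
noncomputable def CactusCell.toCactus {ι : Type} [DecidableEq ι] {τ : CactusType ι}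
    (x : CactusCell τ) : NormalizedSpinelessCactus ι :=
  ⟨⟨x.arcs.reduce, x.arcs_isWeakCactus.reduce⟩, fun i => by
    rw [SpinelessCactus.radius, ArcWord.reduce_lobeLength, x.arcs_lobeLength]⟩

/-- The topology of the CW complex obtained by gluing the closed cells along the degenerations of
cacti, i.e. the quotient topology from the disjoint union of all closed cells. -/
noncomputable instance {ι : Type} [DecidableEq ι] : TopologicalSpace (NormalizedSpinelessCactus ι) :=
  TopologicalSpace.coinduced
    (fun x : (τ : CactusType ι) × CactusCell τ => x.2.toCactus) inferInstance

/-- Scale all lobes to radius one. -/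
noncomputable def SpinelessCactus.normalize {ι : Type} [DecidableEq ι] (c : SpinelessCactus ι) :
    NormalizedSpinelessCactus ι :=
  ⟨c.rescale (fun i => 1 / c.radius i) fun i => one_div_pos.2 (c.radius_pos i), fun i => by
    rw [SpinelessCactus.rescale_radius, one_div_mul_cancel (c.radius_pos i).ne']⟩

/-- The topology of the product of the space of normalized spineless cacti with the space of
the (positive) radii of the lobes. -/
noncomputable instance {ι : Type} [DecidableEq ι] : TopologicalSpace (SpinelessCactus ι) :=
  TopologicalSpace.induced
    (fun c => ((c.normalize, c.radius) : NormalizedSpinelessCactus ι × (ι → ℝ))) inferInstance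

/-! ### Cacti with spines -/

/-- Cacti: spineless cacti together with a local zero on each lobe.  The coordinate in
`S¹ = ℝ / ℤ` of the local zero of a lobe is the length, relative to that of the lobe, of the arc
running counterclockwise from the root point of the lobe (the point where the outside circle
first reaches the lobe) to the local zero. -/
def Cactus (ι : Type) [DecidableEq ι] : Type := SpinelessCactus ι × (ι → UnitAddCircle)

noncomputable instance {ι : Type} [DecidableEq ι] : TopologicalSpace (Cactus ι) :=
  instTopologicalSpaceProd

/-- Relabel the lobes. -/
def Cactus.relabel {ι κ : Type} [DecidableEq ι] [DecidableEq κ] (e : ι ≃ κ) (c : Cactus ι) :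
    Cactus κ := (c.1.relabel e, c.2 ∘ e.symm)

/-- The gluing of cacti: as for spineless cacti, but now the local zero of the lobe `i` of `c` is
matched with the global zero of `c'`.  Hence the root point of the lobe `i` is matched with the
point at position `-c.2 i` of the outside circle of `c'`; this point becomes the new global zero
of `c'` before the gluing, and the coordinates of the local zeros of `c'` are those with respect
to the new root points. -/
noncomputable def Cactus.glue {ι κ : Type} [DecidableEq ι] [Fintype κ] [Nonempty κ]
    [DecidableEq κ] (c : Cactus ι) (i : ι) (c' : Cactus κ) : Cactus ({j : ι // j ≠ i} ⊕ κ) :=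
  (c.1.glue i (c'.1.rotate (-c.2 i)),
    Sum.elim (fun k => c.2 k) fun k => c'.2 k - c'.1.traversed (-c.2 i) k)

/-- Normalized cacti: all lobes have radius one. -/
def NormalizedCactus (ι : Type) [DecidableEq ι] : Type :=
  NormalizedSpinelessCactus ι × (ι → UnitAddCircle)

noncomputable instance {ι : Type} [DecidableEq ι] : TopologicalSpace (NormalizedCactus ι) :=
  instTopologicalSpaceProd

/-- Relabel the lobes. -/
def NormalizedCactus.relabel {ι κ : Type} [DecidableEq ι] [DecidableEq κ] (e : ι ≃ κ)
    (c : NormalizedCactus ι) : NormalizedCactus κ := (c.1.relabel e, c.2 ∘ e.symm)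

/-- The gluing of normalized cacti: as for normalized spineless cacti, but matching the local
zero of the lobe `i` of `c` with the global zero of `c'`. -/
noncomputable def NormalizedCactus.glue {ι κ : Type} [DecidableEq ι] [Fintype κ] [Nonempty κ]
    [DecidableEq κ] (c : NormalizedCactus ι) (i : ι) (c' : NormalizedCactus κ) :
    NormalizedCactus ({j : ι // j ≠ i} ⊕ κ) :=
  (c.1.glue i (c'.1.rotate (-c.2 i)),
    Sum.elim (fun k => c.2 k) fun k => c'.2 k - c'.1.1.traversed (-c.2 i) k)

/-! ### The operations on labels underlying the compositions of an operad

The component of arity `n + 1`, `n ≥ 0`, is indexed by `n`, its inputs by `Fin (n + 1)`. The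
composite of elements of arities `m + 1` and `n + 1` has arity `m + n + 1`. -/

/-- Inserting the block `0, …, n` in place of the entry `i` of `0, …, m`. -/
def insertFun {m n l : ℕ} (h : m + n = l) (i : Fin (m + 1)) :
    {j : Fin (m + 1) // j ≠ i} ⊕ Fin (n + 1) → Fin (l + 1)
  | Sum.inl j => if j.1 < i then ⟨j.1, by omega⟩ else ⟨j.1 + n, by omega⟩
  | Sum.inr j => ⟨i + j, by omega⟩

lemma insertFun_bijective {m n l : ℕ} (h : m + n = l) (i : Fin (m + 1)) :
    Function.Bijective (insertFun h i) := by
  rw [Fintype.bijective_iff_injective_and_card]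
  constructor
  · rintro (⟨j, hj⟩ | j) (⟨k, hk⟩ | k) hjk
    · have hj' : (j : ℕ) ≠ i := fun h => hj (Fin.ext h)
      have hk' : (k : ℕ) ≠ i := fun h => hk (Fin.ext h)
      simp only [insertFun, Fin.lt_def] at hjk
      congr 2
      split_ifs at hjk <;> simp only [Fin.mk.injEq] at hjk <;> apply Fin.ext <;> omega
    · have hj' : (j : ℕ) ≠ i := fun h => hj (Fin.ext h)
      simp only [insertFun, Fin.lt_def] at hjk
      exfalso
      split_ifs at hjk <;> simp only [Fin.mk.injEq] at hjk <;> omega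
    · have hk' : (k : ℕ) ≠ i := fun h => hk (Fin.ext h)
      simp only [insertFun, Fin.lt_def] at hjk
      exfalso
      split_ifs at hjk <;> simp only [Fin.mk.injEq] at hjk <;> omega
    · simp only [insertFun, Fin.mk.injEq] at hjk
      congr 1
      apply Fin.ext; omega
  · simp only [Fintype.card_sum, Fintype.card_fin, ne_eq, Fintype.card_subtype_compl,
      Fintype.card_unique]
    omega

/-- Inserting the block `0, …, n` in place of the entry `i` of `0, …, m`, as a bijection. -/
noncomputable def insertEquiv {m n l : ℕ} (h : m + n = l) (i : Fin (m + 1)) :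
    {j : Fin (m + 1) // j ≠ i} ⊕ Fin (n + 1) ≃ Fin (l + 1) :=
  Equiv.ofBijective _ (insertFun_bijective h i)

/-- The permutation `σ ∘ᵢ τ`: permute the entries by `σ`, where the entry `i` is replaced by a
block, the entries of which are permuted by `τ`. -/
noncomputable def blockPerm {m n l : ℕ} (h : m + n = l) (i : Fin (m + 1))
    (σ : Equiv.Perm (Fin (m + 1))) (τ : Equiv.Perm (Fin (n + 1))) :
    Equiv.Perm (Fin (l + 1)) :=
  (insertEquiv h i).symm.trans
    ((Equiv.sumCongr
      (σ.subtypeEquiv (p := fun j => j ≠ i) (q := fun j => j ≠ σ i)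
        fun _ => σ.injective.ne_iff.symm) τ).trans
      (insertEquiv h (σ i)))

/-! ### Topological quasi-operads -/

/-- The data underlying a topological quasi-operad: spaces, actions of the symmetric groups
and compositions. -/
structure TopCollection where
  /-- the space of arity `n + 1` -/
  space : ℕ → Type
  top : ∀ n, TopologicalSpace (space n)
  /-- the action of the symmetric group (on the labels of the inputs) -/
  act : ∀ {n : ℕ}, Equiv.Perm (Fin (n + 1)) → space n → space n
  /-- the composition `∘ᵢ` -/
  comp : ∀ {m n l : ℕ}, m + n = l → Fin (m + 1) → space m → space n → space l

attribute [instance] TopCollection.top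

namespace TopCollection

/-- Topological quasi-operads. -/
structure IsQuasiOperad (A : TopCollection) : Prop where
  continuous_act : ∀ {n : ℕ} (σ : Equiv.Perm (Fin (n + 1))),
    Continuous (A.act σ : A.space n → A.space n)
  act_one : ∀ {n : ℕ} (a : A.space n), A.act 1 a = a
  act_mul : ∀ {n : ℕ} (σ τ : Equiv.Perm (Fin (n + 1))) (a : A.space n),
    A.act (σ * τ) a = A.act σ (A.act τ a)
  continuous_comp : ∀ {m n l : ℕ} (h : m + n = l) (i : Fin (m + 1)),
    Continuous fun p : A.space m × A.space n => A.comp h i p.1 p.2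
  equivariant : ∀ {m n l : ℕ} (h : m + n = l) (i : Fin (m + 1))
    (σ : Equiv.Perm (Fin (m + 1))) (τ : Equiv.Perm (Fin (n + 1)))
    (a : A.space m) (b : A.space n),
    A.comp h (σ i) (A.act σ a) (A.act τ b) = A.act (blockPerm h i σ τ) (A.comp h i a b)

/-- Topological operads: the compositions are associative. -/
structure IsOperad (A : TopCollection) : Prop extends A.IsQuasiOperad where
  /-- `(a ∘ᵢ b) ∘ⱼ c` for `j` before the inputs of `b` -/
  assoc_left : ∀ {k l m kl km n : ℕ} (hkl : k + l = kl) (hkm : k + m = km) (hn : kl + m = n)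
    (hn' : km + l = n) (i j : Fin (k + 1)) (j' : Fin (kl + 1)) (i' : Fin (km + 1)),
    j < i → (j' : ℕ) = j → (i' : ℕ) = i + m →
    ∀ (a : A.space k) (b : A.space l) (c : A.space m),
    A.comp hn j' (A.comp hkl i a b) c = A.comp hn' i' (A.comp hkm j a c) b
  /-- `(a ∘ᵢ b) ∘ⱼ c` for `j` among the inputs of `b` -/
  assoc_middle : ∀ {k l m kl lm n : ℕ} (hkl : k + l = kl) (hlm : l + m = lm) (hn : kl + m = n)
    (hn' : k + lm = n) (i : Fin (k + 1)) (j : Fin (l + 1)) (j' : Fin (kl + 1)),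
    (j' : ℕ) = i + j →
    ∀ (a : A.space k) (b : A.space l) (c : A.space m),
    A.comp hn j' (A.comp hkl i a b) c = A.comp hn' i a (A.comp hlm j b c)
  /-- `(a ∘ᵢ b) ∘ⱼ c` for `j` after the inputs of `b` -/
  assoc_right : ∀ {k l m kl km n : ℕ} (hkl : k + l = kl) (hkm : k + m = km) (hn : kl + m = n)
    (hn' : km + l = n) (i j : Fin (k + 1)) (j' : Fin (kl + 1)) (i' : Fin (km + 1)),
    i < j → (j' : ℕ) = j + l → (i' : ℕ) = i →
    ∀ (a : A.space k) (b : A.space l) (c : A.space m),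
    A.comp hn j' (A.comp hkl i a b) c = A.comp hn' i' (A.comp hkm j a c) b

/-- Morphisms of quasi-operads. -/
structure IsMorphism (A B : TopCollection) (f : ∀ n, A.space n → B.space n) : Prop where
  continuous : ∀ n, Continuous (f n)
  map_act : ∀ {n : ℕ} (σ : Equiv.Perm (Fin (n + 1))) (a : A.space n),
    f n (A.act σ a) = B.act σ (f n a)
  map_comp : ∀ {m n l : ℕ} (h : m + n = l) (i : Fin (m + 1)) (a : A.space m) (b : A.space n),
    f l (A.comp h i a b) = B.comp h i (f m a) (f n b)

/-- Equivalences of quasi-operads: morphisms that are, in each arity, equivariant homotopy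
equivalences. -/
structure IsEquivalence (A B : TopCollection) (f : ∀ n, A.space n → B.space n) : Prop
    extends IsMorphism A B f where
  exists_inverse : ∀ n, ∃ (g : B.space n → A.space n)
    (H : unitInterval × A.space n → A.space n) (K : unitInterval × B.space n → B.space n),
    Continuous g ∧ Continuous H ∧ Continuous K ∧
    (∀ σ b, g (B.act σ b) = A.act σ (g b)) ∧
    (∀ σ t a, H (t, A.act σ a) = A.act σ (H (t, a))) ∧
    (∀ σ t b, K (t, B.act σ b) = B.act σ (K (t, b))) ∧
    (∀ a, H (0, a) = g (f n a)) ∧ (∀ a, H (1, a) = a) ∧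
    (∀ b, K (0, b) = f n (g b)) ∧ (∀ b, K (1, b) = b)

/-- The type of the compositions on a fixed collection. -/
abbrev Compositions (A : TopCollection) : Type :=
  ∀ (m n l : ℕ), m + n = l → Fin (m + 1) → A.space m → A.space n → A.space l

/-- The same spaces with the same actions, but other compositions. -/
def withComp (A : TopCollection) (c : A.Compositions) : TopCollection where
  space := A.space
  top := A.top
  act := A.act
  comp := fun {m n l} h i => c m n l h i

/-- `B` is the collection of spaces of `A` with another quasi-operad structure, and the two
structures are homotopic through quasi-operad structures. -/
def HomotopicThroughQuasiOperads (A B : TopCollection) : Prop :=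
  ∃ c : unitInterval → A.Compositions,
    (∀ (m n l : ℕ) (h : m + n = l) (i : Fin (m + 1)),
      Continuous fun p : unitInterval × A.space m × A.space n =>
        c p.1 m n l h i p.2.1 p.2.2) ∧
    (∀ t, (A.withComp (c t)).IsQuasiOperad) ∧
    A = A.withComp (c 0) ∧ B = A.withComp (c 1)

/-- The elementary homotopy equivalences between quasi-operads: equivalences of quasi-operads (in
particular isomorphisms) and homotopies through quasi-operad structures. -/
inductive HomotopyStep (A B : TopCollection) : Prop
  | equivalence (hA : A.IsQuasiOperad) (hB : B.IsQuasiOperad) (f : ∀ n, A.space n → B.space n)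
      (hf : IsEquivalence A B f) : HomotopyStep A B
  | homotopy (h : HomotopicThroughQuasiOperads A B) : HomotopyStep A B

/-- Homotopy equivalence of quasi-operads: the equivalence relation generated by the elementary
homotopy equivalences. -/
def HomotopyEquivalent (A B : TopCollection) : Prop := Relation.EqvGen HomotopyStep A B

end TopCollection

/-! ### The quasi-operads of cacti -/

/-- Spineless cacti. -/
noncomputable def spinelessCacti : TopCollection where
  space n := SpinelessCactus (Fin (n + 1))
  top _ := inferInstance
  act σ c := c.relabel σ
  comp h i c c' := (c.glue i c').relabel (insertEquiv h i)

/-- Normalized spineless cacti. -/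
noncomputable def normalizedSpinelessCacti : TopCollection where
  space n := NormalizedSpinelessCactus (Fin (n + 1))
  top _ := inferInstance
  act σ c := c.relabel σ
  comp h i c c' := (c.glue i c').relabel (insertEquiv h i)

/-- Cacti. -/
noncomputable def cacti : TopCollection where
  space n := Cactus (Fin (n + 1))
  top _ := inferInstance
  act σ c := c.relabel σ
  comp h i c c' := (c.glue i c').relabel (insertEquiv h i)

/-- Normalized cacti. -/
noncomputable def normalizedCacti : TopCollection where
  space n := NormalizedCactus (Fin (n + 1))
  top _ := inferInstance
  act σ c := c.relabel σ
  comp h i c c' := (c.glue i c').relabel (insertEquiv h i)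

/-! ### The homology cross product -/

/-- Lattice paths from `(0, 0)` to `(p, q)` in `p + q` unit steps, i.e. `(p, q)`-shuffles; `fst t`
is the first coordinate of the path after `t` steps. -/
@[ext]
structure ShufflePath (p q : ℕ) where
  fst : ℕ → ℕ
  zero : fst 0 = 0
  le_succ : ∀ t, fst t ≤ fst (t + 1)
  succ_le : ∀ t, fst (t + 1) ≤ fst t + 1
  final : ∀ t, p + q ≤ t → fst t = p

namespace ShufflePath

lemma mono {p q : ℕ} (φ : ShufflePath p q) : Monotone φ.fst := monotone_nat_of_le_succ φ.le_succ

lemma fst_add_le {p q : ℕ} (φ : ShufflePath p q) (t u : ℕ) : φ.fst (t + u) ≤ φ.fst t + u := by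
  induction u with
  | zero => simp
  | succ u ih => have := φ.succ_le (t + u); rw [← add_assoc]; omega

lemma fst_le {p q : ℕ} (φ : ShufflePath p q) (t : ℕ) : φ.fst t ≤ p :=
  (φ.mono (show t ≤ p + q + t by omega)).trans (φ.final (p + q + t) (by omega)).le

lemma fst_le_self {p q : ℕ} (φ : ShufflePath p q) (t : ℕ) : φ.fst t ≤ t := by
  have := φ.fst_add_le 0 t
  rw [φ.zero] at this
  simpa using this

lemma le_fst_add {p q : ℕ} (φ : ShufflePath p q) {t : ℕ} (ht : t ≤ p + q) :
    t ≤ φ.fst t + q := by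
  have := φ.fst_add_le t (p + q - t)
  rw [φ.final _ (by omega)] at this
  omega

lemma snd_mono {p q : ℕ} (φ : ShufflePath p q) {t u : ℕ} (h : t ≤ u) :
    t - φ.fst t ≤ u - φ.fst u := by
  obtain ⟨v, rfl⟩ := Nat.exists_eq_add_of_le h
  have := φ.fst_add_le t v
  have := φ.fst_le_self t
  omega

instance (p q : ℕ) : Finite (ShufflePath p q) := by
  refine Finite.of_injective
    (fun (φ : ShufflePath p q) (t : Fin (p + q)) =>
      (⟨φ.fst t, Nat.lt_succ_of_le (φ.fst_le t)⟩ : Fin (p + 1))) fun φ ψ h => ?_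
  ext t
  by_cases ht : t < p + q
  · exact congrArg Fin.val (congrFun h ⟨t, ht⟩)
  · rw [φ.final t (by omega), ψ.final t (by omega)]

noncomputable instance (p q : ℕ) : Fintype (ShufflePath p q) := Fintype.ofFinite _

/-- The number of unit squares below the path; `(-1) ^ area` is the sign of the shuffle. -/
def area {p q : ℕ} (φ : ShufflePath p q) : ℕ :=
  ∑ t ∈ Finset.range (p + q), (φ.fst (t + 1) - φ.fst t) * (t - φ.fst t)

open CategoryTheory Simplicial in
/-- The first coordinate of the path, as a degeneracy operator. -/
def homFst {p q s : ℕ} (_ : p + q = s) (φ : ShufflePath p q) : ⦋s⦌ ⟶ ⦋p⦌ :=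
  SimplexCategory.Hom.mk
    { toFun := fun t => ⟨φ.fst t, Nat.lt_succ_of_le (φ.fst_le t)⟩
      monotone' := fun _ _ h => φ.mono h }

open CategoryTheory Simplicial in
/-- The second coordinate of the path, as a degeneracy operator. -/
def homSnd {p q s : ℕ} (h : p + q = s) (φ : ShufflePath p q) : ⦋s⦌ ⟶ ⦋q⦌ :=
  SimplexCategory.Hom.mk
    { toFun := fun t => ⟨t - φ.fst t, by
        have := φ.le_fst_add (t := t) (by have := t.2; simp at this; omega)
        simp; omega⟩
      monotone' := fun _ _ h => φ.snd_mono h }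

/-! #### The boundary of the shuffle map -/

lemma area_aux {p q : ℕ} (φ : ShufflePath p q) (n : ℕ) :
    2 * (∑ t ∈ Finset.range n, (((φ.fst (t + 1) - φ.fst t) * (t - φ.fst t) : ℕ) : ℤ)) +
      2 * (∑ t ∈ Finset.range (n + 1), (φ.fst t : ℤ)) + φ.fst n * (φ.fst n - 1) =
      2 * n * φ.fst n := by
  induction n with
  | zero => simp [φ.zero]
  | succ n ih =>
    rw [Finset.sum_range_succ, Finset.sum_range_succ (n := n + 1)]
    have h1 := φ.le_succ n
    have h2 := φ.succ_le n
    have h3 := φ.fst_le_self n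
    rcases Nat.eq_or_lt_of_le h1 with h | h
    · rw [← h]
      simp only [Nat.sub_self, zero_mul]
      push_cast at ih ⊢
      linarith
    · have h : φ.fst (n + 1) = φ.fst n + 1 := by omega
      have h' : φ.fst n + 1 - φ.fst n = 1 := by omega
      rw [h, h', one_mul]
      push_cast [h3] at ih ⊢
      linarith

lemma area_eq {p q s : ℕ} (h : p + q = s) (φ : ShufflePath p q) :
    2 * (φ.area : ℤ) + 2 * (∑ t : Fin (s + 1), (φ.fst t : ℤ)) + p * (p - 1) = 2 * s * p := by
  subst h
  have := φ.area_aux (p + q)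
  rw [φ.final _ le_rfl] at this
  rw [area, Fin.sum_univ_eq_sum_range fun t => (φ.fst t : ℤ)]
  exact_mod_cast this

/-- All steps of the path at the vertex `k` are in the first direction. -/
def IsX {p q : ℕ} (φ : ShufflePath p q) (k : ℕ) : Prop :=
  (∀ t, t + 1 = k → φ.fst k = φ.fst t + 1) ∧ (k < p + q → φ.fst (k + 1) = φ.fst k + 1)

/-- All steps of the path at the vertex `k` are in the second direction. -/
def IsY {p q : ℕ} (φ : ShufflePath p q) (k : ℕ) : Prop :=
  (∀ t, t + 1 = k → φ.fst k = φ.fst t) ∧ (k < p + q → φ.fst (k + 1) = φ.fst k)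

lemma corner {p q : ℕ} {φ : ShufflePath p q} {k : ℕ} (hk : k ≤ p + q)
    (hX : ¬ φ.IsX k) (hY : ¬ φ.IsY k) :
    ∃ t, k = t + 1 ∧ k < p + q ∧ φ.fst (k + 1) = φ.fst t + 1 := by
  rcases k with _ | t
  · exfalso
    have h1 := φ.le_succ 0
    have h2 := φ.succ_le 0
    by_cases h : φ.fst (0 + 1) = φ.fst 0
    · exact hY ⟨fun t ht => by omega, fun _ => h⟩
    · exact hX ⟨fun t ht => by omega, fun _ => by omega⟩
  · have h1 := φ.le_succ t
    have h2 := φ.succ_le t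
    have h3 := φ.le_succ (t + 1)
    have h4 := φ.succ_le (t + 1)
    refine ⟨t, rfl, ?_, ?_⟩
    · by_contra hlt
      by_cases h : φ.fst (t + 1) = φ.fst t
      · exact hY ⟨fun u hu => by obtain rfl : u = t := by omega
                                 exact h, fun h' => absurd h' hlt⟩
      · exact hX ⟨fun u hu => by obtain rfl : u = t := by omega
                                 omega, fun h' => absurd h' hlt⟩
    · by_contra hne
      by_cases h : φ.fst (t + 1) = φ.fst t
      · exact hY ⟨fun u hu => by obtain rfl : u = t := by omega
                                 exact h, fun _ => by omega⟩
      · exact hX ⟨fun u hu => by obtain rfl : u = t := by omega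
                                 omega, fun _ => by omega⟩

/-- Flip the corner of the path at the vertex `t + 1`. -/
def flip {p q : ℕ} (φ : ShufflePath p q) (t : ℕ) (ht : t + 1 < p + q)
    (h : φ.fst (t + 2) = φ.fst t + 1) : ShufflePath p q where
  fst u := if u = t + 1 then φ.fst t + φ.fst (t + 2) - φ.fst (t + 1) else φ.fst u
  zero := by simp [φ.zero]
  le_succ u := by
    have h1 := φ.le_succ u
    have h2 := φ.le_succ t
    have h3 := φ.succ_le t
    have h4 : t + 1 + 1 = t + 2 := rfl
    split_ifs with ha hb hb
    · omega
    · subst ha; rw [h4]; omega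
    · obtain rfl : u = t := by omega
      omega
    · exact h1
  succ_le u := by
    have h1 := φ.succ_le u
    have h2 := φ.le_succ t
    have h3 := φ.succ_le t
    split_ifs with ha hb hb
    · omega
    · obtain rfl : u = t := by omega
      omega
    · subst hb
      have h4 : φ.fst (t + 1 + 1) = φ.fst (t + 2) := rfl
      rw [h4]; omega
    · exact h1
  final u hu := by rw [if_neg (by omega)]; exact φ.final u hu

lemma flip_flip {p q : ℕ} (φ : ShufflePath p q) {t t' : ℕ} (ht : t + 1 < p + q)
    (h : φ.fst (t + 2) = φ.fst t + 1) (ht' : t' + 1 < p + q)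
    (h' : (φ.flip t ht h).fst (t' + 2) = (φ.flip t ht h).fst t' + 1) (e : t' = t) :
    (φ.flip t ht h).flip t' ht' h' = φ := by
  subst e
  ext u
  have h1 := φ.le_succ t'
  have h2 := φ.succ_le t'
  simp only [flip]
  by_cases hu : u = t' + 1
  · subst hu
    simp
    omega
  · simp [hu]

/-- Remove the vertex `k`, at which all steps are in the first direction. -/
def dropX {p q : ℕ} (φ : ShufflePath (p + 1) q) (k : ℕ) (hk : k ≤ p + 1 + q) (h : φ.IsX k) :
    ShufflePath p q where
  fst t := if t < k then φ.fst t else φ.fst (t + 1) - 1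
  zero := by
    have h0 := φ.zero
    have h1 := φ.succ_le 0
    split_ifs <;> omega
  le_succ t := by
    have h1 := φ.le_succ t
    have h2 := φ.le_succ (t + 1)
    have h3 := h.1 t
    split_ifs with ha hb hb
    · exact h1
    · have hk : t + 1 = k := by omega
      subst hk
      omega
    · omega
    · omega
  succ_le t := by
    have h1 := φ.succ_le t
    have h2 := φ.succ_le (t + 1)
    split_ifs with ha hb hb
    · exact h1
    · omega
    · obtain rfl : k = t + 1 := by omega
      have h3 := h.1 t rfl
      by_cases hk' : t + 1 < p + 1 + q
      · have := h.2 hk'; omega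
      · have := φ.final (t + 1) (by omega)
        have := φ.final (t + 1 + 1) (by omega)
        omega
    · have h4 : φ.fst (k + 1) ≤ φ.fst (t + 1) := φ.mono (by omega)
      have h5 : 1 ≤ φ.fst (t + 1) := by
        by_cases hk' : k < p + 1 + q
        · have := h.2 hk'; omega
        · rw [φ.final _ (by omega)]; omega
      omega
  final t ht := by
    split_ifs with ha
    · obtain rfl : k = t + 1 := by omega
      have := h.1 t rfl
      rw [φ.final (t + 1) (by omega)] at this
      omega
    · rw [φ.final _ (by omega)]; omega

/-- Remove the vertex `k`, at which all steps are in the second direction. -/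
def dropY {p q : ℕ} (φ : ShufflePath p (q + 1)) (k : ℕ) (hk : k ≤ p + (q + 1)) (h : φ.IsY k) :
    ShufflePath p q where
  fst t := if t < k then φ.fst t else φ.fst (t + 1)
  zero := by
    have h0 := φ.zero
    split_ifs with ha
    · exact h0
    · obtain rfl : k = 0 := by omega
      rw [h.2 (by omega), h0]
  le_succ t := by
    have h1 := φ.le_succ t
    have h2 := φ.le_succ (t + 1)
    split_ifs with ha hb hb <;> omega
  succ_le t := by
    have h1 := φ.succ_le t
    have h2 := φ.succ_le (t + 1)
    split_ifs with ha hb hb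
    · exact h1
    · omega
    · obtain rfl : k = t + 1 := by omega
      have := h.1 t rfl
      omega
    · exact h2
  final t ht := by
    split_ifs with ha
    · obtain rfl : k = t + 1 := by omega
      have := h.1 t rfl
      rw [φ.final (t + 1) (by omega)] at this
      omega
    · rw [φ.final _ (by omega)]

/-- The position at which a vertex with first coordinate `i` is inserted. -/
lemma exists_posX {p q : ℕ} (ψ : ShufflePath p q) (i : ℕ) :
    ∃ t, i ≤ ψ.fst t ∨ t = p + q + 1 := ⟨p + q + 1, Or.inr rfl⟩

/-- The position at which a vertex with second coordinate `j` is inserted. -/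
lemma exists_posY {p q : ℕ} (ψ : ShufflePath p q) (j : ℕ) :
    ∃ t, j ≤ t - ψ.fst t ∨ t = p + q + 1 := ⟨p + q + 1, Or.inr rfl⟩

open Classical in
/-- The position at which a vertex with first coordinate `i` is inserted. -/
noncomputable def posX {p q : ℕ} (ψ : ShufflePath p q) (i : ℕ) : ℕ := Nat.find (ψ.exists_posX i)

open Classical in
/-- The position at which a vertex with second coordinate `j` is inserted. -/
noncomputable def posY {p q : ℕ} (ψ : ShufflePath p q) (j : ℕ) : ℕ := Nat.find (ψ.exists_posY j)

lemma posX_spec {p q : ℕ} (ψ : ShufflePath p q) {i : ℕ} (hi : i ≤ p + 1) :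
    ψ.posX i ≤ p + q + 1 ∧ (∀ t, t < ψ.posX i → ψ.fst t < i) ∧
      (∀ t, t + 1 = ψ.posX i → ψ.fst t + 1 = i) ∧
      (ψ.posX i < p + q + 1 → ψ.fst (ψ.posX i) = i) ∧ (ψ.posX i = 0 → i = 0) := by
  classical
  have h1 : ψ.posX i ≤ p + q + 1 := Nat.find_min' (ψ.exists_posX i) (Or.inr rfl)
  have h2 : ∀ t, t < ψ.posX i → ψ.fst t < i := by
    intro t ht
    have := Nat.find_min (ψ.exists_posX i) ht
    push Not at this
    exact this.1
  have h3 : i ≤ ψ.fst (ψ.posX i) ∨ ψ.posX i = p + q + 1 := Nat.find_spec (ψ.exists_posX i)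
  have h4 : ∀ t, t + 1 = ψ.posX i → ψ.fst t + 1 = i := by
    intro t ht
    have ha := h2 t (by omega)
    rw [← ht] at h3
    rcases h3 with h | h
    · have := ψ.succ_le t; omega
    · have := ψ.final t (by omega); omega
  have h5 : ψ.posX i = 0 → i = 0 := by
    intro h
    rw [h, ψ.zero] at h3
    omega
  refine ⟨h1, h2, h4, fun h => ?_, h5⟩
  have h3 : i ≤ ψ.fst (ψ.posX i) := by omega
  rcases hk : ψ.posX i with _ | t
  · rw [h5 hk, ψ.zero]
  · rw [hk] at h3
    have := h4 t hk.symm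
    have := ψ.succ_le t
    omega

lemma posY_spec {p q : ℕ} (ψ : ShufflePath p q) {j : ℕ} (hj : j ≤ q + 1) :
    ψ.posY j ≤ p + q + 1 ∧ (∀ t, t < ψ.posY j → t - ψ.fst t < j) ∧
      (∀ t, t + 1 = ψ.posY j → t + 1 = ψ.fst t + j) ∧
      (ψ.posY j < p + q + 1 → ψ.posY j = ψ.fst (ψ.posY j) + j) ∧ (ψ.posY j = 0 → j = 0) := by
  classical
  have h1 : ψ.posY j ≤ p + q + 1 := Nat.find_min' (ψ.exists_posY j) (Or.inr rfl)
  have h2 : ∀ t, t < ψ.posY j → t - ψ.fst t < j := by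
    intro t ht
    have := Nat.find_min (ψ.exists_posY j) ht
    push Not at this
    exact this.1
  have h3 : j ≤ ψ.posY j - ψ.fst (ψ.posY j) ∨ ψ.posY j = p + q + 1 :=
    Nat.find_spec (ψ.exists_posY j)
  have h4 : ∀ t, t + 1 = ψ.posY j → t + 1 = ψ.fst t + j := by
    intro t ht
    have ha := h2 t (by omega)
    have hb := ψ.fst_le_self t
    rw [← ht] at h3
    rcases h3 with h | h
    · have := ψ.le_succ t; omega
    · have := ψ.final t (by omega); omega
  have h5 : ψ.posY j = 0 → j = 0 := by
    intro h
    rw [h, ψ.zero] at h3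
    omega
  refine ⟨h1, h2, h4, fun h => ?_, h5⟩
  have h3 : j ≤ ψ.posY j - ψ.fst (ψ.posY j) := by omega
  rcases hk : ψ.posY j with _ | t
  · rw [h5 hk, ψ.zero]
  · rw [hk] at h3
    have := h4 t hk.symm
    have := ψ.le_succ t
    have := ψ.fst_le_self (t + 1)
    omega

/-- Insert a vertex with first coordinate `i`. -/
noncomputable def insertX {p q : ℕ} (ψ : ShufflePath p q) (i : ℕ) (hi : i ≤ p + 1) :
    ShufflePath (p + 1) q where
  fst t := if t < ψ.posX i then ψ.fst t else if t = ψ.posX i then i else ψ.fst (t - 1) + 1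
  zero := by
    have h := (ψ.posX_spec hi).2.2.2.2
    have h0 := ψ.zero
    split_ifs with ha hb
    · exact h0
    · exact h hb.symm
    · omega
  le_succ t := by
    obtain ⟨h1, h2, h3, h4, h5⟩ := ψ.posX_spec hi
    generalize ψ.posX i = k at *
    rcases lt_trichotomy t k with h | rfl | h
    · rw [if_pos h]
      by_cases hk : t + 1 = k
      · rw [if_neg (by omega), if_pos hk]
        have := h3 t hk; omega
      · rw [if_pos (by omega)]; exact ψ.le_succ t
    · rw [if_neg (by omega), if_pos rfl, if_neg (by omega), if_neg (by omega)]
      simp only [Nat.add_sub_cancel]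
      by_cases ht : t < p + q + 1
      · rw [h4 ht]; omega
      · rw [ψ.final t (by omega)]; exact hi
    · rw [if_neg (by omega), if_neg (by omega), if_neg (by omega), if_neg (by omega)]
      have := ψ.mono (show t - 1 ≤ t + 1 - 1 by omega)
      omega
  succ_le t := by
    obtain ⟨h1, h2, h3, h4, h5⟩ := ψ.posX_spec hi
    generalize ψ.posX i = k at *
    rcases lt_trichotomy t k with h | rfl | h
    · rw [if_pos h]
      by_cases hk : t + 1 = k
      · rw [if_neg (by omega), if_pos hk]
        have := h3 t hk; omega
      · rw [if_pos (by omega)]; exact ψ.succ_le t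
    · rw [if_neg (by omega), if_neg (by omega), if_neg (by omega), if_pos rfl]
      simp only [Nat.add_sub_cancel]
      by_cases ht : t < p + q + 1
      · rw [h4 ht]
      · have h6 := h3 (t - 1) (by omega)
        have := ψ.succ_le (t - 1)
        rw [show t - 1 + 1 = t by omega] at this
        omega
    · rw [if_neg (by omega), if_neg (by omega), if_neg (by omega), if_neg (by omega)]
      have := ψ.succ_le (t - 1)
      rw [show t - 1 + 1 = t by omega] at this
      simp only [Nat.add_sub_cancel]
      omega
  final t ht := by
    obtain ⟨h1, h2, h3, h4, h5⟩ := ψ.posX_spec hi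
    rw [if_neg (by omega)]
    split_ifs with h
    · have h6 := h3 (t - 1) (by omega)
      rw [ψ.final _ (by omega)] at h6
      exact h6.symm
    · rw [ψ.final _ (by omega)]

/-- Insert a vertex with second coordinate `j`. -/
noncomputable def insertY {p q : ℕ} (ψ : ShufflePath p q) (j : ℕ) (hj : j ≤ q + 1) :
    ShufflePath p (q + 1) where
  fst t := if t < ψ.posY j then ψ.fst t else if t = ψ.posY j then t - j else ψ.fst (t - 1)
  zero := by
    have h0 := ψ.zero
    split_ifs with ha hb
    · exact h0
    · omega
    · exact h0
  le_succ t := by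
    obtain ⟨h1, h2, h3, h4, h5⟩ := ψ.posY_spec hj
    generalize ψ.posY j = k at *
    rcases lt_trichotomy t k with h | rfl | h
    · rw [if_pos h]
      by_cases hk : t + 1 = k
      · rw [if_neg (by omega), if_pos hk]
        have := h3 t hk; omega
      · rw [if_pos (by omega)]; exact ψ.le_succ t
    · rw [if_neg (by omega), if_pos rfl, if_neg (by omega), if_neg (by omega)]
      simp only [Nat.add_sub_cancel]
      by_cases ht : t < p + q + 1
      · have := h4 ht; omega
      · have h6 := h3 (t - 1) (by omega)
        have := ψ.mono (show t - 1 ≤ t by omega)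
        omega
    · rw [if_neg (by omega), if_neg (by omega), if_neg (by omega), if_neg (by omega)]
      exact ψ.mono (show t - 1 ≤ t + 1 - 1 by omega)
  succ_le t := by
    obtain ⟨h1, h2, h3, h4, h5⟩ := ψ.posY_spec hj
    generalize ψ.posY j = k at *
    rcases lt_trichotomy t k with h | rfl | h
    · rw [if_pos h]
      by_cases hk : t + 1 = k
      · rw [if_neg (by omega), if_pos hk]
        have := h3 t hk; omega
      · rw [if_pos (by omega)]; exact ψ.succ_le t
    · rw [if_neg (by omega), if_neg (by omega), if_neg (by omega), if_pos rfl]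
      simp only [Nat.add_sub_cancel]
      by_cases ht : t < p + q + 1
      · have := h4 ht; omega
      · have h6 := h3 (t - 1) (by omega)
        have := ψ.succ_le (t - 1)
        rw [show t - 1 + 1 = t by omega] at this
        omega
    · rw [if_neg (by omega), if_neg (by omega), if_neg (by omega), if_neg (by omega)]
      have := ψ.succ_le (t - 1)
      rw [show t - 1 + 1 = t by omega] at this
      simpa only [Nat.add_sub_cancel] using this
  final t ht := by
    obtain ⟨h1, h2, h3, h4, h5⟩ := ψ.posY_spec hj
    rw [if_neg (by omega)]
    split_ifs with h
    · have h6 := h3 (t - 1) (by omega)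
      rw [ψ.final _ (by omega)] at h6
      omega
    · rw [ψ.final _ (by omega)]

lemma dropX_fst {p q : ℕ} (φ : ShufflePath (p + 1) q) {k : ℕ} (hk : k ≤ p + 1 + q)
    (h : φ.IsX k) (t : ℕ) :
    (φ.dropX k hk h).fst t = if t < k then φ.fst t else φ.fst (t + 1) - 1 := rfl

lemma dropY_fst {p q : ℕ} (φ : ShufflePath p (q + 1)) {k : ℕ} (hk : k ≤ p + (q + 1))
    (h : φ.IsY k) (t : ℕ) :
    (φ.dropY k hk h).fst t = if t < k then φ.fst t else φ.fst (t + 1) := rfl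

lemma insertX_fst {p q : ℕ} (ψ : ShufflePath p q) {i : ℕ} (hi : i ≤ p + 1) (t : ℕ) :
    (ψ.insertX i hi).fst t =
      if t < ψ.posX i then ψ.fst t else if t = ψ.posX i then i else ψ.fst (t - 1) + 1 := rfl

lemma insertY_fst {p q : ℕ} (ψ : ShufflePath p q) {j : ℕ} (hj : j ≤ q + 1) (t : ℕ) :
    (ψ.insertY j hj).fst t =
      if t < ψ.posY j then ψ.fst t else if t = ψ.posY j then t - j else ψ.fst (t - 1) := rfl

lemma dropX_insertX {p q : ℕ} (ψ : ShufflePath p q) {i : ℕ} (hi : i ≤ p + 1)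
    (hk : ψ.posX i ≤ p + 1 + q) (h : (ψ.insertX i hi).IsX (ψ.posX i)) :
    (ψ.insertX i hi).dropX (ψ.posX i) hk h = ψ := by
  ext t
  simp only [dropX_fst, insertX_fst]
  split_ifs <;> first | omega | simp

lemma insertX_isX {p q : ℕ} (ψ : ShufflePath p q) {i : ℕ} (hi : i ≤ p + 1) :
    (ψ.insertX i hi).IsX (ψ.posX i) := by
  obtain ⟨h1, h2, h3, h4, h5⟩ := ψ.posX_spec hi
  constructor
  · intro t ht
    rw [insertX_fst, insertX_fst, if_neg (by omega), if_pos rfl, if_pos (by omega)]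
    exact (h3 t ht).symm
  · intro h
    rw [insertX_fst, insertX_fst, if_neg (by omega), if_neg (by omega), if_neg (by omega),
      if_pos rfl]
    simp only [Nat.add_sub_cancel]
    rw [h4 (by omega)]

lemma insertX_posX {p q : ℕ} (ψ : ShufflePath p q) {i : ℕ} (hi : i ≤ p + 1) :
    (ψ.insertX i hi).fst (ψ.posX i) = i := by simp [insertX]

lemma posX_dropX {p q : ℕ} (φ : ShufflePath (p + 1) q) {k : ℕ} (hk : k ≤ p + 1 + q)
    (h : φ.IsX k) : (φ.dropX k hk h).posX (φ.fst k) = k := by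
  classical
  rw [posX, Nat.find_eq_iff]
  constructor
  · by_cases hk' : k < p + 1 + q
    · left
      simp only [dropX, lt_irrefl, if_false]
      have := h.2 hk'; omega
    · right; omega
  · intro t ht
    push Not
    refine ⟨?_, by omega⟩
    simp only [dropX, ht, if_true]
    rcases k with _ | k
    · omega
    · have h1 := h.1 k rfl
      have h2 := φ.mono (show t ≤ k by omega)
      omega

lemma insertX_dropX {p q : ℕ} (φ : ShufflePath (p + 1) q) {k : ℕ} (hk : k ≤ p + 1 + q)
    (h : φ.IsX k) (hi : φ.fst k ≤ p + 1) : (φ.dropX k hk h).insertX (φ.fst k) hi = φ := by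
  ext t
  rw [insertX_fst, posX_dropX]
  simp only [dropX_fst]
  rcases lt_trichotomy t k with ht | rfl | ht
  · simp [ht]
  · simp
  · rw [if_neg (by omega), if_neg (by omega), if_neg (by omega),
      show t - 1 + 1 = t by omega]
    by_cases hk' : k < p + 1 + q
    · have h1 := h.2 hk'
      have h2 := φ.mono (show k + 1 ≤ t by omega)
      omega
    · rw [φ.final t (by omega)]; omega

lemma dropY_insertY {p q : ℕ} (ψ : ShufflePath p q) {j : ℕ} (hj : j ≤ q + 1)
    (hk : ψ.posY j ≤ p + (q + 1)) (h : (ψ.insertY j hj).IsY (ψ.posY j)) :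
    (ψ.insertY j hj).dropY (ψ.posY j) hk h = ψ := by
  ext t
  simp only [dropY_fst, insertY_fst]
  split_ifs <;> first | omega | simp

lemma insertY_isY {p q : ℕ} (ψ : ShufflePath p q) {j : ℕ} (hj : j ≤ q + 1) :
    (ψ.insertY j hj).IsY (ψ.posY j) := by
  obtain ⟨h1, h2, h3, h4, h5⟩ := ψ.posY_spec hj
  constructor
  · intro t ht
    rw [insertY_fst, insertY_fst, if_neg (by omega), if_pos rfl, if_pos (by omega)]
    have := h3 t ht; omega
  · intro h
    rw [insertY_fst, insertY_fst, if_neg (by omega), if_neg (by omega), if_neg (by omega),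
      if_pos rfl]
    simp only [Nat.add_sub_cancel]
    have := h4 (by omega)
    omega

lemma insertY_posY {p q : ℕ} (ψ : ShufflePath p q) {j : ℕ} (hj : j ≤ q + 1) :
    ψ.posY j = (ψ.insertY j hj).fst (ψ.posY j) + j := by
  obtain ⟨h1, h2, h3, h4, h5⟩ := ψ.posY_spec hj
  simp only [insertY, lt_irrefl, if_false, if_true]
  rcases hk : ψ.posY j with _ | t
  · rw [h5 hk]
  · have := h3 t hk.symm; omega

lemma posY_dropY {p q : ℕ} (φ : ShufflePath p (q + 1)) {k : ℕ} (hk : k ≤ p + (q + 1))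
    (h : φ.IsY k) : (φ.dropY k hk h).posY (k - φ.fst k) = k := by
  classical
  rw [posY, Nat.find_eq_iff]
  constructor
  · by_cases hk' : k < p + (q + 1)
    · left
      simp only [dropY, lt_irrefl, if_false]
      have := h.2 hk'; omega
    · right; omega
  · intro t ht
    push Not
    refine ⟨?_, by omega⟩
    simp only [dropY, ht, if_true]
    rcases k with _ | k
    · omega
    · have h1 := h.1 k rfl
      have h2 := φ.snd_mono (show t ≤ k by omega)
      have h3 := φ.fst_le_self k
      omega

lemma insertY_dropY {p q : ℕ} (φ : ShufflePath p (q + 1)) {k : ℕ} (hk : k ≤ p + (q + 1))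
    (h : φ.IsY k) (hj : k - φ.fst k ≤ q + 1) :
    (φ.dropY k hk h).insertY (k - φ.fst k) hj = φ := by
  have h0 := φ.fst_le_self k
  ext t
  rw [insertY_fst, posY_dropY]
  simp only [dropY_fst]
  rcases lt_trichotomy t k with ht | rfl | ht
  · simp [ht]
  · simp only [lt_irrefl, if_false, if_true]; omega
  · rw [if_neg (by omega), if_neg (by omega), if_neg (by omega),
      show t - 1 + 1 = t by omega]

lemma dropX_area {p q s : ℕ} (hs : p + q = s) (φ : ShufflePath (p + 1) q) (k : Fin (s + 2))
    (hk : (k : ℕ) ≤ p + 1 + q) (h : φ.IsX k) :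
    φ.area + φ.fst k = (φ.dropX k hk h).area + k := by
  have h1 := φ.area_eq (s := s + 1) (by omega)
  have h2 := (φ.dropX k hk h).area_eq hs
  rw [Fin.sum_univ_succAbove _ k] at h1
  have h3 : ∀ t : Fin (s + 1), (φ.fst (k.succAbove t) : ℤ) =
      ((φ.dropX k hk h).fst t : ℤ) + if (k : ℕ) ≤ t then 1 else 0 := by
    intro t
    simp only [dropX]
    by_cases ht : (t : ℕ) < k
    · rw [Fin.succAbove_of_castSucc_lt _ _ (by simpa [Fin.lt_def] using ht)]
      simp [ht]
    · rw [Fin.succAbove_of_le_castSucc _ _ (by simpa [Fin.le_def] using ht)]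
      have h5 : 1 ≤ φ.fst (t + 1) := by
        by_cases hk' : (k : ℕ) < p + 1 + q
        · have := h.2 hk'
          have := φ.mono (show (k : ℕ) + 1 ≤ t + 1 by omega)
          omega
        · rw [φ.final _ (by omega)]; omega
      rw [if_neg ht, if_pos (by omega), Fin.val_succ]
      omega
  have h4 : (∑ t : Fin (s + 1), if (k : ℕ) ≤ t then (1 : ℤ) else 0) = s + 1 - k := by
    rw [Fin.sum_univ_eq_sum_range fun t => if (k : ℕ) ≤ t then (1 : ℤ) else 0,
      ← Finset.sum_filter, Finset.sum_const, nsmul_one]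
    have : Finset.filter (fun t => (k : ℕ) ≤ t) (Finset.range (s + 1)) =
        Finset.Ico (k : ℕ) (s + 1) := by
      ext t; simp [and_comm]
    rw [this, Nat.card_Ico]
    have := k.2
    omega
  rw [Finset.sum_congr rfl fun t _ => h3 t, Finset.sum_add_distrib, h4] at h1
  push_cast at h1
  zify
  subst hs
  push_cast at h1 h2
  linarith

lemma dropY_area {p q s : ℕ} (hs : p + q = s) (φ : ShufflePath p (q + 1)) (k : Fin (s + 2))
    (hk : (k : ℕ) ≤ p + (q + 1)) (h : φ.IsY k) :
    φ.area + φ.fst k = (φ.dropY k hk h).area + p := by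
  have h1 := φ.area_eq (s := s + 1) (by omega)
  have h2 := (φ.dropY k hk h).area_eq hs
  rw [Fin.sum_univ_succAbove _ k] at h1
  have h3 : ∀ t : Fin (s + 1), (φ.fst (k.succAbove t) : ℤ) =
      ((φ.dropY k hk h).fst t : ℤ) := by
    intro t
    simp only [dropY]
    by_cases ht : (t : ℕ) < k
    · rw [Fin.succAbove_of_castSucc_lt _ _ (by simpa [Fin.lt_def] using ht)]
      simp [ht]
    · rw [Fin.succAbove_of_le_castSucc _ _ (by simpa [Fin.le_def] using ht)]
      rw [if_neg ht, Fin.val_succ]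
  rw [Finset.sum_congr rfl fun t _ => h3 t] at h1
  zify
  subst hs
  push_cast at h1 h2
  linarith

lemma flip_area {p q s : ℕ} (hs : p + q = s + 1) (φ : ShufflePath p q) {t : ℕ}
    (ht : t + 1 < p + q) (h : φ.fst (t + 2) = φ.fst t + 1) :
    (φ.flip t ht h).area = φ.area + 1 ∨ φ.area = (φ.flip t ht h).area + 1 := by
  have h1 := φ.area_eq hs
  have h2 := (φ.flip t ht h).area_eq hs
  have hk : t + 1 < s + 1 + 1 := by omega
  rw [Fin.sum_univ_succAbove _ (⟨t + 1, hk⟩ : Fin (s + 1 + 1))] at h1 h2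
  have h3 : ∀ u : Fin (s + 1), (φ.flip t ht h).fst ((⟨t + 1, hk⟩ : Fin (s + 1 + 1)).succAbove u) =
      φ.fst ((⟨t + 1, hk⟩ : Fin (s + 1 + 1)).succAbove u) := by
    intro u
    have hne := Fin.succAbove_ne (⟨t + 1, hk⟩ : Fin (s + 1 + 1)) u
    simp only [flip]
    rw [if_neg]
    intro h'
    exact hne (Fin.ext h')
  rw [Finset.sum_congr rfl fun u _ => by rw [h3 u]] at h2
  have h4 : (φ.flip t ht h).fst (t + 1) + φ.fst (t + 1) = 2 * φ.fst t + 1 := by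
    have := φ.le_succ t
    have := φ.succ_le t
    simp only [flip, if_true]
    omega
  have h5 := φ.le_succ t
  have h6 := φ.succ_le t
  simp only at h1 h2
  generalize (φ.flip t ht h).fst (t + 1) = x at *
  rcases Nat.eq_or_lt_of_le h5 with h7 | h7
  · right
    have h8 : x = φ.fst (t + 1) + 1 := by omega
    zify
    rw [h8] at h2
    push_cast at h1 h2
    linarith
  · left
    have h8 : φ.fst (t + 1) = x + 1 := by omega
    zify
    rw [h8] at h1
    push_cast at h1 h2
    linarith

section Boundary

open CategoryTheory Simplicial

lemma homFst_apply {p q s : ℕ} (h : p + q = s) (φ : ShufflePath p q) (t : Fin (s + 1)) :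
    (((φ.homFst h).toOrderHom t : Fin (p + 1)) : ℕ) = φ.fst t := rfl

lemma homSnd_apply {p q s : ℕ} (h : p + q = s) (φ : ShufflePath p q) (t : Fin (s + 1)) :
    (((φ.homSnd h).toOrderHom t : Fin (q + 1)) : ℕ) = t - φ.fst t := rfl

lemma hom_ext_val {m n : ℕ} {f g : ⦋m⦌ ⟶ ⦋n⦌}
    (h : ∀ t : Fin (m + 1), ((f.toOrderHom t : Fin (n + 1)) : ℕ) = (g.toOrderHom t : Fin (n + 1))) :
    f = g :=
  SimplexCategory.Hom.ext _ _ (OrderHom.ext _ _ (funext fun t => Fin.ext (h t)))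

lemma val_succAbove {n : ℕ} (k : Fin (n + 1)) (t : Fin n) :
    (k.succAbove t : ℕ) = if (t : ℕ) < k then (t : ℕ) else t + 1 := by
  by_cases ht : (t : ℕ) < k
  · rw [Fin.succAbove_of_castSucc_lt _ _ (by simpa [Fin.lt_def] using ht), if_pos ht]
    rfl
  · rw [Fin.succAbove_of_le_castSucc _ _ (by simpa [Fin.le_def] using ht), if_neg ht]
    rfl

lemma δ_comp_apply {m n : ℕ} (k : Fin (m + 2)) (f : ⦋m + 1⦌ ⟶ ⦋n⦌) (t : Fin (m + 1)) :
    (SimplexCategory.δ k ≫ f).toOrderHom t = f.toOrderHom (k.succAbove t) := rfl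

lemma comp_δ_apply {m n : ℕ} (k : Fin (n + 2)) (f : ⦋m⦌ ⟶ ⦋n⦌) (t : Fin (m + 1)) :
    (f ≫ SimplexCategory.δ k).toOrderHom t = k.succAbove (f.toOrderHom t) := rfl

lemma dropX_homFst {p q s : ℕ} (hs : p + q = s) (hs' : p + 1 + q = s + 1)
    (φ : ShufflePath (p + 1) q) (k : Fin (s + 2)) (hk : (k : ℕ) ≤ p + 1 + q) (h : φ.IsX k)
    (i : Fin (p + 2)) (hi : (i : ℕ) = φ.fst k) :
    SimplexCategory.δ k ≫ φ.homFst hs' = (φ.dropX k hk h).homFst hs ≫ SimplexCategory.δ i := by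
  refine hom_ext_val fun t => ?_
  rw [δ_comp_apply, comp_δ_apply, val_succAbove, homFst_apply, homFst_apply, val_succAbove,
    dropX_fst, hi]
  have ht2 := t.2
  by_cases ht : (t : ℕ) < k
  · rw [if_pos ht, if_pos ht, if_pos]
    have h1 := h.1 (k - 1) (by omega)
    have h2 := φ.mono (show (t : ℕ) ≤ k - 1 by omega)
    omega
  · rw [if_neg ht, if_neg ht]
    have h1 := h.2 (by omega)
    have h2 := φ.mono (show (k : ℕ) + 1 ≤ t + 1 by omega)
    rw [if_neg (by omega)]
    omega

lemma dropX_homSnd {p q s : ℕ} (hs : p + q = s) (hs' : p + 1 + q = s + 1)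
    (φ : ShufflePath (p + 1) q) (k : Fin (s + 2)) (hk : (k : ℕ) ≤ p + 1 + q) (h : φ.IsX k) :
    SimplexCategory.δ k ≫ φ.homSnd hs' = (φ.dropX k hk h).homSnd hs := by
  refine hom_ext_val fun t => ?_
  rw [δ_comp_apply, homSnd_apply, homSnd_apply, val_succAbove, dropX_fst]
  have ht2 := t.2
  by_cases ht : (t : ℕ) < k
  · rw [if_pos ht, if_pos ht]
  · rw [if_neg ht, if_neg ht]
    have h1 := h.2 (by omega)
    have h2 := φ.mono (show (k : ℕ) + 1 ≤ t + 1 by omega)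
    omega

lemma dropY_homFst {p q s : ℕ} (hs : p + q = s) (hs' : p + (q + 1) = s + 1)
    (φ : ShufflePath p (q + 1)) (k : Fin (s + 2)) (hk : (k : ℕ) ≤ p + (q + 1)) (h : φ.IsY k) :
    SimplexCategory.δ k ≫ φ.homFst hs' = (φ.dropY k hk h).homFst hs := by
  refine hom_ext_val fun t => ?_
  rw [δ_comp_apply, homFst_apply, homFst_apply, val_succAbove, dropY_fst]
  by_cases ht : (t : ℕ) < k
  · rw [if_pos ht, if_pos ht]
  · rw [if_neg ht, if_neg ht]

lemma dropY_homSnd {p q s : ℕ} (hs : p + q = s) (hs' : p + (q + 1) = s + 1)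
    (φ : ShufflePath p (q + 1)) (k : Fin (s + 2)) (hk : (k : ℕ) ≤ p + (q + 1)) (h : φ.IsY k)
    (j : Fin (q + 2)) (hj : (j : ℕ) = k - φ.fst k) :
    SimplexCategory.δ k ≫ φ.homSnd hs' = (φ.dropY k hk h).homSnd hs ≫ SimplexCategory.δ j := by
  refine hom_ext_val fun t => ?_
  rw [δ_comp_apply, comp_δ_apply, val_succAbove, homSnd_apply, homSnd_apply, val_succAbove,
    dropY_fst, hj]
  have ht2 := t.2
  have h0 := φ.fst_le_self k
  by_cases ht : (t : ℕ) < k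
  · rw [if_pos ht, if_pos ht, if_pos]
    have h1 := h.1 (k - 1) (by omega)
    have h2 := φ.snd_mono (show (t : ℕ) ≤ k - 1 by omega)
    have h3 := φ.fst_le_self t
    have h4 := φ.fst_le_self (k - 1)
    omega
  · rw [if_neg ht, if_neg ht]
    have h1 := h.2 (by omega)
    have h2 := φ.snd_mono (show (k : ℕ) + 1 ≤ t + 1 by omega)
    have h3 := φ.fst_le_self (t + 1)
    rw [if_neg (by omega)]
    omega

lemma flip_hom {p q s : ℕ} (hs : p + q = s + 1) (φ : ShufflePath p q) {t : ℕ}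
    (ht : t + 1 < p + q) (h : φ.fst (t + 2) = φ.fst t + 1) (k : Fin (s + 2))
    (hk : (k : ℕ) = t + 1) :
    SimplexCategory.δ k ≫ (φ.flip t ht h).homFst hs = SimplexCategory.δ k ≫ φ.homFst hs ∧
      SimplexCategory.δ k ≫ (φ.flip t ht h).homSnd hs = SimplexCategory.δ k ≫ φ.homSnd hs := by
  have key : ∀ u : Fin (s + 1), (φ.flip t ht h).fst (k.succAbove u) = φ.fst (k.succAbove u) := by
    intro u
    have hne := Fin.succAbove_ne k u
    simp only [flip]
    rw [if_neg]
    intro h'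
    exact hne (Fin.ext (by omega))
  constructor
  · refine hom_ext_val fun u => ?_
    rw [δ_comp_apply, δ_comp_apply, homFst_apply, homFst_apply, key]
  · refine hom_ext_val fun u => ?_
    rw [δ_comp_apply, δ_comp_apply, homSnd_apply, homSnd_apply, key]

lemma neg_one_pow_congr {a b : ℕ} (h : Even (a + b)) : (-1 : ℤ) ^ a = (-1) ^ b := by
  rcases Nat.even_or_odd a with ha | ha
  · rw [ha.neg_one_pow, ((Nat.even_add.1 h).1 ha).neg_one_pow]
  · rw [ha.neg_one_pow, ((Nat.even_add'.1 h).1 ha).neg_one_pow]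

/-- A summand of the boundary of a shuffle product. -/
def faceTerm {A : Type*} [AddCommGroup A] {p q s : ℕ} (hs : p + q = s + 1)
    (G : (⦋s⦌ ⟶ ⦋p⦌) → (⦋s⦌ ⟶ ⦋q⦌) → A) (φ : ShufflePath p q) (k : Fin (s + 2)) : A :=
  (-1 : ℤ) ^ (φ.area + k) •
    G (SimplexCategory.δ k ≫ φ.homFst hs) (SimplexCategory.δ k ≫ φ.homSnd hs)

lemma not_isX_and_isY {p q s : ℕ} (hs : p + q = s + 1) (φ : ShufflePath p q) (k : ℕ) :
    ¬ (φ.IsX k ∧ φ.IsY k) := by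
  rintro ⟨hX, hY⟩
  by_cases hk : k < p + q
  · have := hX.2 hk
    have := hY.2 hk
    omega
  · have := hX.1 (k - 1) (by omega)
    have := hY.1 (k - 1) (by omega)
    omega

open Classical in
lemma sum_faceTerm {A : Type*} [AddCommGroup A] {p q s : ℕ} (hs : p + q = s + 1)
    (G : (⦋s⦌ ⟶ ⦋p⦌) → (⦋s⦌ ⟶ ⦋q⦌) → A) :
    ∑ φ : ShufflePath p q, ∑ k, faceTerm hs G φ k =
      ∑ x : ShufflePath p q × Fin (s + 2) with x.1.IsX x.2, faceTerm hs G x.1 x.2 +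
      ∑ x : ShufflePath p q × Fin (s + 2) with x.1.IsY x.2, faceTerm hs G x.1 x.2 := by
  rw [← Fintype.sum_prod_type',
    ← Finset.sum_filter_add_sum_filter_not Finset.univ
      (fun x : ShufflePath p q × Fin (s + 2) => x.1.IsX x.2)]
  congr 1
  rw [← Finset.sum_filter_add_sum_filter_not _
      (fun x : ShufflePath p q × Fin (s + 2) => x.1.IsY x.2), Finset.filter_filter,
    Finset.filter_filter]
  have h0 : ∀ x : ShufflePath p q × Fin (s + 2), (¬ x.1.IsX x.2 ∧ x.1.IsY x.2) ↔ x.1.IsY x.2 :=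
    fun x => ⟨fun h => h.2, fun h => ⟨fun h' => not_isX_and_isY hs _ _ ⟨h', h⟩, h⟩⟩
  simp only [h0]
  rw [add_eq_left]
  have hc : ∀ x : ShufflePath p q × Fin (s + 2),
      x ∈ Finset.univ.filter
        (fun x : ShufflePath p q × Fin (s + 2) => ¬ x.1.IsX x.2 ∧ ¬ x.1.IsY x.2) →
      ∃ t, (x.2 : ℕ) = t + 1 ∧ t + 1 < p + q ∧ x.1.fst (t + 2) = x.1.fst t + 1 := by
    intro x hx
    have hx := (Finset.mem_filter.1 hx).2
    obtain ⟨t, h1, h2, h3⟩ := corner (φ := x.1) (k := x.2) (by omega) hx.1 hx.2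
    exact ⟨t, h1, by omega, by rw [h1] at h3; exact h3⟩
  choose t h1 h2 h3 using hc
  refine Finset.sum_involution (fun x hx => (x.1.flip (t x hx) (h2 x hx) (h3 x hx), x.2))
    ?_ ?_ ?_ ?_
  · intro x hx
    simp only [faceTerm]
    obtain ⟨ha, hb⟩ := flip_hom hs x.1 (h2 x hx) (h3 x hx) x.2 (h1 x hx)
    rw [ha, hb, ← add_smul]
    have : (-1 : ℤ) ^ (x.1.area + x.2) +
        (-1 : ℤ) ^ ((x.1.flip (t x hx) (h2 x hx) (h3 x hx)).area + x.2) = 0 := by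
      rcases flip_area hs x.1 (h2 x hx) (h3 x hx) with h | h <;> rw [h] <;> ring
    rw [this, zero_smul]
  · intro x hx _ h
    have h' := congrArg (fun y : ShufflePath p q × Fin (s + 2) => y.1.area) h
    simp only at h'
    rcases flip_area hs x.1 (h2 x hx) (h3 x hx) with h | h <;> omega
  · intro x hx
    have e1 := h1 x hx
    have e2 := h2 x hx
    have e3 := h3 x hx
    rw [Finset.mem_filter] at hx ⊢
    refine ⟨Finset.mem_univ _, ?_, ?_⟩
    · intro hX
      have := hX.1 (t x (Finset.mem_filter.2 hx)) e1.symm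
      have h' := hX.2 (by simp only; omega)
      simp only [flip, e1, if_true] at this h'
      rw [if_neg (by omega)] at this h'
      have e4 : x.1.fst (t x (Finset.mem_filter.2 hx) + 1 + 1) =
        x.1.fst (t x (Finset.mem_filter.2 hx) + 2) := rfl
      omega
    · intro hY
      have := hY.1 (t x (Finset.mem_filter.2 hx)) e1.symm
      have h' := hY.2 (by simp only; omega)
      simp only [flip, e1, if_true] at this h'
      rw [if_neg (by omega)] at this h'
      have e4 : x.1.fst (t x (Finset.mem_filter.2 hx) + 1 + 1) =
        x.1.fst (t x (Finset.mem_filter.2 hx) + 2) := rfl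
      omega
  · intro x hx
    have e1 := h1 x hx
    have e3 := h3 x hx
    have aux : ∀ hy, t (x.1.flip (t x hx) (h2 x hx) (h3 x hx), x.2) hy = t x hx := by
      intro hy
      have := h1 _ hy
      simp only at this
      omega
    refine Prod.ext ?_ rfl
    refine flip_flip x.1 (h2 x hx) (h3 x hx) ?_ ?_ ?_
    · exact h2 _ _
    · exact h3 (x.1.flip (t x hx) (h2 x hx) (h3 x hx), x.2) _
    · exact aux _

open Classical in
lemma sum_isX {A : Type*} [AddCommGroup A] {p q s : ℕ} (hs : p + q = s)
    (hs' : p + 1 + q = s + 1) (G : (⦋s⦌ ⟶ ⦋p + 1⦌) → (⦋s⦌ ⟶ ⦋q⦌) → A) :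
    ∑ x : ShufflePath (p + 1) q × Fin (s + 2) with x.1.IsX x.2, faceTerm hs' G x.1 x.2 =
      ∑ ψ : ShufflePath p q, ∑ i : Fin (p + 2), (-1 : ℤ) ^ (ψ.area + i) •
        G (ψ.homFst hs ≫ SimplexCategory.δ i) (ψ.homSnd hs) := by
  rw [← Fintype.sum_prod_type']
  refine Finset.sum_bij'
    (fun x hx => (x.1.dropX x.2 (by have := x.2.2; omega) (Finset.mem_filter.1 hx).2,
      ⟨x.1.fst x.2, Nat.lt_succ_of_le (x.1.fst_le _)⟩))
    (fun y _ => (y.1.insertX y.2 (Nat.le_of_lt_succ y.2.2),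
      ⟨y.1.posX y.2, by
        have := (y.1.posX_spec (Nat.le_of_lt_succ y.2.2)).1
        omega⟩)) ?_ ?_ ?_ ?_ ?_
  · exact fun _ _ => Finset.mem_univ _
  · exact fun y _ => Finset.mem_filter.2 ⟨Finset.mem_univ _, insertX_isX _ (Nat.le_of_lt_succ y.2.2)⟩
  · intro x hx
    have hk : (x.2 : ℕ) ≤ p + 1 + q := by have := x.2.2; omega
    have hh := (Finset.mem_filter.1 hx).2
    refine Prod.ext ?_ (Fin.ext ?_)
    · exact insertX_dropX _ hk hh (x.1.fst_le _)
    · exact posX_dropX _ hk hh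
  · intro y _
    refine Prod.ext ?_ (Fin.ext ?_)
    · have hy := Nat.le_of_lt_succ y.2.2
      have hb := (y.1.posX_spec hy).1
      exact dropX_insertX _ hy (by omega) (insertX_isX _ hy)
    · exact insertX_posX _ (Nat.le_of_lt_succ y.2.2)
  · intro x hx
    have hk : (x.2 : ℕ) ≤ p + 1 + q := by have := x.2.2; omega
    have hX := (Finset.mem_filter.1 hx).2
    simp only [faceTerm]
    rw [dropX_homFst hs hs' x.1 x.2 hk hX ⟨x.1.fst x.2, Nat.lt_succ_of_le (x.1.fst_le _)⟩ rfl,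
      dropX_homSnd hs hs' x.1 x.2 hk hX]
    congr 1
    apply neg_one_pow_congr
    have := dropX_area hs x.1 x.2 hk hX
    exact ⟨x.1.area + x.1.fst x.2, by omega⟩

open Classical in
lemma sum_isY {A : Type*} [AddCommGroup A] {p q s : ℕ} (hs : p + q = s)
    (hs' : p + (q + 1) = s + 1) (G : (⦋s⦌ ⟶ ⦋p⦌) → (⦋s⦌ ⟶ ⦋q + 1⦌) → A) :
    ∑ x : ShufflePath p (q + 1) × Fin (s + 2) with x.1.IsY x.2, faceTerm hs' G x.1 x.2 =
      (-1 : ℤ) ^ p • ∑ ψ : ShufflePath p q, ∑ j : Fin (q + 2), (-1 : ℤ) ^ (ψ.area + j) •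
        G (ψ.homFst hs) (ψ.homSnd hs ≫ SimplexCategory.δ j) := by
  rw [← Fintype.sum_prod_type', Finset.smul_sum]
  refine Finset.sum_bij'
    (fun x hx => (x.1.dropY x.2 (by have := x.2.2; omega) (Finset.mem_filter.1 hx).2,
      ⟨x.2 - x.1.fst x.2, by
        have := x.1.le_fst_add (t := x.2) (by have := x.2.2; omega)
        omega⟩))
    (fun y _ => (y.1.insertY y.2 (Nat.le_of_lt_succ y.2.2),
      ⟨y.1.posY y.2, by
        have := (y.1.posY_spec (Nat.le_of_lt_succ y.2.2)).1
        omega⟩)) ?_ ?_ ?_ ?_ ?_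
  · exact fun _ _ => Finset.mem_univ _
  · exact fun y _ => Finset.mem_filter.2 ⟨Finset.mem_univ _, insertY_isY _ (Nat.le_of_lt_succ y.2.2)⟩
  · intro x hx
    have hk : (x.2 : ℕ) ≤ p + (q + 1) := by have := x.2.2; omega
    have hh := (Finset.mem_filter.1 hx).2
    refine Prod.ext ?_ (Fin.ext ?_)
    · exact insertY_dropY _ hk hh (by have := x.1.le_fst_add hk; omega)
    · exact posY_dropY _ hk hh
  · intro y _
    refine Prod.ext ?_ (Fin.ext ?_)
    · have hy := Nat.le_of_lt_succ y.2.2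
      have hb := (y.1.posY_spec hy).1
      exact dropY_insertY _ hy (by omega) (insertY_isY _ hy)
    · have := insertY_posY y.1 (Nat.le_of_lt_succ y.2.2)
      simp only
      omega
  · intro x hx
    have hk : (x.2 : ℕ) ≤ p + (q + 1) := by have := x.2.2; omega
    have hY := (Finset.mem_filter.1 hx).2
    have hj := x.1.le_fst_add (t := x.2) hk
    have h0 := x.1.fst_le_self x.2
    simp only [faceTerm]
    rw [dropY_homFst hs hs' x.1 x.2 hk hY,
      dropY_homSnd hs hs' x.1 x.2 hk hY ⟨x.2 - x.1.fst x.2, by omega⟩ rfl, smul_smul, ← pow_add]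
    congr 2
    have := dropY_area hs x.1 x.2 hk hY
    omega

lemma not_isX_zero {q s : ℕ} (hs : 0 + q = s + 1) (φ : ShufflePath 0 q) (k : ℕ) : ¬ φ.IsX k := by
  intro h
  have h1 := φ.fst_le k
  have h2 := φ.fst_le (k + 1)
  by_cases hk : k < 0 + q
  · have := h.2 hk; omega
  · have := h.1 (k - 1) (by omega); omega

lemma not_isY_zero {p s : ℕ} (hs : p + 0 = s + 1) (φ : ShufflePath p 0) (k : ℕ)
    (hk : k ≤ s + 1) : ¬ φ.IsY k := by
  intro h
  have h1 := φ.le_fst_add (t := k) (by omega)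
  have h2 := φ.fst_le_self k
  by_cases hk' : k < p + 0
  · have := h.2 hk'
    have := φ.le_fst_add (t := k + 1) (by omega)
    omega
  · have := h.1 (k - 1) (by omega)
    have := φ.fst_le_self (k - 1)
    omega

end Boundary

end ShufflePath

namespace SimplicialCross

open CategoryTheory Simplicial Limits MonoidalCategory

/-- The simplicial chains with coefficients in `k`. -/
noncomputable abbrev Chains (k : Type) [CommRing k] (X : SSet.{0}) (n : ℕ) : ModuleCat.{0} k :=
  (X.chainComplex (ModuleCat.of k k)).X n

/-- A simplex as a chain. -/
noncomputable def gen (k : Type) [CommRing k] {X : SSet.{0}} {n : ℕ} (x : X _⦋n⦌) :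
    Chains k X n := (X.ιChainComplex (R := ModuleCat.of k k) x).hom (1 : k)

/-- The linear map on chains with given values on the simplices. -/
noncomputable def lift (k : Type) [CommRing k] {X : SSet.{0}} {n : ℕ} {M : Type}
    [AddCommGroup M] [Module k M] (f : X _⦋n⦌ → M) : Chains k X n →ₗ[k] M :=
  ((X.isColimitChainComplexXCofan (ModuleCat.of k k) n).desc
    (Cofan.mk (ModuleCat.of k M)
      fun x => ModuleCat.ofHom (LinearMap.toSpanSingleton k M (f x)))).hom

lemma lift_gen (k : Type) [CommRing k] {X : SSet.{0}} {n : ℕ} {M : Type}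
    [AddCommGroup M] [Module k M] (f : X _⦋n⦌ → M) (x : X _⦋n⦌) : lift k f (gen k x) = f x := by
  have h := (X.isColimitChainComplexXCofan (ModuleCat.of k k) n).fac
    (Cofan.mk (ModuleCat.of k M)
      fun x => ModuleCat.ofHom (LinearMap.toSpanSingleton k M (f x))) ⟨x⟩
  have h' := congrArg (fun g => g.hom (1 : k)) h
  have h'' : LinearMap.toSpanSingleton k M (f x) (1 : k) = f x := by simp
  exact h'.trans h''

lemma hom_ext {k : Type} [CommRing k] {X : SSet.{0}} {n : ℕ} {M : Type}
    [AddCommGroup M] [Module k M] {f g : Chains k X n →ₗ[k] M}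
    (h : ∀ x : X _⦋n⦌, f (gen k x) = g (gen k x)) : f = g := by
  have : (ModuleCat.ofHom f : Chains k X n ⟶ ModuleCat.of k M) = ModuleCat.ofHom g := by
    apply SSet.chainComplex_hom_ext
    intro x
    apply ModuleCat.hom_ext
    apply LinearMap.ext_ring
    exact h x
  exact congrArg ModuleCat.Hom.hom this

lemma d_gen (k : Type) [CommRing k] {X : SSet.{0}} {n : ℕ} (x : X _⦋n + 1⦌) :
    ((X.chainComplex (ModuleCat.of k k)).d (n + 1) n).hom (gen k x) =
      ∑ i : Fin (n + 2), (-1 : ℤ) ^ (i : ℕ) • gen k (X.δ i x) := by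
  have h := congrArg (fun g => g.hom (1 : k))
    (SSet.ιChainComplex_d (C := ModuleCat.{0} k) X (ModuleCat.of k k) x)
  refine Eq.trans h ?_
  simp only [ModuleCat.hom_sum, LinearMap.sum_apply, gen]
  refine Finset.sum_congr rfl fun i _ => ?_
  rfl

/-- A simplex of a product of simplicial sets. -/
def pair {X Y : SSet.{0}} {n : ℕ} (x : X _⦋n⦌) (y : Y _⦋n⦌) : (X ⊗ Y : SSet.{0}) _⦋n⦌ := (x, y)

lemma δ_pair {X Y : SSet.{0}} {n : ℕ} (i : Fin (n + 2)) (x : X _⦋n + 1⦌) (y : Y _⦋n + 1⦌) :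
    (X ⊗ Y : SSet.{0}).δ i (pair x y) = pair (X.δ i x) (Y.δ i y) := rfl

/-- The cross product on simplicial chains: the shuffle map. -/
noncomputable def cross (k : Type) [CommRing k] (X Y : SSet.{0}) {p q s : ℕ} (h : p + q = s) :
    Chains k X p →ₗ[k] Chains k Y q →ₗ[k] Chains k (X ⊗ Y) s :=
  lift k fun x => lift k fun y => ∑ φ : ShufflePath p q, (-1 : ℤ) ^ φ.area •
    gen k (pair (X.map (φ.homFst h).op x) (Y.map (φ.homSnd h).op y))

lemma cross_gen (k : Type) [CommRing k] {X Y : SSet.{0}} {p q s : ℕ} (h : p + q = s)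
    (x : X _⦋p⦌) (y : Y _⦋q⦌) :
    cross k X Y h (gen k x) (gen k y) = ∑ φ : ShufflePath p q, (-1 : ℤ) ^ φ.area •
      gen k (pair (X.map (φ.homFst h).op x) (Y.map (φ.homSnd h).op y)) := by
  rw [cross, lift_gen, lift_gen]

lemma d_cross_gen (k : Type) [CommRing k] {X Y : SSet.{0}} {p q s : ℕ} (h : p + q = s + 1)
    (x : X _⦋p⦌) (y : Y _⦋q⦌) :
    (((X ⊗ Y : SSet.{0}).chainComplex (ModuleCat.of k k)).d (s + 1) s).hom
      (cross k X Y h (gen k x) (gen k y)) =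
    ∑ φ : ShufflePath p q, ∑ i, ShufflePath.faceTerm h (fun f g =>
      gen k (pair (X.map f.op x) (Y.map g.op y))) φ i := by
  rw [cross_gen, map_sum]
  refine Finset.sum_congr rfl fun φ _ => ?_
  rw [map_zsmul, d_gen, Finset.smul_sum]
  refine Finset.sum_congr rfl fun i _ => ?_
  rw [smul_smul, ← pow_add, ShufflePath.faceTerm, δ_pair, op_comp, op_comp, Functor.map_comp,
    Functor.map_comp]
  rfl

lemma cross_d_left_gen (k : Type) [CommRing k] {X Y : SSet.{0}} {p q s : ℕ} (h : p + q = s)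
    (x : X _⦋p + 1⦌) (y : Y _⦋q⦌) :
    cross k X Y h (((X.chainComplex (ModuleCat.of k k)).d (p + 1) p).hom (gen k x)) (gen k y) =
    ∑ ψ : ShufflePath p q, ∑ i : Fin (p + 2), (-1 : ℤ) ^ (ψ.area + i) •
      gen k (pair (X.map (ψ.homFst h ≫ SimplexCategory.δ i).op x) (Y.map (ψ.homSnd h).op y)) := by
  rw [d_gen, map_sum, LinearMap.sum_apply, Finset.sum_comm]
  refine Finset.sum_congr rfl fun i _ => ?_
  rw [map_zsmul, LinearMap.smul_apply, cross_gen, Finset.smul_sum]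
  refine Finset.sum_congr rfl fun ψ _ => ?_
  rw [smul_smul, ← pow_add, add_comm, op_comp, Functor.map_comp]
  rfl

lemma cross_d_right_gen (k : Type) [CommRing k] {X Y : SSet.{0}} {p q s : ℕ} (h : p + q = s)
    (x : X _⦋p⦌) (y : Y _⦋q + 1⦌) :
    cross k X Y h (gen k x) (((Y.chainComplex (ModuleCat.of k k)).d (q + 1) q).hom (gen k y)) =
    ∑ ψ : ShufflePath p q, ∑ j : Fin (q + 2), (-1 : ℤ) ^ (ψ.area + j) •
      gen k (pair (X.map (ψ.homFst h).op x) (Y.map (ψ.homSnd h ≫ SimplexCategory.δ j).op y)) := by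
  rw [d_gen, map_sum, Finset.sum_comm]
  refine Finset.sum_congr rfl fun i _ => ?_
  rw [map_zsmul, cross_gen, Finset.smul_sum]
  refine Finset.sum_congr rfl fun ψ _ => ?_
  rw [smul_smul, ← pow_add, add_comm, op_comp, Functor.map_comp]
  rfl

lemma bilin_ext {k : Type} [CommRing k] {X Y : SSet.{0}} {p q : ℕ} {M : Type}
    [AddCommGroup M] [Module k M] {f g : Chains k X p →ₗ[k] Chains k Y q →ₗ[k] M}
    (h : ∀ (x : X _⦋p⦌) (y : Y _⦋q⦌), f (gen k x) (gen k y) = g (gen k x) (gen k y)) : f = g :=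
  hom_ext fun x => hom_ext fun y => h x y

lemma d_cross (k : Type) [CommRing k] {X Y : SSet.{0}} {p q s : ℕ} (h : p + 1 + (q + 1) = s + 1)
    (hl : p + (q + 1) = s) (hr : p + 1 + q = s) (a : Chains k X (p + 1)) (b : Chains k Y (q + 1)) :
    (((X ⊗ Y : SSet.{0}).chainComplex (ModuleCat.of k k)).d (s + 1) s).hom (cross k X Y h a b) =
      cross k X Y hl (((X.chainComplex (ModuleCat.of k k)).d (p + 1) p).hom a) b +
      (-1 : ℤ) ^ (p + 1) • cross k X Y hr a
        (((Y.chainComplex (ModuleCat.of k k)).d (q + 1) q).hom b) := by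
  classical
  have key : (cross k X Y h).compr₂
      (((X ⊗ Y : SSet.{0}).chainComplex (ModuleCat.of k k)).d (s + 1) s).hom =
      (cross k X Y hl).comp ((X.chainComplex (ModuleCat.of k k)).d (p + 1) p).hom +
      (-1 : ℤ) ^ (p + 1) • (cross k X Y hr).compl₂
        ((Y.chainComplex (ModuleCat.of k k)).d (q + 1) q).hom := by
    refine bilin_ext fun x y => ?_
    have e1 := d_cross_gen k h x y
    rw [ShufflePath.sum_faceTerm, ShufflePath.sum_isX hl, ShufflePath.sum_isY hr,
      ← cross_d_left_gen, ← cross_d_right_gen] at e1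
    exact e1
  exact congrArg (fun f => f a b) key

lemma d_cross_left (k : Type) [CommRing k] {X Y : SSet.{0}} {p s : ℕ} (h : p + 1 + 0 = s + 1)
    (hl : p + 0 = s) (a : Chains k X (p + 1)) (b : Chains k Y 0) :
    (((X ⊗ Y : SSet.{0}).chainComplex (ModuleCat.of k k)).d (s + 1) s).hom (cross k X Y h a b) =
      cross k X Y hl (((X.chainComplex (ModuleCat.of k k)).d (p + 1) p).hom a) b := by
  classical
  have key : (cross k X Y h).compr₂
      (((X ⊗ Y : SSet.{0}).chainComplex (ModuleCat.of k k)).d (s + 1) s).hom =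
      (cross k X Y hl).comp ((X.chainComplex (ModuleCat.of k k)).d (p + 1) p).hom := by
    refine bilin_ext fun x y => ?_
    have e1 := d_cross_gen k h x y
    rw [ShufflePath.sum_faceTerm, ShufflePath.sum_isX hl, ← cross_d_left_gen,
      Finset.filter_eq_empty_iff.2 fun z _ =>
        ShufflePath.not_isY_zero h z.1 z.2 (Nat.le_of_lt_succ z.2.2), Finset.sum_empty,
      add_zero] at e1
    exact e1
  exact congrArg (fun f => f a b) key

lemma d_cross_right (k : Type) [CommRing k] {X Y : SSet.{0}} {q s : ℕ} (h : 0 + (q + 1) = s + 1)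
    (hr : 0 + q = s) (a : Chains k X 0) (b : Chains k Y (q + 1)) :
    (((X ⊗ Y : SSet.{0}).chainComplex (ModuleCat.of k k)).d (s + 1) s).hom (cross k X Y h a b) =
      cross k X Y hr a (((Y.chainComplex (ModuleCat.of k k)).d (q + 1) q).hom b) := by
  classical
  have key : (cross k X Y h).compr₂
      (((X ⊗ Y : SSet.{0}).chainComplex (ModuleCat.of k k)).d (s + 1) s).hom =
      (cross k X Y hr).compl₂ ((Y.chainComplex (ModuleCat.of k k)).d (q + 1) q).hom := by
    refine bilin_ext fun x y => ?_
    have e1 := d_cross_gen k h x y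
    rw [ShufflePath.sum_faceTerm, ShufflePath.sum_isY hr, ← cross_d_right_gen,
      Finset.filter_eq_empty_iff.2 fun z _ => ShufflePath.not_isX_zero h z.1 z.2,
      Finset.sum_empty, zero_add, pow_zero, one_smul] at e1
    exact e1
  exact congrArg (fun f => f a b) key

lemma cross_cycle (k : Type) [CommRing k] {X Y : SSet.{0}} {p q s : ℕ} (h : p + q = s)
    (a : Chains k X p) (b : Chains k Y q)
    (ha : ∀ i, ((X.chainComplex (ModuleCat.of k k)).d p i).hom a = 0)
    (hb : ∀ i, ((Y.chainComplex (ModuleCat.of k k)).d q i).hom b = 0) (i : ℕ) :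
    (((X ⊗ Y : SSet.{0}).chainComplex (ModuleCat.of k k)).d s i).hom (cross k X Y h a b) = 0 := by
  by_cases hi : i + 1 = s
  · subst hi
    rcases p with _ | p
    · rcases q with _ | q
      · omega
      · rw [d_cross_right k h (by omega), hb, map_zero]
    · rcases q with _ | q
      · rw [d_cross_left k h (by omega), ha, map_zero, LinearMap.zero_apply]
      · rw [d_cross k h (by omega) (by omega), ha, hb, map_zero, map_zero, LinearMap.zero_apply,
          smul_zero, add_zero]
  · rw [HomologicalComplex.shape _ _ _ hi]
    rfl

lemma cross_boundary_left (k : Type) [CommRing k] {X Y : SSet.{0}} {p q s : ℕ} (h : p + q = s)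
    (j : ℕ) (c : Chains k X j) (b : Chains k Y q)
    (hb : ∀ i, ((Y.chainComplex (ModuleCat.of k k)).d q i).hom b = 0) :
    ∃ e, (((X ⊗ Y : SSet.{0}).chainComplex (ModuleCat.of k k)).d (s + 1) s).hom e =
      cross k X Y h (((X.chainComplex (ModuleCat.of k k)).d j p).hom c) b := by
  by_cases hj : p + 1 = j
  · subst hj
    refine ⟨cross k X Y (by omega) c b, ?_⟩
    rcases q with _ | q
    · rw [d_cross_left k _ h]
    · rw [d_cross k (by omega) h (by omega), hb, map_zero, smul_zero, add_zero]
  · refine ⟨0, ?_⟩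
    rw [HomologicalComplex.shape (X.chainComplex (ModuleCat.of k k)) j p hj, map_zero]
    exact (congrFun (congrArg DFunLike.coe (map_zero (cross k X Y h))) b).symm

lemma cross_boundary_right (k : Type) [CommRing k] {X Y : SSet.{0}} {p q s : ℕ} (h : p + q = s)
    (j : ℕ) (a : Chains k X p) (c : Chains k Y j)
    (ha : ∀ i, ((X.chainComplex (ModuleCat.of k k)).d p i).hom a = 0) :
    ∃ e, (((X ⊗ Y : SSet.{0}).chainComplex (ModuleCat.of k k)).d (s + 1) s).hom e =
      cross k X Y h a (((Y.chainComplex (ModuleCat.of k k)).d j q).hom c) := by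
  by_cases hj : q + 1 = j
  · subst hj
    rcases p with _ | p
    · exact ⟨cross k X Y (by omega) a c, d_cross_right k _ h _ _⟩
    · refine ⟨(-1 : ℤ) ^ (p + 1) • cross k X Y (by omega) a c, ?_⟩
      rw [map_zsmul, d_cross k (by omega) (by omega) h, ha, map_zero, LinearMap.zero_apply,
        zero_add, smul_smul, ← pow_add, Even.neg_one_pow ⟨_, rfl⟩, one_smul]
  · refine ⟨0, ?_⟩
    rw [HomologicalComplex.shape (Y.chainComplex (ModuleCat.of k k)) j q hj, map_zero]
    exact (map_zero (cross k X Y h a)).symm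

/-- Cycles modulo boundaries. -/
abbrev HomologyQuot (k : Type) [CommRing k] (X : SSet.{0}) (n : ℕ) : Type :=
  LinearMap.ker ((X.chainComplex (ModuleCat.of k k)).sc n).g.hom ⧸
    LinearMap.range ((X.chainComplex (ModuleCat.of k k)).sc n).moduleCatToCycles

lemma d_eq_zero {k : Type} [CommRing k] {X : SSet.{0}} {n : ℕ}
    (a : LinearMap.ker ((X.chainComplex (ModuleCat.of k k)).sc n).g.hom) (i : ℕ) :
    ((X.chainComplex (ModuleCat.of k k)).d n i).hom a.1 = 0 := by
  by_cases hi : (ComplexShape.down ℕ).Rel n i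
  · obtain rfl := (ComplexShape.down ℕ).next_eq' hi
    exact a.2
  · rw [HomologicalComplex.shape _ _ _ hi]
    rfl

/-- The cross product on cycles. -/
noncomputable def crossCycles (k : Type) [CommRing k] (X Y : SSet.{0}) {p q s : ℕ}
    (h : p + q = s) :
    LinearMap.ker ((X.chainComplex (ModuleCat.of k k)).sc p).g.hom →ₗ[k]
      LinearMap.ker ((Y.chainComplex (ModuleCat.of k k)).sc q).g.hom →ₗ[k]
        LinearMap.ker (((X ⊗ Y : SSet.{0}).chainComplex (ModuleCat.of k k)).sc s).g.hom :=
  LinearMap.mk₂ k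
    (fun a b => ⟨cross k X Y h a.1 b.1,
      cross_cycle k h a.1 b.1 (d_eq_zero a) (d_eq_zero b) _⟩)
    (fun a a' b => Subtype.ext (LinearMap.map_add₂ (cross k X Y h) a.1 a'.1 b.1))
    (fun r a b => Subtype.ext (LinearMap.map_smul₂ (cross k X Y h) r a.1 b.1))
    (fun a b b' => Subtype.ext (map_add (cross k X Y h a.1) b.1 b'.1))
    (fun r a b => Subtype.ext (map_smul (cross k X Y h a.1) r b.1))

lemma mkQ_eq_zero {k : Type} [CommRing k] {X : SSet.{0}} {n : ℕ}
    (a : LinearMap.ker ((X.chainComplex (ModuleCat.of k k)).sc n).g.hom)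
    (h : ∃ e, ((X.chainComplex (ModuleCat.of k k)).d (n + 1) n).hom e = a.1) :
    (Submodule.Quotient.mk a : HomologyQuot k X n) = 0 := by
  rw [Submodule.Quotient.mk_eq_zero]
  obtain ⟨e, he⟩ := h
  have hj' : n + 1 = (ComplexShape.down ℕ).prev n := ((ComplexShape.down ℕ).prev_eq' rfl).symm
  have : ∀ j, n + 1 = j → ∃ e, ((X.chainComplex (ModuleCat.of k k)).d j n).hom e = a.1 := by
    rintro j rfl
    exact ⟨e, he⟩
  obtain ⟨e', he'⟩ := this _ hj'
  exact ⟨e', Subtype.ext he'⟩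

/-- The cross product on cycles modulo boundaries. -/
noncomputable def crossQuot (k : Type) [CommRing k] (X Y : SSet.{0}) {p q s : ℕ}
    (h : p + q = s) : HomologyQuot k X p →ₗ[k] HomologyQuot k Y q →ₗ[k] HomologyQuot k (X ⊗ Y) s :=
  (Submodule.liftQ _
    (Submodule.liftQ _ ((crossCycles k X Y h).compr₂ (Submodule.mkQ _)) (by
      rintro _ ⟨c, rfl⟩
      refine LinearMap.ext fun b => mkQ_eq_zero _ ?_
      exact cross_boundary_left k h _ c b.1 (d_eq_zero b))).flip (by
    rintro _ ⟨c, rfl⟩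
    refine LinearMap.ext fun a => ?_
    induction a using Submodule.Quotient.induction_on with
    | _ a => exact mkQ_eq_zero _ (cross_boundary_right k h _ a.1 c (d_eq_zero a)))).flip

/-- The cross product in the homology of simplicial sets. -/
noncomputable def crossHomology (k : Type) [CommRing k] (X Y : SSet.{0}) {p q s : ℕ}
    (h : p + q = s) :
    (X.chainComplex (ModuleCat.of k k)).homology p →ₗ[k]
      (Y.chainComplex (ModuleCat.of k k)).homology q →ₗ[k]
        ((X ⊗ Y : SSet.{0}).chainComplex (ModuleCat.of k k)).homology s :=
  ((crossQuot k X Y h).compl₁₂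
    ((X.chainComplex (ModuleCat.of k k)).sc p).moduleCatHomologyIso.hom.hom
    ((Y.chainComplex (ModuleCat.of k k)).sc q).moduleCatHomologyIso.hom.hom).compr₂
    (((X ⊗ Y : SSet.{0}).chainComplex (ModuleCat.of k k)).sc s).moduleCatHomologyIso.inv.hom

end SimplicialCross

/-! ### Singular homology -/

open CategoryTheory in
/-- Singular homology in degree `d` with coefficients in `k`. -/
noncomputable abbrev SingularHomology (k : Type) [CommRing k] (X : Type) [TopologicalSpace X]
    (d : ℕ) : ModuleCat.{0} k :=
  (TopCat.toSSet.obj (TopCat.of X)).homology (ModuleCat.of k k) d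

namespace SingularHomology

open CategoryTheory MonoidalCategory

/-- The linear map induced by a continuous map. -/
noncomputable def map (k : Type) [CommRing k] {X Y : Type} [TopologicalSpace X]
    [TopologicalSpace Y] (f : C(X, Y)) (d : ℕ) :
    SingularHomology k X d →ₗ[k] SingularHomology k Y d :=
  (SSet.homologyMap (TopCat.toSSet.map (TopCat.ofHom f)) (ModuleCat.of k k) d).hom

/-- Pairs of singular simplices are singular simplices of the product. -/
noncomputable def prodMap (X Y : Type) [TopologicalSpace X] [TopologicalSpace Y] :
    TopCat.toSSet.obj (TopCat.of X) ⊗ TopCat.toSSet.obj (TopCat.of Y) ⟶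
      TopCat.toSSet.obj (TopCat.of (X × Y)) where
  app _ := TypeCat.ofHom fun p => ⟨TopCat.ofHom (p.1.down.hom.prodMk p.2.down.hom)⟩
  naturality _ _ _ := rfl

/-- The homology cross product `H_p(X) × H_q(Y) → H_{p+q}(X × Y)`. -/
noncomputable def cross (k : Type) [CommRing k] (X Y : Type) [TopologicalSpace X]
    [TopologicalSpace Y] {p q s : ℕ} (h : p + q = s) :
    SingularHomology k X p →ₗ[k] SingularHomology k Y q →ₗ[k] SingularHomology k (X × Y) s :=
  (SimplicialCross.crossHomology k _ _ h).compr₂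
    (SSet.homologyMap (prodMap X Y) (ModuleCat.of k k) s).hom

end SingularHomology

/-! ### Graded operads and the homology of topological operads -/

/-- The data underlying a graded quasi-operad of `k`-modules: graded modules, actions of the
symmetric groups and compositions of degree zero. -/
structure GradedCollection (k : Type) [CommRing k] where
  /-- the module of arity `n + 1` and degree `p` -/
  obj : ℕ → ℕ → ModuleCat.{0} k
  /-- the action of the symmetric group -/
  act : ∀ {n : ℕ}, Equiv.Perm (Fin (n + 1)) → ∀ p : ℕ, obj n p →ₗ[k] obj n p
  /-- the composition `∘ᵢ` -/
  comp : ∀ {m n l : ℕ}, m + n = l → Fin (m + 1) → ∀ {p q s : ℕ}, p + q = s →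
    (obj m p →ₗ[k] obj n q →ₗ[k] obj l s)

namespace GradedCollection

/-- Graded quasi-operads. -/
structure IsQuasiOperad {k : Type} [CommRing k] (A : GradedCollection k) : Prop where
  act_one : ∀ {n : ℕ} (p : ℕ) (a : A.obj n p), A.act 1 p a = a
  act_mul : ∀ {n : ℕ} (σ τ : Equiv.Perm (Fin (n + 1))) (p : ℕ) (a : A.obj n p),
    A.act (σ * τ) p a = A.act σ p (A.act τ p a)
  equivariant : ∀ {m n l : ℕ} (h : m + n = l) (i : Fin (m + 1))
    (σ : Equiv.Perm (Fin (m + 1))) (τ : Equiv.Perm (Fin (n + 1))) {p q s : ℕ} (hs : p + q = s)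
    (a : A.obj m p) (b : A.obj n q),
    A.comp h (σ i) hs (A.act σ p a) (A.act τ q b) =
      A.act (blockPerm h i σ τ) s (A.comp h i hs a b)

/-- Graded operads: the compositions are associative, with the sign of the interchange of the
second and the third argument. -/
structure IsOperad {k : Type} [CommRing k] (A : GradedCollection k) : Prop
    extends A.IsQuasiOperad where
  /-- `(a ∘ᵢ b) ∘ⱼ c` for `j` before the inputs of `b` -/
  assoc_left : ∀ {k l m kl km n : ℕ} (hkl : k + l = kl) (hkm : k + m = km) (hn : kl + m = n)
    (hn' : km + l = n) (i j : Fin (k + 1)) (j' : Fin (kl + 1)) (i' : Fin (km + 1)),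
    j < i → (j' : ℕ) = j → (i' : ℕ) = i + m →
    ∀ {p q r pq pr s : ℕ} (hpq : p + q = pq) (hpr : p + r = pr) (hs : pq + r = s)
    (hs' : pr + q = s) (a : A.obj k p) (b : A.obj l q) (c : A.obj m r),
    A.comp hn j' hs (A.comp hkl i hpq a b) c =
      (-1 : ℤ) ^ (q * r) • A.comp hn' i' hs' (A.comp hkm j hpr a c) b
  /-- `(a ∘ᵢ b) ∘ⱼ c` for `j` among the inputs of `b` -/
  assoc_middle : ∀ {k l m kl lm n : ℕ} (hkl : k + l = kl) (hlm : l + m = lm) (hn : kl + m = n)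
    (hn' : k + lm = n) (i : Fin (k + 1)) (j : Fin (l + 1)) (j' : Fin (kl + 1)),
    (j' : ℕ) = i + j →
    ∀ {p q r pq qr s : ℕ} (hpq : p + q = pq) (hqr : q + r = qr) (hs : pq + r = s)
    (hs' : p + qr = s) (a : A.obj k p) (b : A.obj l q) (c : A.obj m r),
    A.comp hn j' hs (A.comp hkl i hpq a b) c = A.comp hn' i hs' a (A.comp hlm j hqr b c)
  /-- `(a ∘ᵢ b) ∘ⱼ c` for `j` after the inputs of `b` -/
  assoc_right : ∀ {k l m kl km n : ℕ} (hkl : k + l = kl) (hkm : k + m = km) (hn : kl + m = n)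
    (hn' : km + l = n) (i j : Fin (k + 1)) (j' : Fin (kl + 1)) (i' : Fin (km + 1)),
    i < j → (j' : ℕ) = j + l → (i' : ℕ) = i →
    ∀ {p q r pq pr s : ℕ} (hpq : p + q = pq) (hpr : p + r = pr) (hs : pq + r = s)
    (hs' : pr + q = s) (a : A.obj k p) (b : A.obj l q) (c : A.obj m r),
    A.comp hn j' hs (A.comp hkl i hpq a b) c =
      (-1 : ℤ) ^ (q * r) • A.comp hn' i' hs' (A.comp hkm j hpr a c) b

/-- Isomorphy of graded (quasi-)operads. -/
def Isomorphic {k : Type} [CommRing k] (A B : GradedCollection k) : Prop :=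
  ∃ f : ∀ n p : ℕ, A.obj n p ≃ₗ[k] B.obj n p,
    (∀ {n : ℕ} (σ : Equiv.Perm (Fin (n + 1))) (p : ℕ) (a : A.obj n p),
      f n p (A.act σ p a) = B.act σ p (f n p a)) ∧
    (∀ {m n l : ℕ} (h : m + n = l) (i : Fin (m + 1)) {p q s : ℕ} (hs : p + q = s)
      (a : A.obj m p) (b : A.obj n q),
      f l s (A.comp h i hs a b) = B.comp h i hs (f m p a) (f n q b))

end GradedCollection

namespace TopCollection

/-- The homology of a quasi-operad: its singular homology groups, with the compositions
`H_p(A(m)) × H_q(A(n)) → H_{p+q}(A(m) × A(n)) → H_{p+q}(A(m+n-1))` given by the cross product and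
the maps in homology induced by the compositions of `A`. -/
noncomputable def homology (k : Type) [CommRing k] {A : TopCollection} (hA : A.IsQuasiOperad) :
    GradedCollection k where
  obj n p := SingularHomology k (A.space n) p
  act σ p := SingularHomology.map k ⟨A.act σ, hA.continuous_act σ⟩ p
  comp {m n _} h i {_ _ s} hs := (SingularHomology.cross k (A.space m) (A.space n) hs).compr₂
    (SingularHomology.map k ⟨fun x => A.comp h i x.1 x.2, hA.continuous_comp h i⟩ s)

end TopCollection

/-! A cactus is encoded by its walks: for each lobe `i`, the function that sends `x` to the length
of the lobe `i` covered by a walk of length `x` along the outside circle. Extended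
quasi-periodically to the real line, these functions are monotone, vanish at zero and add up to `x`.
A reduced arc word is determined by them (`eq_of_trav_eq`), and they do not see arcs of length zero
or the splitting of an arc (`trav_reduce`). In this encoding every operation on words becomes
elementary: relabelling permutes the functions, scaling reparametrizes them, moving the global zero
translates them, and gluing is composition: the walk on the inserted cactus is its own walk
evaluated at the walk on the lobe `i` (`path_substitute_inr`).

The encoding also describes the topology. There are finitely many topological types, since a
tree-like word cannot contain the same pair of neighbours twice, and each closed cell is compact. So
normalized spineless cacti form a compact space that injects continuously into a Hausdorff space of
functions, and its topology is that of pointwise convergence (`isInducing_path`). Continuity of all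
operations is then checked on walks and radii.

For cacti with spines, the walk on a lobe, divided by its radius and measured from the local zero,
is a self-map of the circle (`Cactus.spin`). Radii and these circle maps determine the cactus, and
gluing composes the circle maps (`glue_spin_inr`); the rotation of the inserted cactus is absorbed
by the choice of origins. Hence associativity of cacti is associativity of composition, together
with bookkeeping of labels. Spineless cacti are the cacti with all local zeros at the root points,
which are closed under composition.

Normalized (spineless) cacti are an equivariant deformation retract: `r` scales all lobes to radius
one, `s` is the inclusion, and the homotopy `H` interpolates the radii linearly. The normalized
composition is the one induced by retraction, `r (s a ∘ᵢ s b)`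
(`NormalizedSpinelessCactus.glue_eq`). This alone gives both conclusions. The compositions `H_t a ∘ᵢ
H_t b` are equivariant for every `t`, they start with the given structure, and for the last one `r`
is a morphism and an equivariant homotopy equivalence. In homology, `s` induces an isomorphism, and
it respects compositions because `s ∘ r` is homotopic to the identity.

It remains that the homology of a topological operad is a graded operad. For this the cross product
must be natural, associative and graded commutative. With the shuffle map all three hold strictly on
singular chains: commutativity comes from exchanging the two directions of a shuffle, associativity
from the two ways of describing a shuffle of three strings (`Assoc`). The Koszul sign is the sign of
the exchange. The homology of the normalized structure, which need not be associative on the nose,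
is then an operad by transport along the isomorphism. -/

set_option linter.unusedSectionVars false

/-! ### Walking along the outside circle -/

namespace ArcWord

variable {ι κ : Type} [DecidableEq ι] [DecidableEq κ]

/-- The length of the part of the lobe `i` traversed by a walk of length `x` along the outside
circle, starting at the global zero and stopping when it is complete. -/
noncomputable def trav : ArcWord ι → ℝ → ι → ℝ
  | [], _, _ => 0
  -- Once the walk ends inside an arc, the remaining length `x - a.2` is negative, and the clamp at
  -- zero makes all later arcs contribute nothing.
  | a :: w, x, i => (if a.1 = i then max 0 (min x a.2) else 0) + trav w (x - a.2) i

@[simp] lemma trav_nil (x : ℝ) (i : ι) : trav [] x i = 0 := rfl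

lemma trav_cons (a : ι × ℝ) (w : ArcWord ι) (x : ℝ) (i : ι) :
    trav (a :: w) x i = (if a.1 = i then max 0 (min x a.2) else 0) + trav w (x - a.2) i := rfl

lemma trav_append (v w : ArcWord ι) (x : ℝ) (i : ι) :
    trav (v ++ w) x i = trav v x i + trav w (x - length v) i := by
  induction v generalizing x with
  | nil => simp
  | cons a v ih => rw [List.cons_append, trav_cons, trav_cons, ih, length_cons, add_assoc, sub_sub]

lemma trav_of_nonpos {w : ArcWord ι} (h : ∀ a ∈ w, 0 ≤ a.2) {x : ℝ} (hx : x ≤ 0) (i : ι) :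
    trav w x i = 0 := by
  induction w generalizing x with
  | nil => rfl
  | cons a w ih =>
    have ha := h a (by simp)
    rw [trav_cons, ih (fun b hb => h b (by simp [hb])) (by linarith),
      max_eq_left ((min_le_left _ _).trans hx)]
    simp

lemma trav_of_length_le {w : ArcWord ι} (h : ∀ a ∈ w, 0 ≤ a.2) {x : ℝ} (hx : length w ≤ x)
    (i : ι) : trav w x i = lobeLength w i := by
  induction w generalizing x with
  | nil => rfl
  | cons a w ih =>
    have ha := h a (by simp)
    have hw : ∀ b ∈ w, 0 ≤ b.2 := fun b hb => h b (by simp [hb])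
    have := length_nonneg hw
    rw [length_cons] at hx
    rw [trav_cons, lobeLength_cons, ih hw (by linarith), min_eq_right (by linarith),
      max_eq_right ha]

lemma trav_mono (w : ArcWord ι) {x y : ℝ} (h : x ≤ y) (i : ι) : trav w x i ≤ trav w y i := by
  induction w generalizing x y with
  | nil => rfl
  | cons a w ih =>
    rw [trav_cons, trav_cons]
    refine add_le_add ?_ (ih (by linarith))
    split_ifs
    · gcongr
    · rfl

lemma trav_nonneg (w : ArcWord ι) (x : ℝ) (i : ι) : 0 ≤ trav w x i := by
  induction w generalizing x with
  | nil => rfl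
  | cons a w ih =>
    rw [trav_cons]
    refine add_nonneg ?_ (ih _)
    split_ifs <;> simp

/-- Each arc lies on exactly one lobe, so nothing of the walk is lost or counted twice. -/
lemma sum_trav [Fintype ι] {w : ArcWord ι} (h : ∀ a ∈ w, 0 ≤ a.2) (x : ℝ) :
    ∑ i, trav w x i = max 0 (min x (length w)) := by
  induction w generalizing x with
  | nil => simp
  | cons a w ih =>
    have ha := h a (by simp)
    have hw : ∀ b ∈ w, 0 ≤ b.2 := fun b hb => h b (by simp [hb])
    have := length_nonneg hw
    simp only [trav_cons, Finset.sum_add_distrib, ih hw, length_cons, Finset.sum_ite_eq,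
      Finset.mem_univ, if_true]
    rcases le_total x a.2 with h1 | h1
    · rw [min_eq_left h1, min_eq_left (by linarith : x - a.2 ≤ length w),
        min_eq_left (by linarith), max_eq_left (by linarith : x - a.2 ≤ 0), add_zero]
    · rw [min_eq_right h1, max_eq_right ha, max_eq_right (a := 0) (le_min (by linarith) this),
        max_eq_right (le_min (by linarith) (by linarith)), ← min_add_add_left]
      congr 1
      ring

lemma trav_push {a : ι × ℝ} {w : ArcWord ι} (ha : 0 ≤ a.2) (h : ∀ b ∈ w, 0 ≤ b.2) (x : ℝ)
    (i : ι) : trav (push a w) x i = trav (a :: w) x i := by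
  cases w with
  | nil => rfl
  | cons c w =>
    have hc := h c (by simp)
    rw [push_cons]
    split_ifs with hac
    · simp only [trav_cons, hac, sub_sub, ← add_assoc]
      congr 1
      split_ifs
      · rcases le_total x a.2 with h1 | h1
        · rw [min_eq_left h1, min_eq_left (by linarith : x ≤ a.2 + c.2),
            min_eq_left (by linarith : x - a.2 ≤ c.2), max_eq_left (by linarith : x - a.2 ≤ 0),
            add_zero]
        · rw [min_eq_right h1, max_eq_right ha, max_eq_right (a := 0) (le_min (by linarith) hc),
            max_eq_right (le_min (by linarith) (by linarith)), ← min_add_add_left]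
          congr 1
          ring
      · simp
    · rfl

/-- An arc of length zero is never walked along, and two neighbouring arcs on one lobe add up to the
arc that replaces them. Thus reduction can be ignored in every computation with walks. -/
lemma trav_reduce {w : ArcWord ι} (h : ∀ a ∈ w, 0 ≤ a.2) (x : ℝ) (i : ι) :
    trav (reduce w) x i = trav w x i := by
  induction w generalizing x with
  | nil => rfl
  | cons a w ih =>
    have ha := h a (by simp)
    have hw : ∀ b ∈ w, 0 ≤ b.2 := fun b hb => h b (by simp [hb])
    rw [reduce_cons]
    split_ifs with h0
    · rw [ih hw, trav_cons, h0, sub_zero, max_eq_left (min_le_right _ _)]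
      simp
    · rw [trav_push ha fun b hb => (reduce_pos hw b hb).le, trav_cons, trav_cons, ih hw]

lemma length_reduce {w : ArcWord ι} : length (reduce w) = length w := by
  induction w with
  | nil => rfl
  | cons a w ih =>
    rw [reduce_cons]
    split_ifs with h0
    · simp [ih, h0]
    · rw [length_cons, ← ih]
      cases reduce w with
      | nil => simp [push]
      | cons c v =>
        rw [push_cons]
        split_ifs
        · simp; ring
        · simp

lemma trav_relabel {e : ι → κ} (he : Function.Injective e) (w : ArcWord ι) (x : ℝ) (i : ι) :
    trav (relabel e w) x (e i) = trav w x i := by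
  induction w generalizing x with
  | nil => rfl
  | cons a w ih =>
    have : relabel e (a :: w) = (e a.1, a.2) :: relabel e w := rfl
    rw [this, trav_cons, trav_cons, ih]
    simp [he.eq_iff]

lemma trav_relabel_of_ne {ι : Type} {e : ι → κ} {k : κ} (hk : ∀ i, e i ≠ k) (w : ArcWord ι) (x : ℝ) :
    trav (relabel e w) x k = 0 := by
  induction w generalizing x with
  | nil => rfl
  | cons a w ih =>
    have : relabel e (a :: w) = (e a.1, a.2) :: relabel e w := rfl
    rw [this, trav_cons, ih]
    simp [hk]

lemma length_relabel {ι κ : Type} (e : ι → κ) (w : ArcWord ι) :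
    length (relabel e w) = length w := by
  simp [length, relabel, Function.comp_def]

/-- Both walks end at the same point of the configuration: to reach it after scaling, the walk needs
the sum of the scaled parts it has covered. -/
lemma trav_rescale [Fintype ι] {s : ι → ℝ} (hs : ∀ i, 0 < s i) {w : ArcWord ι}
    (h : ∀ a ∈ w, 0 ≤ a.2) (x : ℝ) (i : ι) :
    trav (rescale s w) (∑ k, s k * trav w x k) i = s i * trav w x i := by
  induction w generalizing x with
  | nil => simp [rescale]
  | cons a w ih =>
    have ha := h a (by simp)
    have hw : ∀ b ∈ w, 0 ≤ b.2 := fun b hb => h b (by simp [hb])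
    have hr : rescale s (a :: w) = (a.1, s a.1 * a.2) :: rescale s w := rfl
    have hsum : ∑ k, s k * trav (a :: w) x k =
        s a.1 * max 0 (min x a.2) + ∑ k, s k * trav w (x - a.2) k := by
      simp [trav_cons, mul_add, Finset.sum_add_distrib]
    have hsa := hs a.1
    rw [hr, trav_cons, trav_cons, hsum]
    -- If the walk ends on the first arc, the scaled walk ends there too; otherwise the arc is
    -- complete in both words and the rest is the induction hypothesis.
    rcases le_total x a.2 with h1 | h1
    · have h0 : ∀ k, trav w (x - a.2) k = 0 := trav_of_nonpos hw (by linarith)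
      have hle : s a.1 * max 0 (min x a.2) ≤ s a.1 * a.2 := by
        gcongr
        exact max_le ha (min_le_right _ _)
      have hr' : ∀ b ∈ rescale s w, 0 ≤ b.2 := by
        simp only [rescale, List.mem_map, forall_exists_index, and_imp]
        rintro b c hc rfl
        exact mul_nonneg (hs _).le (hw c hc)
      simp only [h0, mul_zero, Finset.sum_const_zero, add_zero]
      rw [trav_of_nonpos hr' (by linarith), min_eq_left hle,
        max_eq_right (mul_nonneg hsa.le (le_max_left _ _))]
      split_ifs with hai
      · rw [hai, add_zero]
      · simp
    · rw [min_eq_right h1, max_eq_right ha]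
      have hnn : 0 ≤ ∑ k, s k * trav w (x - a.2) k :=
        Finset.sum_nonneg fun k _ => mul_nonneg (hs k).le (trav_nonneg _ _ _)
      rw [add_sub_cancel_left, ih hw, min_eq_right (by linarith),
        max_eq_right (mul_nonneg hsa.le ha), mul_add]
      split_ifs with hai
      · rw [hai]
      · simp

lemma length_cut {ι : Type} {u : ℝ} {w : ArcWord ι} (hu : u ≤ length w) (hu0 : 0 ≤ u) :
    length (cut u w).1 = u := by
  induction w generalizing u with
  | nil => simp [cut] at hu ⊢; linarith
  | cons a w ih =>
    rw [length_cons] at hu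
    unfold cut
    split_ifs with hau
    · simp only [length_cons]
      rw [ih (by linarith) (by linarith)]; ring
    · simp

lemma trav_cut_fst {u : ℝ} (hu : 0 ≤ u) {w : ArcWord ι} (h : ∀ a ∈ w, 0 ≤ a.2) (x : ℝ) (i : ι) :
    trav (cut u w).1 x i = trav w (min x u) i := by
  induction w generalizing u x with
  | nil => simp [cut]
  | cons a w ih =>
    have hw : ∀ b ∈ w, 0 ≤ b.2 := fun b hb => h b (by simp [hb])
    unfold cut
    split_ifs with hau
    · simp only [trav_cons]
      rw [ih (by linarith) hw, min_sub_sub_right, min_assoc, min_eq_right hau]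
    · simp only [trav_cons, trav_nil]
      rw [trav_of_nonpos hw (by have := min_le_right x u; linarith), min_assoc,
        min_eq_left (le_of_not_ge hau)]

lemma trav_cut_snd {u : ℝ} (hu : 0 ≤ u) {w : ArcWord ι} (h : ∀ a ∈ w, 0 ≤ a.2) {x : ℝ}
    (hx : 0 ≤ x) (i : ι) : trav (cut u w).2 x i = trav w (u + x) i - trav w u i := by
  induction w generalizing u with
  | nil => simp [cut]
  | cons a w ih =>
    have ha := h a (by simp)
    have hw : ∀ b ∈ w, 0 ≤ b.2 := fun b hb => h b (by simp [hb])
    unfold cut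
    split_ifs with hau
    · simp only [trav_cons]
      rw [ih (by linarith) hw, min_eq_right (by linarith : a.2 ≤ u + x), min_eq_right hau,
        show u - a.2 + x = u + x - a.2 by ring]
      ring
    · simp only [trav_cons]
      have hau := le_of_not_ge hau
      rw [trav_of_nonpos hw (by linarith : u - a.2 ≤ 0), min_eq_left hau, max_eq_right hu,
        show x - (a.2 - u) = u + x - a.2 by ring,
        max_eq_right (le_min hx (by linarith)), max_eq_right (le_min (by linarith) ha)]
      have : min (u + x) a.2 = u + min x (a.2 - u) := by
        rw [← min_add_add_left]; congr 1; ring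
      rw [this]
      split_ifs <;> ring

lemma cut_lobeLength_fst {u : ℝ} (hu : 0 ≤ u) {w : ArcWord ι} (h : ∀ a ∈ w, 0 ≤ a.2) (i : ι) :
    lobeLength (cut u w).1 i = trav w u i := by
  induction w generalizing u with
  | nil => simp [cut]
  | cons a w ih =>
    have ha := h a (by simp)
    have hw : ∀ b ∈ w, 0 ≤ b.2 := fun b hb => h b (by simp [hb])
    unfold cut
    split_ifs with hau
    · simp only [trav_cons, lobeLength_cons]
      rw [ih (by linarith) hw, min_eq_right hau, max_eq_right ha]
    · simp only [trav_cons, lobeLength_cons, lobeLength_nil]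
      rw [trav_of_nonpos hw (by linarith), min_eq_left (le_of_not_ge hau), max_eq_right hu]

/-- After the new zero comes the part of the circle behind the cut, then the part before it; the
last summand is the piece walked past the old global zero. -/
lemma trav_rotate {u : ℝ} (hu : 0 ≤ u) {w : ArcWord ι} (h : ∀ a ∈ w, 0 ≤ a.2)
    (hul : u ≤ length w) {x : ℝ} (hx : 0 ≤ x) (i : ι) :
    trav (rotate u w) x i =
      trav w (u + x) i - trav w u i + trav w (min (x + u - length w) u) i := by
  rw [rotate, trav_append, trav_cut_snd hu h hx, trav_cut_fst hu h, cut_length hul hu]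
  congr 3
  ring

lemma length_rotate {ι : Type} {u : ℝ} {w : ArcWord ι} (hu : 0 ≤ u)
    (hul : u ≤ length w) : length (rotate u w) = length w := by
  have : ∀ v v' : ArcWord ι, length (v ++ v') = length v + length v' := by
    intro v v'; simp [length]
  rw [rotate, this, cut_length hul hu, length_cut hul hu]
  ring

lemma trav_substitute_inl (i : ι) {w : ArcWord ι} {d : ArcWord κ} (hw : ∀ a ∈ w, 0 ≤ a.2)
    (hd : ∀ a ∈ d, 0 ≤ a.2) (hl : lobeLength w i ≤ length d) (x : ℝ) (j : {j : ι // j ≠ i}) :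
    trav (substitute i w d) x (Sum.inl j) = trav w x j := by
  induction w generalizing d x with
  | nil => simp [substitute]
  | cons a w ih =>
    have ha : 0 ≤ a.2 := hw a (by simp)
    have hw' : ∀ b ∈ w, 0 ≤ b.2 := fun b hb => hw b (by simp [hb])
    have hwn := lobeLength_nonneg hw' i
    by_cases h : a.1 = i
    · rw [lobeLength_cons, if_pos h] at hl
      rw [substitute_cons_pos h, trav_append, trav_relabel_of_ne (by simp), length_relabel,
        length_cut (by linarith) ha, ih hw' (cut_nonneg ha hd).2
          (by rw [cut_length (by linarith) ha]; linarith), trav_cons]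
      simp [h, j.2.symm]
    · rw [lobeLength_cons, if_neg h, zero_add] at hl
      rw [substitute_cons_neg h, trav_cons, trav_cons, ih hw' hd hl]
      simp [Subtype.ext_iff]

/-- The source of all composition laws: the glued walk advances on the outside circle of `d` exactly
as much as the original walk advances on the lobe `i`. The cuts of `d` are made at these moments. -/
lemma trav_substitute_inr (i : ι) {w : ArcWord ι} {d : ArcWord κ} (hw : ∀ a ∈ w, 0 ≤ a.2)
    (hd : ∀ a ∈ d, 0 ≤ a.2) (hl : lobeLength w i ≤ length d) (x : ℝ) (k : κ) :
    trav (substitute i w d) x (Sum.inr k) = trav d (trav w x i) k := by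
  induction w generalizing d x with
  | nil => simp [substitute, trav_of_nonpos hd le_rfl]
  | cons a w ih =>
    have ha : 0 ≤ a.2 := hw a (by simp)
    have hw' : ∀ b ∈ w, 0 ≤ b.2 := fun b hb => hw b (by simp [hb])
    have hwn := lobeLength_nonneg hw' i
    by_cases h : a.1 = i
    · rw [lobeLength_cons, if_pos h] at hl
      rw [substitute_cons_pos h, trav_append, trav_relabel Sum.inr_injective, length_relabel,
        length_cut (by linarith) ha, ih hw' (cut_nonneg ha hd).2
          (by rw [cut_length (by linarith) ha]; linarith), trav_cons, if_pos h,
        trav_cut_fst ha hd, trav_cut_snd ha hd (trav_nonneg _ _ _)]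
      rcases le_total x a.2 with h1 | h1
      · rw [trav_of_nonpos hw' (by linarith), min_eq_left h1, add_zero, add_zero]
        rcases le_total x 0 with h2 | h2
        · rw [max_eq_left h2, trav_of_nonpos hd h2, trav_of_nonpos hd le_rfl]; ring
        · rw [max_eq_right h2]; ring
      · rw [min_eq_right h1, max_eq_right ha]; ring
    · rw [lobeLength_cons, if_neg h, zero_add] at hl
      rw [substitute_cons_neg h, trav_cons, trav_cons, ih hw' hd hl, if_neg h]
      simp

/-- The lobe `i` is exchanged for lobes of the same total length. -/
lemma length_substitute {ι κ : Type} [DecidableEq ι] [Fintype ι] [DecidableEq κ] [Fintype κ]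
    (i : ι) {w : ArcWord ι} {d : ArcWord κ}
    (hw : ∀ a ∈ w, 0 ≤ a.2) (hd : ∀ a ∈ d, 0 ≤ a.2) (hl : length d = lobeLength w i) :
    length (substitute i w d) = length w := by
  rw [length_eq_sum, length_eq_sum w, Fintype.sum_sum_type]
  simp only [substitute_lobeLength_inl, substitute_lobeLength_inr i hw hd hl]
  rw [← length_eq_sum, hl, add_comm, Fintype.sum_eq_add_sum_subtype_ne _ i]

/-- Right after the first arc the walk is on another lobe, since neighbouring labels differ. This
makes the end of the first arc visible in the walk; it would not be visible in an unreduced word. -/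
lemma trav_past_first {a : ι × ℝ} {w : ArcWord ι} (h : ∀ b ∈ a :: w, 0 < b.2)
    (hc : (labels (a :: w)).IsChain (· ≠ ·)) :
    ∃ δ > 0, ∀ ε, 0 ≤ ε → ε ≤ δ → trav (a :: w) (a.2 + ε) a.1 = a.2 := by
  have ha := h a (by simp)
  cases w with
  | nil =>
    refine ⟨1, one_pos, fun ε h0 _ => ?_⟩
    rw [trav_cons, if_pos rfl, min_eq_right (by linarith), max_eq_right ha.le, trav_nil, add_zero]
  | cons c w =>
    refine ⟨c.2, h c (by simp), fun ε h0 h1 => ?_⟩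
    have hac : c.1 ≠ a.1 := by
      simp only [labels_cons, List.isChain_cons_cons] at hc
      exact hc.1.symm
    rw [trav_cons, if_pos rfl, min_eq_right (by linarith), max_eq_right ha.le, trav_cons,
      if_neg hac, trav_of_nonpos (fun b hb => (h b (by simp [hb])).le) (by linarith)]
    ring

lemma trav_first {a : ι × ℝ} {w : ArcWord ι} (h : ∀ b ∈ a :: w, 0 < b.2) {x : ℝ} (hx : 0 ≤ x)
    (hxa : x ≤ a.2) (i : ι) : trav (a :: w) x i = if a.1 = i then x else 0 := by
  rw [trav_cons, trav_of_nonpos (fun b hb => (h b (by simp [hb])).le) (by linarith),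
    min_eq_left hxa, max_eq_right hx, add_zero]

/-- If the second word had the longer first arc, then slightly beyond the end of `a` its walk would
still advance on the common lobe while the first walk has stopped there. -/
lemma first_le_of_trav_eq {a b : ι × ℝ} {w v : ArcWord ι} (hab : a.1 = b.1)
    (hw : ∀ c ∈ a :: w, 0 < c.2) (hv : ∀ c ∈ b :: v, 0 < c.2)
    (hc : (labels (a :: w)).IsChain (· ≠ ·))
    (h : ∀ x i, trav (a :: w) x i = trav (b :: v) x i) : b.2 ≤ a.2 := by
  by_contra! hlt
  have ha := hw a (by simp)
  obtain ⟨δ, hδ, hd⟩ := trav_past_first hw hc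
  -- A step short enough to stay both on the arc following `a` and on the arc `b`.
  have h1 := hd (min δ (b.2 - a.2)) (le_min hδ.le (by linarith)) (min_le_left _ _)
  have h2 := min_le_right δ (b.2 - a.2)
  have h3 : 0 < min δ (b.2 - a.2) := lt_min hδ (by linarith)
  rw [h, trav_first hv (by linarith) (by linarith), if_pos hab.symm] at h1
  linarith

/-- The word can be read off letter by letter: the first label is the lobe on which the walk starts
to advance, and the first length is where that advance first stops. Then the first arc is removed
and the argument repeated. -/
lemma eq_of_trav_eq {w v : ArcWord ι} (hw : ∀ a ∈ w, 0 < a.2) (hv : ∀ a ∈ v, 0 < a.2)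
    (hcw : w.labels.IsChain (· ≠ ·)) (hcv : v.labels.IsChain (· ≠ ·))
    (h : ∀ x i, trav w x i = trav v x i) : w = v := by
  induction w generalizing v with
  | nil =>
    cases v with
    | nil => rfl
    | cons b v =>
      have hb := hv b (by simp)
      have := h b.2 b.1
      rw [trav_first hv hb.le le_rfl, if_pos rfl, trav_nil] at this
      linarith
  | cons a w ih =>
    have ha := hw a (by simp)
    cases v with
    | nil =>
      have := h a.2 a.1
      rw [trav_first hw ha.le le_rfl, if_pos rfl, trav_nil] at this
      linarith
    | cons b v =>
      have hb := hv b (by simp)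
      have hm := lt_min ha hb
      have hab : a.1 = b.1 := by
        by_contra hne
        have := h (min a.2 b.2) a.1
        rw [trav_first hw hm.le (min_le_left _ _), trav_first hv hm.le (min_le_right _ _),
          if_pos rfl, if_neg (Ne.symm hne)] at this
        linarith
      have hab2 : a.2 = b.2 := le_antisymm
        (first_le_of_trav_eq hab.symm hv hw hcv fun x i => (h x i).symm)
        (first_le_of_trav_eq hab hw hv hcw h)
      obtain rfl : a = b := Prod.ext hab hab2
      congr 1
      refine ih (fun c hc => hw c (by simp [hc])) (fun c hc => hv c (by simp [hc])) hcw.tail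
        hcv.tail fun x i => ?_
      -- A walk of length `x` in the tail is a walk of length `x + a.2` in the whole word, which has
      -- the common first arc in addition.
      have := h (x + a.2) i
      rw [trav_cons, trav_cons, add_sub_cancel_right] at this
      linarith

lemma IsCactus.reduce_eq {w : ArcWord ι} (h : IsCactus w) : ArcWord.reduce w = w :=
  eq_of_trav_eq (reduce_pos h.isWeakCactus.nonneg) h.pos (reduce_chain w) h.adjacent
    (trav_reduce h.isWeakCactus.nonneg)

end ArcWord

/-! ### Quasi-periodic walks on the whole real line -/

namespace ArcWord

/-- The periodic extension of `trav`: the winding of a walk of length `x` along the outside circle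
on the lobe `i`. -/
noncomputable def path {ι : Type} [DecidableEq ι] (w : ArcWord ι) (x : ℝ) (i : ι) : ℝ :=
  ⌊x / length w⌋ * lobeLength w i + trav w (x - ⌊x / length w⌋ * length w) i

variable {ι κ : Type} [DecidableEq ι] [DecidableEq κ]

/-- A full turn around the outside circle covers each lobe once. With this, statements about walks
reduce to a single period. -/
lemma path_add_int {w : ArcWord ι} (hl : 0 < length w) (x : ℝ) (n : ℤ) (i : ι) :
    path w (x + n * length w) i = path w x i + n * lobeLength w i := by
  have h : ⌊(x + n * length w) / length w⌋ = ⌊x / length w⌋ + n := by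
    rw [add_div, mul_div_cancel_right₀ _ hl.ne', Int.floor_add_intCast]
  rw [path, h, path]
  push_cast
  rw [show x + n * length w - (⌊x / length w⌋ + n) * length w = x - ⌊x / length w⌋ * length w by
    ring]
  ring

lemma path_of_mem {w : ArcWord ι} (h : ∀ a ∈ w, 0 ≤ a.2) (hl : 0 < length w) {x : ℝ}
    (h0 : 0 ≤ x) (h1 : x ≤ length w) (i : ι) : path w x i = trav w x i := by
  rcases h1.lt_or_eq with h1 | rfl
  · have : ⌊x / length w⌋ = 0 := by
      rw [Int.floor_eq_iff]
      exact ⟨by simpa using div_nonneg h0 hl.le, by simpa using (div_lt_one hl).2 h1⟩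
    simp [path, this]
  -- At the endpoint of the period the integer part jumps to one and the remaining walk is empty;
  -- both descriptions give one full lobe.
  · rw [path, div_self hl.ne', Int.floor_one, trav_of_length_le h le_rfl]
    simp [trav_of_nonpos h]

lemma exists_eq_add_int {L : ℝ} (hl : 0 < L) (x : ℝ) :
    ∃ (y : ℝ) (n : ℤ), 0 ≤ y ∧ y ≤ L ∧ x = y + n * L := by
  refine ⟨x - ⌊x / L⌋ * L, ⌊x / L⌋, ?_, ?_, by ring⟩
  · have := (le_div_iff₀ hl).1 (Int.floor_le (x / L))
    linarith
  · have := (div_le_iff₀ hl).1 (Int.lt_floor_add_one (x / L)).le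
    linarith

lemma path_congr {w : ArcWord ι} {v : ArcWord κ} {i : ι} {k : κ} (hl : length w = length v)
    (hi : lobeLength w i = lobeLength v k) (h : ∀ x, trav w x i = trav v x k) (x : ℝ) :
    path w x i = path v x k := by
  rw [path, path, hl, hi, h]

lemma sum_path [Fintype ι] {w : ArcWord ι} (h : ∀ a ∈ w, 0 ≤ a.2) (hl : 0 < length w) (x : ℝ) :
    ∑ i, path w x i = x := by
  obtain ⟨y, n, h0, h1, rfl⟩ := exists_eq_add_int hl x
  simp only [path_add_int hl, path_of_mem h hl h0 h1, Finset.sum_add_distrib, sum_trav h,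
    ← Finset.mul_sum, ← length_eq_sum]
  rw [min_eq_left h1, max_eq_right h0]

lemma path_mono {w : ArcWord ι} (h : ∀ a ∈ w, 0 ≤ a.2) (hl : 0 < length w) {x y : ℝ}
    (hxy : x ≤ y) (i : ι) : path w x i ≤ path w y i := by
  have hf : ⌊x / length w⌋ ≤ ⌊y / length w⌋ := Int.floor_mono (by gcongr)
  have hle : ∀ z, trav w z i ≤ lobeLength w i := fun z =>
    (trav_mono w (le_max_left z (length w)) i).trans (trav_of_length_le h (le_max_right _ _) i).le
  -- In different periods, the gain of at least one full lobe outweighs whatever the first walk has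
  -- covered in its last, incomplete turn.
  rcases hf.lt_or_eq with hf | hf
  · have h1 : (⌊x / length w⌋ : ℝ) + 1 ≤ ⌊y / length w⌋ := by exact_mod_cast hf
    have h2 := mul_le_mul_of_nonneg_right h1 (lobeLength_nonneg h i)
    have h3 := hle (x - ⌊x / length w⌋ * length w)
    have h4 := trav_nonneg w (y - ⌊y / length w⌋ * length w) i
    rw [path, path]
    linarith
  · rw [path, path, hf]
    gcongr
    exact trav_mono w (by linarith) i

lemma path_rescale [Fintype ι] {s : ι → ℝ} (hs : ∀ i, 0 < s i) {w : ArcWord ι}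
    (h : ∀ a ∈ w, 0 ≤ a.2) (hl : 0 < length w) (hl' : 0 < length (rescale s w)) (x : ℝ) (i : ι) :
    path (rescale s w) (∑ k, s k * path w x k) i = s i * path w x i := by
  have hls : length (rescale s w) = ∑ k, s k * lobeLength w k := by
    simp [length_eq_sum, lobeLength_rescale]
  have hr : ∀ b ∈ rescale s w, 0 ≤ b.2 := by
    simp only [rescale, List.mem_map, forall_exists_index, and_imp]
    rintro b c hc rfl
    exact mul_nonneg (hs _).le (h c hc)
  obtain ⟨y, n, h0, h1, rfl⟩ := exists_eq_add_int hl x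
  have hsum : ∑ k, s k * path w (y + n * length w) k =
      ∑ k, s k * trav w y k + n * length (rescale s w) := by
    simp only [path_add_int hl, path_of_mem h hl h0 h1, hls, mul_add, Finset.sum_add_distrib,
      Finset.mul_sum]
    congr 1
    exact Finset.sum_congr rfl fun k _ => by ring
  rw [hsum, path_add_int hl', path_of_mem hr hl', trav_rescale hs h, path_add_int hl,
    path_of_mem h hl h0 h1, lobeLength_rescale]
  · ring
  · exact Finset.sum_nonneg fun k _ => mul_nonneg (hs k).le (trav_nonneg _ _ _)
  · rw [hls]
    refine Finset.sum_le_sum fun k _ => mul_le_mul_of_nonneg_left ?_ (hs k).le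
    rw [← trav_of_length_le h le_rfl]
    exact trav_mono w h1 k

/-- For the periodic walk, moving the origin is a translation in the argument, normalized to vanish
at zero; the case distinction of the finite walk disappears. -/
lemma path_rotate {u : ℝ} (hu : 0 ≤ u) {w : ArcWord ι} (h : ∀ a ∈ w, 0 ≤ a.2)
    (hul : u ≤ length w) (hl : 0 < length w) (x : ℝ) (i : ι) :
    path (rotate u w) x i = path w (u + x) i - path w u i := by
  have hlr := length_rotate hu hul
  have hr : ∀ a ∈ rotate u w, 0 ≤ a.2 := fun a ha => by
    rcases List.mem_append.1 ha with ha | ha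
    · exact (cut_nonneg hu h).2 a ha
    · exact (cut_nonneg hu h).1 a ha
  have hlo : lobeLength (rotate u w) i = lobeLength w i := by
    rw [rotate, lobeLength_append, add_comm, cut_lobeLength]
  obtain ⟨y, n, h0, h1, rfl⟩ := exists_eq_add_int hl x
  rw [← hlr] at h1
  rw [← add_assoc, path_add_int hl]
  nth_rewrite 1 [← hlr]
  rw [path_add_int (by linarith), path_of_mem hr (by linarith) h0 h1, trav_rotate hu h hul h0,
    hlo, path_of_mem h hl hu hul]
  rw [hlr] at h1
  -- Whether the walk passes the old global zero. If it does, the excess over one turn is the part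
  -- before the cut.
  rcases le_total (u + y) (length w) with h2 | h2
  · rw [path_of_mem h hl (by linarith) h2,
      trav_of_nonpos h ((min_le_left _ _).trans (by linarith))]
    ring
  · rw [trav_of_length_le h h2, min_eq_left (by linarith),
      show u + y = (u + y - length w) + (1 : ℤ) * length w by push_cast; ring, path_add_int hl,
      path_of_mem h hl (by linarith) (by linarith), add_comm y u]
    push_cast
    ring

lemma path_substitute_inl [Fintype ι] [Fintype κ] (i : ι) {w : ArcWord ι} {d : ArcWord κ}
    (hw : ∀ a ∈ w, 0 ≤ a.2)
    (hd : ∀ a ∈ d, 0 ≤ a.2) (hl : length d = lobeLength w i) (x : ℝ) (j : {j : ι // j ≠ i}) :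
    path (substitute i w d) x (Sum.inl j) = path w x j :=
  path_congr (length_substitute i hw hd hl) (substitute_lobeLength_inl i w d j)
    (fun y => trav_substitute_inl i hw hd hl.ge y j) x

/-- One turn along the outside circle of `w` is one turn on the lobe `i`, hence, the lengths being
equal, one turn along `d`. So the formula for one period extends to all walks. -/
lemma path_substitute_inr [Fintype ι] [Fintype κ] (i : ι) {w : ArcWord ι} {d : ArcWord κ}
    (hw : ∀ a ∈ w, 0 ≤ a.2) (hd : ∀ a ∈ d, 0 ≤ a.2) (hl : length d = lobeLength w i)
    (h0 : 0 < length w) (h1 : 0 < length d) (x : ℝ) (k : κ) :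
    path (substitute i w d) x (Sum.inr k) = path d (path w x i) k := by
  have hls := length_substitute i hw hd hl
  obtain ⟨y, n, hy0, hy1, rfl⟩ := exists_eq_add_int h0 x
  rw [path_add_int h0, ← hl, path_add_int h1]
  nth_rewrite 1 [← hls]
  rw [path_add_int (by linarith), path_of_mem (substitute_nonneg i hw hd) (by linarith) hy0
    (by linarith), trav_substitute_inr i hw hd hl.ge, path_of_mem hw h0 hy0 hy1, path_of_mem hd h1
    (trav_nonneg _ _ _), substitute_lobeLength_inr i hw hd hl]
  rw [hl, ← trav_of_length_le hw le_rfl]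
  exact trav_mono w hy1 i

end ArcWord

/-! ### Walks of spineless cacti under relabelling, scaling, gluing and rotation -/

namespace SpinelessCactus

variable {ι κ : Type} [DecidableEq ι] [DecidableEq κ]

/-- The winding of a walk of length `x` along the outside circle on the lobe `i`. -/
noncomputable def path (c : SpinelessCactus ι) (x : ℝ) (i : ι) : ℝ := c.word.path x i

lemma word_nonneg (c : SpinelessCactus ι) : ∀ a ∈ c.word, 0 ≤ a.2 :=
  c.isCactus.isWeakCactus.nonneg

@[ext] lemma ext_word {c d : SpinelessCactus ι} (h : c.word = d.word) : c = d := by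
  cases c; cases d; cases h; rfl

variable [Fintype ι] [Nonempty ι]

lemma path_add_int (c : SpinelessCactus ι) (x : ℝ) (n : ℤ) (i : ι) :
    c.path (x + n * c.totalRadius) i = c.path x i + n * c.radius i :=
  ArcWord.path_add_int c.totalRadius_pos x n i

lemma sum_path (c : SpinelessCactus ι) (x : ℝ) : ∑ i, c.path x i = x :=
  ArcWord.sum_path c.word_nonneg c.totalRadius_pos x

lemma path_mono (c : SpinelessCactus ι) {x y : ℝ} (h : x ≤ y) (i : ι) :
    c.path x i ≤ c.path y i :=
  ArcWord.path_mono c.word_nonneg c.totalRadius_pos h i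

lemma path_zero (c : SpinelessCactus ι) (i : ι) : c.path 0 i = 0 := by
  rw [path, ArcWord.path_of_mem c.word_nonneg c.totalRadius_pos le_rfl c.totalRadius_nonneg,
    ArcWord.trav_of_nonpos c.word_nonneg le_rfl]

/-- The increments on the individual lobes are nonnegative and add up to the increment of the whole
walk. -/
lemma path_sub_le (c : SpinelessCactus ι) {x y : ℝ} (h : x ≤ y) (i : ι) :
    c.path y i - c.path x i ≤ y - x := by
  refine le_of_le_of_eq ?_ (congrArg₂ (· - ·) (c.sum_path y) (c.sum_path x))
  rw [← Finset.sum_sub_distrib]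
  exact Finset.single_le_sum (f := fun k => c.path y k - c.path x k)
    (fun k _ => sub_nonneg.2 (c.path_mono h k)) (Finset.mem_univ i)

lemma lipschitz_path (c : SpinelessCactus ι) (i : ι) : LipschitzWith 1 fun x => c.path x i := by
  refine LipschitzWith.of_le_add fun x y => ?_
  rcases le_total x y with h | h
  · exact (c.path_mono h i).trans (le_add_of_nonneg_right dist_nonneg)
  · have := c.path_sub_le h i
    rw [Real.dist_eq, abs_of_nonneg (by linarith)]
    linarith

/-- The extensionality principle for cacti: equal radii give equal periods, so the finite walks
agree, and these determine the reduced word. -/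
lemma eq_of_path_eq {c d : SpinelessCactus ι} (hr : ∀ i, c.radius i = d.radius i)
    (h : ∀ x i, c.path x i = d.path x i) : c = d := by
  have hl : c.totalRadius = d.totalRadius := by simp only [totalRadius_eq_sum, hr]
  refine ext_word (ArcWord.eq_of_trav_eq c.isCactus.pos d.isCactus.pos c.isCactus.adjacent
    d.isCactus.adjacent fun x i => ?_)
  rcases le_total x 0 with h0 | h0
  · rw [ArcWord.trav_of_nonpos c.word_nonneg h0, ArcWord.trav_of_nonpos d.word_nonneg h0]
  rcases le_total x c.totalRadius with h1 | h1
  · rw [← ArcWord.path_of_mem c.word_nonneg c.totalRadius_pos h0 h1,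
      ← ArcWord.path_of_mem d.word_nonneg d.totalRadius_pos h0 (h1.trans hl.le)]
    exact h x i
  · rw [ArcWord.trav_of_length_le c.word_nonneg h1,
      ArcWord.trav_of_length_le d.word_nonneg (hl.symm.le.trans h1)]
    exact hr i

lemma relabel_path (e : ι ≃ κ) (c : SpinelessCactus ι) (x : ℝ) (k : κ) :
    (c.relabel e).path x k = c.path x (e.symm k) := by
  obtain ⟨i, rfl⟩ := e.surjective k
  rw [e.symm_apply_apply]
  exact ArcWord.path_congr (ArcWord.length_relabel _ _)
    (ArcWord.lobeLength_relabel e.injective _ _) (fun y => ArcWord.trav_relabel e.injective _ y i) x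

lemma rescale_path (c : SpinelessCactus ι) (s : ι → ℝ) (hs : ∀ i, 0 < s i) (x : ℝ) (i : ι) :
    (c.rescale s hs).path (∑ k, s k * c.path x k) i = s i * c.path x i :=
  ArcWord.path_rescale hs c.word_nonneg c.totalRadius_pos (c.rescale s hs).totalRadius_pos x i

lemma rescale_const_path (c : SpinelessCactus ι) (s : ℝ) (hs : 0 < s) (x : ℝ) (i : ι) :
    (c.rescale (fun _ => s) fun _ => hs).path x i = s * c.path (x / s) i := by
  rw [← c.rescale_path (fun _ => s) fun _ => hs, ← Finset.mul_sum, sum_path,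
    mul_div_cancel₀ _ hs.ne']

lemma rescale_rescale (c : SpinelessCactus ι) (s t : ι → ℝ) (hs : ∀ i, 0 < s i)
    (ht : ∀ i, 0 < t i) :
    (c.rescale s hs).rescale t ht =
      c.rescale (fun i => t i * s i) fun i => mul_pos (ht i) (hs i) := by
  ext1
  simp [rescale, ArcWord.rescale, Function.comp_def, mul_assoc]

lemma rescale_congr (c : SpinelessCactus ι) {s t : ι → ℝ} (h : s = t) (hs : ∀ i, 0 < s i) :
    c.rescale s hs = c.rescale t (h ▸ hs) := by subst h; rfl

lemma rescale_one (c : SpinelessCactus ι) : c.rescale (fun _ => 1) (fun _ => one_pos) = c := by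
  ext1
  simp [rescale, ArcWord.rescale]

lemma rescale_inv (c : SpinelessCactus ι) (s : ι → ℝ) (hs : ∀ i, 0 < s i) :
    (c.rescale s hs).rescale (fun i => (s i)⁻¹) (fun i => inv_pos.2 (hs i)) = c := by
  rw [rescale_rescale]
  have : (fun i => (s i)⁻¹ * s i) = fun _ => (1 : ℝ) := funext fun i => inv_mul_cancel₀ (hs i).ne'
  rw [rescale_congr _ this, rescale_one]

lemma rescale_relabel (e : ι ≃ κ) (c : SpinelessCactus ι) (s : κ → ℝ) (hs : ∀ i, 0 < s i) :
    (c.relabel e).rescale s hs = (c.rescale (fun i => s (e i)) fun _ => hs _).relabel e := by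
  ext1
  simp [rescale, relabel, ArcWord.rescale, ArcWord.relabel]

/-- A walk of length `x` along the outside circle of a rescaled cactus, before the rescaling. -/
lemma rescale_path_inv (c : SpinelessCactus ι) (s : ι → ℝ) (hs : ∀ i, 0 < s i) (x : ℝ) (i : ι) :
    s i * c.path (∑ k, (s k)⁻¹ * (c.rescale s hs).path x k) i = (c.rescale s hs).path x i := by
  -- The rescaled cactus is scaled back by the inverse factors, which recovers `c`.
  have := (c.rescale s hs).rescale_path (fun i => (s i)⁻¹) (fun i => inv_pos.2 (hs i)) x i
  rw [rescale_inv] at this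
  rw [this, mul_inv_cancel_left₀ (hs i).ne']

lemma rescale_sum_path_inv (c : SpinelessCactus ι) (s : ι → ℝ) (hs : ∀ i, 0 < s i) (x : ℝ) :
    ∑ i, s i * c.path (∑ k, (s k)⁻¹ * (c.rescale s hs).path x k) i = x := by
  simp only [rescale_path_inv, sum_path]

/-- The walk of a rescaled cactus is only known explicitly after the reparametrization by scaled
lengths. As that reparametrization is onto, comparing walks there suffices. -/
lemma eq_rescale (c d : SpinelessCactus ι) (s : ι → ℝ) (hs : ∀ i, 0 < s i)
    (hr : ∀ i, c.radius i = s i * d.radius i)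
    (h : ∀ x i, c.path (∑ k, s k * d.path x k) i = s i * d.path x i) : c = d.rescale s hs := by
  refine eq_of_path_eq (fun i => by rw [hr, rescale_radius]) fun x i => ?_
  rw [← rescale_path_inv, ← h, rescale_sum_path_inv]

variable [Fintype κ] [Nonempty κ]

lemma plug_path_inl (c : SpinelessCactus ι) (i : ι) (c' : SpinelessCactus κ)
    (h : c'.totalRadius = c.radius i) (x : ℝ) (j : {j : ι // j ≠ i}) :
    (c.plug i c' h).path x (Sum.inl j) = c.path x j := by
  rw [path, path, ← ArcWord.path_substitute_inl i c.word_nonneg c'.word_nonneg h]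
  exact ArcWord.path_congr ArcWord.length_reduce (ArcWord.reduce_lobeLength _ _) (fun y =>
    ArcWord.trav_reduce (ArcWord.substitute_nonneg i c.word_nonneg c'.word_nonneg) y _) x

lemma plug_path_inr (c : SpinelessCactus ι) (i : ι) (c' : SpinelessCactus κ)
    (h : c'.totalRadius = c.radius i) (x : ℝ) (k : κ) :
    (c.plug i c' h).path x (Sum.inr k) = c'.path (c.path x i) k := by
  simp only [path]
  rw [← ArcWord.path_substitute_inr i c.word_nonneg c'.word_nonneg h c.totalRadius_pos
    c'.totalRadius_pos]
  exact ArcWord.path_congr ArcWord.length_reduce (ArcWord.reduce_lobeLength _ _) (fun y =>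
    ArcWord.trav_reduce (ArcWord.substitute_nonneg i c.word_nonneg c'.word_nonneg) y _) x

lemma glue_radius_inl (c : SpinelessCactus ι) (i : ι) (c' : SpinelessCactus κ)
    (j : {j : ι // j ≠ i}) : (c.glue i c').radius (Sum.inl j) = c.radius j :=
  plug_radius_inl _ _ _ _ _

lemma glue_radius_inr (c : SpinelessCactus ι) (i : ι) (c' : SpinelessCactus κ) (k : κ) :
    (c.glue i c').radius (Sum.inr k) = c.radius i / c'.totalRadius * c'.radius k := by
  rw [glue, plug_radius_inr, rescale_radius]

lemma glue_path_inl (c : SpinelessCactus ι) (i : ι) (c' : SpinelessCactus κ) (x : ℝ)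
    (j : {j : ι // j ≠ i}) : (c.glue i c').path x (Sum.inl j) = c.path x j :=
  plug_path_inl _ _ _ _ _ _

/-- The walk of `c'` at the walk on the lobe `i`, with a change of units before and after: from the
lobe to the original outside circle of `c'` and back. -/
lemma glue_path_inr (c : SpinelessCactus ι) (i : ι) (c' : SpinelessCactus κ) (x : ℝ) (k : κ) :
    (c.glue i c').path x (Sum.inr k) = c.radius i / c'.totalRadius *
      c'.path (c.path x i / c.radius i * c'.totalRadius) k := by
  rw [glue, plug_path_inr, rescale_const_path _ _ (div_pos (c.radius_pos i) c'.totalRadius_pos),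
    div_div_eq_mul_div, mul_div_right_comm]

lemma glue_totalRadius (c : SpinelessCactus ι) (i : ι) (c' : SpinelessCactus κ) :
    (c.glue i c').totalRadius = c.totalRadius := by
  rw [totalRadius_eq_sum, totalRadius_eq_sum, Fintype.sum_sum_type]
  simp only [glue_radius_inl, glue_radius_inr]
  rw [← Finset.mul_sum, ← totalRadius_eq_sum c', div_mul_cancel₀ _ c'.totalRadius_pos.ne',
    add_comm, Fintype.sum_eq_add_sum_subtype_ne _ i]

/-- Scaling the lobe and the inserted cactus by one common factor keeps the identification of the
two circles. This compares the two conventions for scaling in a gluing. -/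
lemma plug_rescale (c : SpinelessCactus ι) (i : ι) (c' : SpinelessCactus κ)
    (h : c'.totalRadius = c.radius i) (s : ι → ℝ) (hs : ∀ i, 0 < s i) (h') :
    (c.rescale s hs).plug i (c'.rescale (fun _ => s i) fun _ => hs i) h' =
      (c.plug i c' h).rescale (Sum.elim (fun j : {j : ι // j ≠ i} => s j) fun _ => s i)
        (by rintro (_ | _) <;> exact hs _) := by
  refine eq_rescale _ _ _ _ ?_ fun x => ?_
  · rintro (j | j)
    · rw [plug_radius_inl, plug_radius_inl, rescale_radius]; rfl
    · rw [plug_radius_inr, plug_radius_inr, rescale_radius]; rfl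
  · have hsum : ∑ k, (Sum.elim (fun j : {j : ι // j ≠ i} => s j) fun _ : κ => s i) k *
        (c.plug i c' h).path x k = ∑ k, s k * c.path x k := by
      rw [Fintype.sum_sum_type]
      simp only [plug_path_inl, plug_path_inr, Sum.elim_inl, Sum.elim_inr]
      rw [← Finset.mul_sum, sum_path, add_comm,
        Fintype.sum_eq_add_sum_subtype_ne (fun k => s k * c.path x k) i]
    rw [hsum]
    rintro (j | j)
    · rw [plug_path_inl, plug_path_inl, rescale_path]; rfl
    · rw [plug_path_inr, plug_path_inr, rescale_path, rescale_const_path,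
        mul_div_cancel_left₀ _ (hs i).ne']
      rfl

lemma turn_coe (t : UnitAddCircle) : ((turn t : ℝ) : UnitAddCircle) = t :=
  (AddCircle.equivIco 1 0).symm_apply_apply t

lemma turn_lt_one (t : UnitAddCircle) : turn t < 1 := by
  have := (AddCircle.equivIco 1 0 t).2.2
  simpa [turn] using this

lemma rotate_totalRadius (c : SpinelessCactus ι) (t : UnitAddCircle) :
    (c.rotate t).totalRadius = c.totalRadius := by
  simp only [totalRadius_eq_sum, rotate_radius]

lemma turn_mul_totalRadius_le (c : SpinelessCactus ι) (t : UnitAddCircle) :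
    turn t * c.totalRadius ≤ c.totalRadius := by
  have := mul_le_mul_of_nonneg_right (turn_lt_one t).le c.totalRadius_nonneg
  linarith

lemma exists_turn_eq (u : ℝ) : ∃ n : ℤ, u = turn (u : UnitAddCircle) + n := by
  have := turn_coe (u : UnitAddCircle)
  rw [← sub_eq_zero, ← AddCircle.coe_sub, AddCircle.coe_eq_zero_iff] at this
  obtain ⟨n, hn⟩ := this
  rw [zsmul_eq_mul, mul_one] at hn
  exact ⟨-n, by push_cast; linarith⟩

/-- Any real representative `u` of the angle may be used: another one differs by full turns, whose
contributions to the two terms cancel. -/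
lemma rotate_path (c : SpinelessCactus ι) (u x : ℝ) (i : ι) :
    (c.rotate (u : UnitAddCircle)).path x i =
      c.path (u * c.totalRadius + x) i - c.path (u * c.totalRadius) i := by
  obtain ⟨n, hn⟩ := exists_turn_eq u
  have h0 := mul_nonneg (turn_nonneg (u : UnitAddCircle)) c.totalRadius_nonneg
  have h1 := c.turn_mul_totalRadius_le u
  have key : (c.rotate (u : UnitAddCircle)).path x i =
      c.path (turn (u : UnitAddCircle) * c.totalRadius + x) i -
        c.path (turn (u : UnitAddCircle) * c.totalRadius) i := by
    simp only [path]
    rw [← ArcWord.path_rotate h0 c.word_nonneg h1 c.totalRadius_pos]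
    exact ArcWord.path_congr ArcWord.length_reduce (ArcWord.reduce_lobeLength _ _) (fun y =>
      ArcWord.trav_reduce (c.isCactus.isWeakCactus.rotate h0).nonneg y _) x
  rw [key]
  generalize turn (u : UnitAddCircle) = v at hn
  subst hn
  rw [show (v + n) * c.totalRadius + x = v * c.totalRadius + x + n * c.totalRadius by ring,
    add_mul, path_add_int, path_add_int]
  ring

/-- A change of the representative `u` adds full turns on the lobe, which vanish in the circle. -/
lemma traversed_eq (c : SpinelessCactus ι) (u : ℝ) (i : ι) :
    c.traversed (u : UnitAddCircle) i =
      ((c.path (u * c.totalRadius) i / c.radius i : ℝ) : UnitAddCircle) := by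
  obtain ⟨n, hn⟩ := exists_turn_eq u
  have h0 := mul_nonneg (turn_nonneg (u : UnitAddCircle)) c.totalRadius_nonneg
  have h1 := c.turn_mul_totalRadius_le u
  rw [traversed, ArcWord.cut_lobeLength_fst h0 c.word_nonneg,
    ← ArcWord.path_of_mem c.word_nonneg c.totalRadius_pos h0 h1]
  change ((c.path _ i / _ : ℝ) : UnitAddCircle) = _
  generalize turn (u : UnitAddCircle) = v at hn
  subst hn
  rw [add_mul, path_add_int, add_div, mul_div_cancel_right₀ _ (c.radius_pos i).ne']
  simp

lemma rotate_zero (c : SpinelessCactus ι) : c.rotate 0 = c := by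
  refine eq_of_path_eq (c.rotate_radius 0) fun x i => ?_
  have := c.rotate_path 0 x i
  simpa [path_zero] using this

lemma traversed_zero (c : SpinelessCactus ι) (i : ι) : c.traversed 0 i = 0 := by
  have := c.traversed_eq 0 i
  simpa [path_zero] using this

end SpinelessCactus

/-! ### The topology in terms of walks -/

/-- Pigeonhole on pairs of neighbouring letters: if the pair `i, j` occurs at two places, these do
not overlap, because `i ≠ j`, and the word contains `i, j, i, j`. So there are at most as many
neighbouring pairs as pairs of labels. -/
lemma Treelike.length_le {ι : Type} [Fintype ι] {l : List ι} (hc : l.IsChain (· ≠ ·))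
    (ht : Treelike l) : l.length ≤ Fintype.card ι * Fintype.card ι + 1 := by
  by_contra! hlt
  have hcard : Fintype.card (ι × ι) < Fintype.card (Fin (l.length - 1)) := by
    rw [Fintype.card_prod, Fintype.card_fin]; omega
  obtain ⟨p, q, hpq, h⟩ := Fintype.exists_ne_map_eq_of_card_lt
    (fun p : Fin (l.length - 1) => (l[(p : ℕ)]'(by omega), l[(p : ℕ) + 1]'(by omega))) hcard
  wlog hlt' : p < q generalizing p q
  · exact this q p hpq.symm h.symm (lt_of_le_of_ne (not_lt.1 hlt') hpq.symm)
  simp only [Prod.mk.injEq] at h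
  have hne : ∀ r : Fin (l.length - 1), l[(r : ℕ)]'(by omega) ≠ l[(r : ℕ) + 1]'(by omega) :=
    fun r => List.isChain_iff_getElem.1 hc r (by omega)
  have hpq' : (p : ℕ) + 1 ≠ q := by
    intro he
    apply hne p
    rw [h.1]
    congr 1
    exact he.symm
  have hlt'' : (p : ℕ) < q := hlt'
  refine ht _ _ (hne p) ?_
  have hq := q.2
  -- The four positions `p < p + 1 < q < q + 1` carry the forbidden pattern.
  have : List.Sublist ([⟨p, by omega⟩, ⟨p + 1, by omega⟩, ⟨q, by omega⟩, ⟨q + 1, by omega⟩].map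
      (l.get ·)) l := by
    refine List.map_getElem_sublist ?_
    simp [Fin.mk_lt_mk, -Fin.val_fin_lt]
    omega
  simpa [← h.1, ← h.2] using this

instance {ι : Type} [Fintype ι] : Finite (CactusType ι) := by
  have := List.finite_length_le ι (Fintype.card ι * Fintype.card ι + 1)
  exact (this.subset fun l (h : l.IsChain (· ≠ ·) ∧ (∀ i, i ∈ l) ∧ Treelike l) =>
    Treelike.length_le h.1 h.2.2).to_subtype

/-- A closed subset of a cube: an arc is at most as long as its lobe, which has length one. -/
instance {ι : Type} [DecidableEq ι] (τ : CactusType ι) : CompactSpace (CactusCell τ) := by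
  have key : IsCompact {x : Fin τ.1.length → ℝ | (∀ a, 0 ≤ x a) ∧
      ∀ i, ∑ a, (if τ.1.get a = i then x a else 0) = 1} := ?_
  · exact isCompact_iff_compactSpace.1 key
  refine (isCompact_univ_pi fun _ => isCompact_Icc (a := (0 : ℝ)) (b := 1)).of_isClosed_subset
    ?_ fun x hx a _ => ⟨hx.1 a, ?_⟩
  · simp only [Set.ofPred_and, Set.ofPred_forall]
    refine (isClosed_iInter fun a => isClosed_le continuous_const (continuous_apply a)).inter
      (isClosed_iInter fun i => isClosed_eq ?_ continuous_const)
    refine continuous_finsetSum _ fun a _ => ?_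
    split_ifs
    · exact continuous_apply a
    · exact continuous_const
  · rw [← hx.2 (τ.1.get a)]
    refine le_of_eq_of_le (by simp)
      (Finset.single_le_sum (f := fun b => if τ.1.get b = τ.1.get a then x b else 0)
        (fun b _ => ite_nonneg (hx.1 b) le_rfl) (Finset.mem_univ a))

namespace ArcWord

lemma continuous_trav_ofFn {ι X : Type} [DecidableEq ι] [TopologicalSpace X] {n : ℕ}
    (l : Fin n → ι) {f : Fin n → X → ℝ} (hf : ∀ a, Continuous (f a)) {g : X → ℝ}
    (hg : Continuous g) (i : ι) :
    Continuous fun x => trav (List.ofFn fun a => (l a, f a x)) (g x) i := by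
  induction n generalizing g with
  | zero => simpa using continuous_const
  | succ n ih =>
    simp only [List.ofFn_succ, trav_cons]
    refine Continuous.add ?_ (ih _ (fun a => hf _) (hg.sub (hf 0)))
    have := hf 0
    split_ifs <;> fun_prop

end ArcWord

/-! ### Normalized spineless cacti as a compact space of functions -/

namespace NormalizedSpinelessCactus

variable {ι κ : Type} [DecidableEq ι] [DecidableEq κ] [Fintype ι] [Nonempty ι]
  [Fintype κ] [Nonempty κ]

/-- A cactus lies in the cell of its own label word, at the point given by its arc lengths;
reduction does nothing there because the word is already reduced. -/
lemma toCactus_surjective :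
    Function.Surjective fun x : (τ : CactusType ι) × CactusCell τ => x.2.toCactus := by
  intro c
  have hw := c.1.isCactus
  have hlen : c.1.word.labels.length = List.length c.1.word := by simp [ArcWord.labels]
  have harcs : List.ofFn (fun a => (c.1.word.labels.get a, (c.1.word.get (a.cast hlen)).2)) =
      c.1.word := by
    refine List.ext_getElem (by simp [hlen]) fun n h1 h2 => ?_
    simp only [ArcWord.labels, List.getElem_ofFn, List.get_eq_getElem, List.getElem_map]
    rfl
  refine ⟨⟨⟨c.1.word.labels, hw.adjacent, hw.mem, hw.treelike⟩,
    ⟨fun a => (c.1.word.get (a.cast hlen)).2, fun a => (hw.pos _ (List.get_mem _ _)).le,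
      fun i => ?_⟩⟩, ?_⟩
  · refine Eq.trans ?_ (c.2 i)
    rw [SpinelessCactus.radius]
    conv_rhs => rw [← harcs, ArcWord.lobeLength, List.map_ofFn, List.sum_ofFn]
    rfl
  · refine Subtype.ext (SpinelessCactus.ext_word ?_)
    conv_rhs => rw [← hw.reduce_eq, ← harcs]
    rfl

/-- The quotient of a disjoint union of finitely many compact cells. -/
instance : CompactSpace (NormalizedSpinelessCactus ι) := by
  have : Continuous fun x : (τ : CactusType ι) × CactusCell τ => x.2.toCactus :=
    continuous_coinduced_rng
  exact toCactus_surjective.compactSpace this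

@[ext] lemma ext_val {c d : NormalizedSpinelessCactus ι} (h : c.1 = d.1) : c = d := Subtype.ext h

/-- On each closed cell the period is constant and the walk is a continuous function of the arc
lengths, also at the boundary, where contracted arcs do not matter for the walk. -/
lemma continuous_path (y : ℝ) (i : ι) :
    Continuous fun c : NormalizedSpinelessCactus ι => c.1.path y i := by
  refine continuous_coinduced_dom.2 (continuous_sigma fun τ => ?_)
  have h : ∀ x : CactusCell τ, x.toCactus.1.path y i = ⌊y / Fintype.card ι⌋ * 1 +
      ArcWord.trav (List.ofFn fun a => (τ.1.get a, x.1 a))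
        (y - ⌊y / Fintype.card ι⌋ * Fintype.card ι) i := by
    intro x
    have h1 : x.toCactus.1.word.lobeLength i = 1 := x.toCactus.2 i
    have h2 : x.toCactus.1.word.length = Fintype.card ι := x.toCactus.totalRadius_eq
    rw [SpinelessCactus.path, ArcWord.path, h1, h2]
    congr 1
    exact ArcWord.trav_reduce x.arcs_isWeakCactus.nonneg _ _
  simp only [Function.comp_def, h]
  refine continuous_const.add (ArcWord.continuous_trav_ofFn _ (fun a => ?_) continuous_const i)
  exact (continuous_apply a).comp continuous_subtype_val

/-- The topology of the space of normalized spineless cacti is that of pointwise convergence of the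
walks along the outside circle. -/
lemma isInducing_path :
    Topology.IsInducing fun (c : NormalizedSpinelessCactus ι) (y : ℝ) (i : ι) => c.1.path y i := by
  -- A continuous injection from a compact space to a Hausdorff space is a closed embedding.
  refine (Continuous.isClosedEmbedding ?_ fun c d h => ?_).isInducing
  · exact continuous_pi fun y => continuous_pi fun i => continuous_path y i
  · exact ext_val (SpinelessCactus.eq_of_path_eq (fun i => (c.2 i).trans (d.2 i).symm)
      fun x i => congrFun (congrFun h x) i)

end NormalizedSpinelessCactus

/-! ### Continuity of the operations, tested on walks and radii -/

namespace SpinelessCactus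

variable {ι κ X : Type} [DecidableEq ι] [DecidableEq κ] [Fintype ι] [Nonempty ι]
  [Fintype κ] [Nonempty κ] [TopologicalSpace X]

/-- Not every lobe can stand still while the walk advances, since the walks on the lobes add up to
the walk. -/
lemma rescale_width_strictMono (c : SpinelessCactus ι) (s : ι → ℝ) (hs : ∀ i, 0 < s i) :
    StrictMono fun x => ∑ k, s k * c.path x k := by
  intro x y h
  refine Finset.sum_lt_sum
    (fun k _ => mul_le_mul_of_nonneg_left (c.path_mono h.le k) (hs k).le) ?_
  by_contra! hle
  have : ∑ k, c.path y k ≤ ∑ k, c.path x k :=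
    Finset.sum_le_sum fun k hk => le_of_mul_le_mul_left (hle k hk) (hs k)
  rw [sum_path, sum_path] at this
  linarith

/-- Walks are Lipschitz in the length with a constant independent of the cactus, so continuity for
each fixed length implies joint continuity. -/
lemma continuous_path_comp {c : X → SpinelessCactus ι}
    (hc : ∀ x i, Continuous fun p => (c p).path x i) {g : X → ℝ} (hg : Continuous g) (i : ι) :
    Continuous fun p => (c p).path (g p) i :=
  (continuous_prod_of_continuous_lipschitzWith' (fun q : X × ℝ => (c q.1).path q.2 i) 1
    (fun p => (c p).lipschitz_path i) fun x => hc x i).comp (continuous_id.prodMk hg)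

/-- The walk of the rescaled cactus is the original walk at the inverse of the reparametrization by
scaled lengths. The essential point is that this inverse depends continuously on the parameter. -/
lemma continuous_rescale_path {c : X → SpinelessCactus ι}
    (hc : ∀ x i, Continuous fun p => (c p).path x i) {s : X → ι → ℝ} (hs : ∀ p i, 0 < s p i)
    (hsc : Continuous s) (x : ℝ) (i : ι) :
    Continuous fun p => ((c p).rescale (s p) (hs p)).path x i := by
  have hsc' : ∀ k, Continuous fun p => s p k := fun k => (continuous_apply k).comp hsc
  have hw : ∀ t, Continuous fun p => ∑ k, s p k * (c p).path t k := fun t =>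
    continuous_finsetSum _ fun k _ => (hsc' k).mul (hc t k)
  have hψ : Continuous fun p => ∑ k, (s p k)⁻¹ * ((c p).rescale (s p) (hs p)).path x k := by
    -- By strict monotonicity, comparing the inverse function with `a` is comparing the
    -- reparametrization at `a` with `x`, which is an open condition on the parameter.
    refine OrderTopology.continuous_iff.2 fun a => ⟨?_, ?_⟩
    · convert isOpen_lt (hw a) (continuous_const (y := x)) using 1
      ext p
      conv_rhs => rw [Set.mem_ofPred, ← (c p).rescale_sum_path_inv (s p) (hs p) x]
      exact ((c p).rescale_width_strictMono (s p) (hs p)).lt_iff_lt.symm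
    · convert isOpen_lt (continuous_const (y := x)) (hw a) using 1
      ext p
      conv_rhs => rw [Set.mem_ofPred, ← (c p).rescale_sum_path_inv (s p) (hs p) x]
      exact ((c p).rescale_width_strictMono (s p) (hs p)).lt_iff_lt.symm
  refine ((hsc' i).mul (continuous_path_comp hc hψ i)).congr fun p => ?_
  exact (c p).rescale_path_inv (s p) (hs p) x i

lemma normalize_rescale (c : SpinelessCactus ι) :
    c.normalize.1.rescale c.radius c.radius_pos = c := by
  have : (fun i => c.radius i * (1 / c.radius i)) = fun _ => (1 : ℝ) :=
    funext fun i => mul_one_div_cancel (c.radius_pos i).ne'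
  rw [normalize, rescale_rescale, rescale_congr _ this, rescale_one]

lemma continuous_radius : Continuous (radius : SpinelessCactus ι → ι → ℝ) :=
  have h : Continuous fun c : SpinelessCactus ι => (c.normalize, c.radius) := continuous_induced_dom
  h.snd

lemma continuous_normalize :
    Continuous (normalize : SpinelessCactus ι → NormalizedSpinelessCactus ι) :=
  have h : Continuous fun c : SpinelessCactus ι => (c.normalize, c.radius) := continuous_induced_dom
  h.fst

/-- A cactus is its normalization scaled by its radii, and both depend continuously on it. -/
lemma continuous_path (x : ℝ) (i : ι) : Continuous fun c : SpinelessCactus ι => c.path x i := by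
  have := continuous_rescale_path (c := fun c : SpinelessCactus ι => c.normalize.1)
    (fun x i => (NormalizedSpinelessCactus.continuous_path x i).comp continuous_normalize)
    (fun c => c.radius_pos) continuous_radius x i
  simpa only [normalize_rescale] using this

/-- The continuity criterion used for all operations: walks and radii control the walks of the
normalization, which in turn carry the topology of normalized cacti. -/
lemma continuous_of_path {c : X → SpinelessCactus ι} (hr : ∀ i, Continuous fun p => (c p).radius i)
    (hc : ∀ x i, Continuous fun p => (c p).path x i) : Continuous c := by
  refine continuous_induced_rng.2 (Continuous.prodMk ?_ (continuous_pi hr))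
  refine NormalizedSpinelessCactus.isInducing_path.continuous_iff.2
    (continuous_pi fun x => continuous_pi fun i => ?_)
  exact continuous_rescale_path hc (fun p i => one_div_pos.2 ((c p).radius_pos i))
    (continuous_pi fun i => continuous_const.div (hr i) fun p => ((c p).radius_pos i).ne') x i

lemma continuous_radius_apply (i : ι) : Continuous fun c : SpinelessCactus ι => c.radius i :=
  (continuous_apply i).comp continuous_radius

lemma continuous_totalRadius : Continuous fun c : SpinelessCactus ι => c.totalRadius := by
  simp only [totalRadius_eq_sum]
  exact continuous_finsetSum _ fun i _ => continuous_radius_apply i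

lemma continuous_path_of_continuous {c : X → SpinelessCactus ι} (hc : Continuous c) {g : X → ℝ}
    (hg : Continuous g) (i : ι) : Continuous fun p => (c p).path (g p) i :=
  continuous_path_comp (fun x i => (continuous_path x i).comp hc) hg i

lemma continuous_rescale {c : X → SpinelessCactus ι} (hc : Continuous c) {s : X → ι → ℝ}
    (hs : ∀ p i, 0 < s p i) (hsc : Continuous s) :
    Continuous fun p => (c p).rescale (s p) (hs p) := by
  refine continuous_of_path (fun i => ?_) (continuous_rescale_path
    (fun x i => (continuous_path x i).comp hc) hs hsc)
  simp only [rescale_radius]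
  exact ((continuous_apply i).comp hsc).mul ((continuous_radius_apply i).comp hc)

lemma continuous_relabel (e : ι ≃ κ) : Continuous (relabel e) := by
  refine continuous_of_path (fun k => ?_) fun x k => ?_
  · simp only [relabel_radius]
    exact continuous_radius_apply _
  · simp only [relabel_path]
    exact continuous_path _ _

/-- The covering of the circle by the line is an open quotient map and remains one after taking the
product with `X`. So angles may be lifted to real numbers. -/
lemma continuous_of_continuous_coe {Y : Type} [TopologicalSpace Y] {f : X × UnitAddCircle → Y}
    (h : Continuous fun q : X × ℝ => f (q.1, (q.2 : UnitAddCircle))) : Continuous f := by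
  have hq : IsOpenQuotientMap (Prod.map id (fun x : ℝ => (x : UnitAddCircle)) : X × ℝ → _) :=
    IsOpenQuotientMap.id.prodMap QuotientAddGroup.isOpenQuotientMap_mk
  exact hq.isQuotientMap.continuous_iff.2 h

lemma continuous_rotate :
    Continuous fun q : SpinelessCactus ι × UnitAddCircle => q.1.rotate q.2 := by
  refine continuous_of_continuous_coe (continuous_of_path (fun i => ?_) fun x i => ?_)
  · simp only [rotate_radius]
    exact (continuous_radius_apply i).comp continuous_fst
  · simp only [rotate_path]
    have := (continuous_totalRadius (ι := ι)).comp (continuous_fst (Y := ℝ))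
    have h2 := continuous_snd.mul this
    exact (continuous_path_of_continuous continuous_fst (h2.add continuous_const) i).sub
      (continuous_path_of_continuous continuous_fst h2 i)

lemma continuous_traversed (i : ι) :
    Continuous fun q : SpinelessCactus ι × UnitAddCircle => q.1.traversed q.2 i := by
  refine continuous_of_continuous_coe ?_
  simp only [traversed_eq]
  have := (continuous_totalRadius (ι := ι)).comp (continuous_fst (Y := ℝ))
  have h2 := continuous_snd.mul this
  exact (AddCircle.continuous_mk' 1).comp
    ((continuous_path_of_continuous continuous_fst h2 i).div
      ((continuous_radius_apply i).comp continuous_fst) fun q => (q.1.radius_pos i).ne')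

lemma continuous_glue (i : ι) :
    Continuous fun q : SpinelessCactus ι × SpinelessCactus κ => q.1.glue i q.2 := by
  have hr := (continuous_radius_apply i).comp (continuous_fst (Y := SpinelessCactus κ))
  have hl := (continuous_totalRadius (ι := κ)).comp (continuous_snd (X := SpinelessCactus ι))
  have hs := hr.div hl fun q => q.2.totalRadius_pos.ne'
  refine continuous_of_path ?_ fun x => ?_
  · rintro (j | k)
    · simp only [glue_radius_inl]
      exact (continuous_radius_apply _).comp continuous_fst
    · simp only [glue_radius_inr]
      exact hs.mul ((continuous_radius_apply k).comp continuous_snd)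
  · rintro (j | k)
    · simp only [glue_path_inl]
      exact (continuous_path _ _).comp continuous_fst
    · simp only [glue_path_inr]
      refine hs.mul (continuous_path_of_continuous continuous_snd ?_ k)
      exact (((continuous_path x i).comp continuous_fst).div hr
        fun q => (q.1.radius_pos i).ne').mul hl

end SpinelessCactus

/-! ### Comparison of the two gluings of normalized cacti -/

namespace NormalizedSpinelessCactus

variable {ι κ X : Type} [DecidableEq ι] [DecidableEq κ] [Fintype ι] [Nonempty ι]
  [Fintype κ] [Nonempty κ] [TopologicalSpace X]

lemma continuous_val : Continuous fun c : NormalizedSpinelessCactus ι => c.1 := by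
  refine SpinelessCactus.continuous_of_path (fun i => ?_) continuous_path
  exact continuous_const.congr fun c => (c.2 i).symm

lemma normalize_val (c : NormalizedSpinelessCactus ι) : c.1.normalize = c := by
  refine ext_val ?_
  have : (fun i => 1 / c.1.radius i) = fun _ => (1 : ℝ) := funext fun i => by rw [c.2, div_one]
  change c.1.rescale _ (fun i => one_div_pos.2 (c.1.radius_pos i)) = c.1
  rw [SpinelessCactus.rescale_congr _ this, SpinelessCactus.rescale_one]

/-- The gluing of normalized spineless cacti is the normalization of the gluing of spineless
cacti. -/
lemma glue_eq (c : NormalizedSpinelessCactus ι) (i : ι) (c' : NormalizedSpinelessCactus κ) :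
    c.glue i c' = (c.1.glue i c'.1).normalize := by
  have hl := c'.totalRadius_eq
  have hN : (0 : ℝ) < Fintype.card κ := by exact_mod_cast Fintype.card_pos
  let s : ι → ℝ := fun k => if k = i then (Fintype.card κ : ℝ) else 1
  have hs : ∀ k, 0 < s k := fun k => by
    dsimp only [s]
    split_ifs
    · exact hN
    · exact one_pos
  have hsi : s i = Fintype.card κ := if_pos rfl
  have h1 : (fun _ => s i * (c.1.radius i / c'.1.totalRadius) : κ → ℝ) = fun _ => 1 := by
    rw [hl, c.2, hsi, mul_one_div_cancel hN.ne']
  -- In the gluing of spineless cacti, `c'` is shrunk to total length one; the factor `s i`, its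
  -- number of lobes, restores it.
  have h2 : (c'.1.rescale (fun _ => c.1.radius i / c'.1.totalRadius) fun _ =>
      div_pos (c.1.radius_pos i) c'.1.totalRadius_pos).rescale (fun _ => s i) (fun _ => hs i) =
      c'.1 := by
    rw [SpinelessCactus.rescale_rescale, SpinelessCactus.rescale_congr _ h1,
      SpinelessCactus.rescale_one]
  have h3 : c'.1.totalRadius = (c.1.rescale s hs).radius i := by
    rw [SpinelessCactus.rescale_radius, c.2, hsi, hl, mul_one]
  refine ext_val ?_
  change (c.1.rescale s hs).plug i c'.1 h3 = (c.1.glue i c'.1).rescale _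
    (fun j => one_div_pos.2 ((c.1.glue i c'.1).radius_pos j))
  have h5 : (c'.1.rescale (fun _ => c.1.radius i / c'.1.totalRadius) fun _ =>
      div_pos (c.1.radius_pos i) c'.1.totalRadius_pos).totalRadius = c.1.radius i :=
    (ArcWord.length_rescale _ _).trans (div_mul_cancel₀ _ c'.1.totalRadius_pos.ne')
  -- Enlarging the lobe `i` and the shrunken `c'` together turns the gluing of spineless cacti into
  -- the normalized one.
  have h4 := c.1.plug_rescale i _ h5 s hs (by rw [h2]; exact h3)
  simp only [h2] at h4
  rw [h4]
  -- The factors are those of the normalization: in the glued cactus the old lobes have radius one,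
  -- the inserted ones the inverse of the number of lobes of `c'`.
  refine SpinelessCactus.rescale_congr (c.1.glue i c'.1) (funext ?_) _
  rintro (j | k)
  · rw [SpinelessCactus.glue_radius_inl, c.2, div_one]
    exact if_neg j.2
  · rw [SpinelessCactus.glue_radius_inr, c.2, c'.2, hl, mul_one, one_div_one_div]
    exact hsi

end NormalizedSpinelessCactus

/-! ### Inserting a block of values -/

/-- Inserting the block `g` in place of the entry `i` of `f`. -/
def insertVal {α : Type} {m n l : ℕ} (h : m + n = l) (i : Fin (m + 1)) (f : Fin (m + 1) → α)
    (g : Fin (n + 1) → α) (v : Fin (l + 1)) : α :=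
  if _ : (v : ℕ) < i then f ⟨v, by omega⟩
  else if _ : (v : ℕ) ≤ i + n then g ⟨v - i, by omega⟩ else f ⟨v - n, by omega⟩

section InsertVal

variable {α β : Type}

lemma insertVal_insertEquiv {m n l : ℕ} (h : m + n = l) (i : Fin (m + 1)) (f : Fin (m + 1) → α)
    (g : Fin (n + 1) → α) (u : {j : Fin (m + 1) // j ≠ i} ⊕ Fin (n + 1)) :
    insertVal h i f g (insertEquiv h i u) = Sum.elim (fun j : {j // j ≠ i} => f j) g u := by
  change insertVal h i f g (insertFun h i u) = _
  rcases u with ⟨j, hj⟩ | k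
  · have hj' : (j : ℕ) ≠ i := fun h => hj (Fin.ext h)
    simp only [insertFun, Sum.elim_inl, Fin.lt_def]
    by_cases hlt : (j : ℕ) < i
    · rw [if_pos hlt, insertVal, dif_pos hlt]
    · rw [if_neg hlt, insertVal, dif_neg (by dsimp only; omega), dif_neg (by dsimp only; omega)]
      exact congrArg f (Fin.ext (by simp))
  · simp only [insertFun, Sum.elim_inr]
    rw [insertVal, dif_neg (by dsimp only; omega), dif_pos (by dsimp only; omega)]
    exact congrArg g (Fin.ext (by simp))

/-- Both sides agree on the image of every label under the insertion, where the block permutation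
acts by `σ` outside the block and by `τ` inside. -/
lemma insertVal_blockPerm {m n l : ℕ} (h : m + n = l) (i : Fin (m + 1))
    (σ : Equiv.Perm (Fin (m + 1))) (τ : Equiv.Perm (Fin (n + 1))) (f : Fin (m + 1) → α)
    (g : Fin (n + 1) → α) :
    insertVal h (σ i) (f ∘ σ.symm) (g ∘ τ.symm) =
      insertVal h i f g ∘ (blockPerm h i σ τ).symm := by
  funext v
  obtain ⟨v, rfl⟩ := (blockPerm h i σ τ).surjective v
  obtain ⟨u, rfl⟩ := (insertEquiv h i).surjective v
  rw [Function.comp_apply, Equiv.symm_apply_apply, insertVal_insertEquiv]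
  simp only [blockPerm, Equiv.trans_apply, Equiv.symm_apply_apply, insertVal_insertEquiv]
  rcases u with j | k <;> simp

lemma insertVal_apply_of_lt {m n l : ℕ} (h : m + n = l) (i : Fin (m + 1)) (f : Fin (m + 1) → α)
    (g : Fin (n + 1) → α) {j : Fin (m + 1)} {j' : Fin (l + 1)} (hj : j < i) (hj' : (j' : ℕ) = j) :
    insertVal h i f g j' = f j := by
  rw [Fin.lt_def] at hj
  rw [insertVal, dif_pos (by omega)]
  congr 1
  ext
  exact hj'

lemma insertVal_apply_block {m n l : ℕ} (h : m + n = l) (i : Fin (m + 1)) (f : Fin (m + 1) → α)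
    (g : Fin (n + 1) → α) {j : Fin (n + 1)} {j' : Fin (l + 1)} (hj' : (j' : ℕ) = i + j) :
    insertVal h i f g j' = g j := by
  rw [insertVal, dif_neg (by omega), dif_pos (by omega)]
  congr 1
  ext
  simp [hj']

lemma insertVal_apply_of_gt {m n l : ℕ} (h : m + n = l) (i : Fin (m + 1)) (f : Fin (m + 1) → α)
    (g : Fin (n + 1) → α) {j : Fin (m + 1)} {j' : Fin (l + 1)} (hj : i < j)
    (hj' : (j' : ℕ) = j + n) : insertVal h i f g j' = f j := by
  rw [Fin.lt_def] at hj
  rw [insertVal, dif_neg (by omega), dif_neg (by omega)]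
  congr 1
  ext
  simp [hj']

lemma map_insertVal (φ : α → β) {m n l : ℕ} (h : m + n = l) (i : Fin (m + 1))
    (f : Fin (m + 1) → α) (g : Fin (n + 1) → α) :
    (fun v => φ (insertVal h i f g v)) =
      insertVal h i (fun j => φ (f j)) fun k => φ (g k) := by
  funext v
  simp only [insertVal]
  split_ifs <;> rfl

/-- Two disjoint blocks can be inserted in either order. This is the label part of both parallel
associativity relations. -/
lemma insertVal_comm {k l m kl km n : ℕ} (hkl : k + l = kl) (hkm : k + m = km) (hn : kl + m = n)
    (hn' : km + l = n) (i j : Fin (k + 1)) (j' : Fin (kl + 1)) (i' : Fin (km + 1))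
    (hij : j < i) (hj : (j' : ℕ) = j) (hi : (i' : ℕ) = i + m) (f : Fin (k + 1) → α)
    (g : Fin (l + 1) → α) (e : Fin (m + 1) → α) :
    insertVal hn j' (insertVal hkl i f g) e = insertVal hn' i' (insertVal hkm j f e) g := by
  rw [Fin.lt_def] at hij
  funext v
  simp only [insertVal]
  split_ifs <;> first | omega | rfl | exact congrArg _ (Fin.ext (by dsimp only; omega))

/-- A block inside a block: the label part of the nested associativity relation. -/
lemma insertVal_assoc {k l m kl lm n : ℕ} (hkl : k + l = kl) (hlm : l + m = lm) (hn : kl + m = n)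
    (hn' : k + lm = n) (i : Fin (k + 1)) (j : Fin (l + 1)) (j' : Fin (kl + 1))
    (hj : (j' : ℕ) = i + j) (f : Fin (k + 1) → α) (g : Fin (l + 1) → α) (e : Fin (m + 1) → α) :
    insertVal hn j' (insertVal hkl i f g) e = insertVal hn' i f (insertVal hlm j g e) := by
  funext v
  simp only [insertVal]
  split_ifs <;> first | omega | rfl | exact congrArg _ (Fin.ext (by dsimp only; omega))

end InsertVal

/-! ### The operad of cacti -/

namespace Cactus

open SpinelessCactus

variable {ι κ : Type} [DecidableEq ι] [DecidableEq κ] [Fintype ι] [Nonempty ι]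
  [Fintype κ] [Nonempty κ]

/-- The projection of the outside circle to the lobe `i`, where the origins are the global zero
and the local zero. -/
noncomputable def spin (c : Cactus ι) (t : UnitAddCircle) (i : ι) : UnitAddCircle :=
  c.1.traversed t i - c.2 i

/-- Circle maps know the walks only modulo full turns, but the difference of two walks, measured in
turns, is a continuous integer-valued function vanishing at zero. -/
lemma eq_of_spin_eq {c d : Cactus ι} (hr : c.1.radius = d.1.radius)
    (h : ∀ t i, c.spin t i = d.spin t i) : c = d := by
  have hr := congrFun hr
  -- At the global zero nothing has been traversed, so the circle map takes the value `-c.2 i`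
  -- there.
  have h2 : c.2 = d.2 := funext fun i => by
    have := h 0 i
    simpa [spin, traversed_zero] using this
  have hl : c.1.totalRadius = d.1.totalRadius := by simp only [totalRadius_eq_sum, hr]
  refine Prod.ext (eq_of_path_eq hr fun x i => ?_) h2
  have hint : ∀ y : ℝ, ∃ n : ℤ, c.1.path y i / c.1.radius i - d.1.path y i / c.1.radius i = n := by
    intro y
    have := h (y / c.1.totalRadius : ℝ) i
    rw [spin, spin, h2, sub_left_inj, traversed_eq, traversed_eq, ← hl, ← hr,
      div_mul_cancel₀ _ c.1.totalRadius_pos.ne', ← sub_eq_zero, ← AddCircle.coe_sub,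
      AddCircle.coe_eq_zero_iff] at this
    obtain ⟨n, hn⟩ := this
    exact ⟨n, by rw [← hn]; simp⟩
  choose n hn using hint
  -- The integers are closed and discrete in the reals, so `n` inherits continuity from the walks
  -- and is constant on the connected line.
  have hc : Continuous n := by
    rw [Int.isClosedEmbedding_coe_real.isInducing.continuous_iff]
    refine (((c.1.lipschitz_path i).continuous.div_const _).sub
      ((d.1.lipschitz_path i).continuous.div_const (c.1.radius i))).congr hn
  have h0 : n x = n 0 := PreconnectedSpace.constant inferInstance hc
  have h00 : n 0 = 0 := by
    have := hn 0
    rw [path_zero, path_zero, sub_self] at this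
    exact_mod_cast this.symm
  have := hn x
  rw [h0, h00, Int.cast_zero, sub_eq_zero] at this
  exact (div_left_inj' (c.1.radius_pos i).ne').1 this

lemma relabel_spin (e : ι ≃ κ) (c : Cactus ι) (t : UnitAddCircle) (k : κ) :
    (c.relabel e).spin t k = c.spin t (e.symm k) := by
  rw [← turn_coe t]
  have : (c.1.relabel e).totalRadius = c.1.totalRadius := ArcWord.length_relabel _ _
  simp only [spin, relabel, traversed_eq, relabel_path, SpinelessCactus.relabel_radius, this,
    Function.comp_apply]

lemma glue_spin_inl (c : Cactus ι) (i : ι) (c' : Cactus κ) (t : UnitAddCircle)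
    (j : {j : ι // j ≠ i}) : (c.glue i c').spin t (Sum.inl j) = c.spin t j := by
  rw [← turn_coe t]
  have : (c.glue i c').1.totalRadius = c.1.totalRadius := glue_totalRadius _ _ _
  simp only [spin, traversed_eq, this]
  simp only [glue, glue_path_inl, glue_radius_inl, Sum.elim_inl]

/-- Gluing matches the local zero of the lobe with the global zero of `c'`, which are the origins of
the two circle maps; so the maps compose. The rotation of `c'` and the correction of its local zeros
are two sides of the same change of root points and cancel. -/
lemma glue_spin_inr (c : Cactus ι) (i : ι) (c' : Cactus κ) (t : UnitAddCircle) (k : κ) :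
    (c.glue i c').spin t (Sum.inr k) = c'.spin (c.spin t i) k := by
  rw [← turn_coe t]
  have h1 : (c.glue i c').1.totalRadius = c.1.totalRadius := glue_totalRadius _ _ _
  have hr := c.1.radius_pos i
  have hL := c'.1.totalRadius_pos
  -- A real representative of the angle of rotation, so that the formulas for walks apply.
  obtain ⟨u, hu⟩ := QuotientAddGroup.mk_surjective (-c.2 i)
  change (u : UnitAddCircle) = -c.2 i at hu
  generalize turn t = x
  have h2 : c.spin (x : UnitAddCircle) i =
      ((u + c.1.path (x * c.1.totalRadius) i / c.1.radius i : ℝ) : UnitAddCircle) := by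
    rw [spin, traversed_eq, sub_eq_add_neg, ← hu, ← AddCircle.coe_add, add_comm]
  rw [h2]
  simp only [spin, traversed_eq, h1]
  simp only [glue, glue_path_inr, glue_radius_inr, Sum.elim_inr, ← hu, rotate_path,
    rotate_totalRadius, rotate_radius, traversed_eq]
  rw [sub_sub_eq_add_sub, sub_left_inj, ← AddCircle.coe_add,
    mul_div_mul_left _ _ (div_pos hr hL).ne', ← add_div, sub_add_cancel, add_mul]

lemma glue_radius_inl (c : Cactus ι) (i : ι) (c' : Cactus κ) (j : {j : ι // j ≠ i}) :
    (c.glue i c').1.radius (Sum.inl j) = c.1.radius j :=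
  SpinelessCactus.glue_radius_inl _ _ _ _

lemma glue_radius_inr (c : Cactus ι) (i : ι) (c' : Cactus κ) (k : κ) :
    (c.glue i c').1.radius (Sum.inr k) = c.1.radius i / c'.1.totalRadius * c'.1.radius k := by
  simp only [glue, SpinelessCactus.glue_radius_inr, rotate_totalRadius, rotate_radius]

lemma continuous_glue (i : ι) : Continuous fun q : Cactus ι × Cactus κ => q.1.glue i q.2 := by
  have h1 : Continuous fun q : Cactus ι × Cactus κ => q.1.1 := continuous_fst.fst
  have h2 : Continuous fun q : Cactus ι × Cactus κ => q.2.1 := continuous_snd.fst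
  have h3 : ∀ j, Continuous fun q : Cactus ι × Cactus κ => q.1.2 j := fun j =>
    (continuous_apply j).comp continuous_fst.snd
  have h4 : ∀ k, Continuous fun q : Cactus ι × Cactus κ => q.2.2 k := fun k =>
    (continuous_apply k).comp continuous_snd.snd
  have h5 := h2.prodMk (h3 i).neg
  refine Continuous.prodMk ?_ (continuous_pi ?_)
  · exact (SpinelessCactus.continuous_glue i).comp (h1.prodMk (continuous_rotate.comp h5))
  · rintro (j | k)
    · exact h3 j
    · exact (h4 k).sub ((continuous_traversed k).comp h5)

lemma continuous_relabel (e : ι ≃ κ) : Continuous (relabel e) :=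
  ((SpinelessCactus.continuous_relabel e).comp continuous_fst).prodMk
    (continuous_pi fun k => (continuous_apply (e.symm k)).comp continuous_snd)

end Cactus

/-! ### The composition of cacti in terms of circle maps and radii -/

section

variable {m n l : ℕ} (h : m + n = l) (i : Fin (m + 1))

lemma cacti_comp_spin (a : cacti.space m) (b : cacti.space n) (t : UnitAddCircle) :
    Cactus.spin (cacti.comp h i a b) t =
      insertVal h i (Cactus.spin a t) (Cactus.spin b (Cactus.spin a t i)) := by
  funext v
  obtain ⟨u, rfl⟩ := (insertEquiv h i).surjective v
  rw [insertVal_insertEquiv]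
  refine (Cactus.relabel_spin _ _ _ _).trans ?_
  rw [Equiv.symm_apply_apply]
  rcases u with j | k
  · exact Cactus.glue_spin_inl _ _ _ _ _
  · exact Cactus.glue_spin_inr _ _ _ _ _

lemma cacti_comp_radius (a : cacti.space m) (b : cacti.space n) :
    (Prod.fst (cacti.comp h i a b)).radius = insertVal h i a.1.radius
      fun k => a.1.radius i / b.1.totalRadius * b.1.radius k := by
  funext v
  obtain ⟨u, rfl⟩ := (insertEquiv h i).surjective v
  rw [insertVal_insertEquiv]
  refine (SpinelessCactus.relabel_radius _ _ _).trans ?_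
  rw [Equiv.symm_apply_apply]
  rcases u with j | k
  · exact Cactus.glue_radius_inl _ _ _ _
  · exact Cactus.glue_radius_inr _ _ _ _

/-- The inserted cactus is scaled to the lobe it replaces; this is why the scaling factors agree in
iterated compositions. -/
lemma cacti_comp_totalRadius (a : cacti.space m) (b : cacti.space n) :
    (Prod.fst (cacti.comp h i a b)).totalRadius = a.1.totalRadius :=
  (ArcWord.length_relabel _ _).trans (SpinelessCactus.glue_totalRadius _ _ _)

lemma cacti_act_spin (σ : Equiv.Perm (Fin (m + 1))) (a : cacti.space m) (t : UnitAddCircle) :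
    Cactus.spin (cacti.act σ a) t = Cactus.spin a t ∘ σ.symm :=
  funext fun _ => Cactus.relabel_spin _ _ _ _

lemma cacti_act_radius (σ : Equiv.Perm (Fin (m + 1))) (a : cacti.space m) :
    (Prod.fst (cacti.act σ a)).radius = a.1.radius ∘ σ.symm :=
  funext fun _ => SpinelessCactus.relabel_radius _ _ _

lemma cacti_act_totalRadius (σ : Equiv.Perm (Fin (m + 1))) (a : cacti.space m) :
    (Prod.fst (cacti.act σ a)).totalRadius = a.1.totalRadius :=
  ArcWord.length_relabel _ _

end

/-- All operad axioms are checked through this: each becomes an identity between families of circle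
maps and between families of radii. -/
lemma cacti_ext {n : ℕ} {a b : cacti.space n} (hr : a.1.radius = b.1.radius)
    (h : ∀ t, Cactus.spin a t = Cactus.spin b t) : a = b :=
  Cactus.eq_of_spin_eq hr fun t i => congrFun (h t) i

/-- On circle maps, composition is substitution into the block of labels, so its axioms are those of
composing functions and of inserting blocks. On radii only a scaling factor has to be followed. -/
theorem isOperad_cacti : cacti.IsOperad where
  continuous_act σ := Cactus.continuous_relabel σ
  act_one a := cacti_ext (by rw [cacti_act_radius]; rfl) fun t => by rw [cacti_act_spin]; rfl
  act_mul σ τ a := cacti_ext (by simp only [cacti_act_radius]; rfl)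
    fun t => by simp only [cacti_act_spin]; rfl
  continuous_comp h i := (Cactus.continuous_relabel _).comp (Cactus.continuous_glue i)
  equivariant h i σ τ a b := by
    refine cacti_ext ?_ fun t => ?_
    · rw [cacti_act_radius, cacti_comp_radius, cacti_comp_radius, ← insertVal_blockPerm,
        cacti_act_radius, cacti_act_radius, cacti_act_totalRadius, Function.comp_apply,
        Equiv.symm_apply_apply]
      rfl
    · rw [cacti_act_spin, cacti_comp_spin, cacti_comp_spin, ← insertVal_blockPerm,
        cacti_act_spin, cacti_act_spin, Function.comp_apply, Equiv.symm_apply_apply]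
  assoc_left hkl hkm hn hn' i j j' i' hij hj hi a b c := by
    refine cacti_ext ?_ fun t => ?_
    · simp only [cacti_comp_radius]
      rw [insertVal_apply_of_lt hkl i _ _ hij hj, insertVal_apply_of_gt hkm j _ _ hij hi,
        insertVal_comm hkl hkm hn hn' i j j' i' hij hj hi]
    · simp only [cacti_comp_spin]
      rw [insertVal_apply_of_lt hkl i _ _ hij hj, insertVal_apply_of_gt hkm j _ _ hij hi,
        insertVal_comm hkl hkm hn hn' i j j' i' hij hj hi]
  assoc_middle hkl hlm hn hn' i j j' hj a b c := by
    refine cacti_ext ?_ fun t => ?_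
    · simp only [cacti_comp_radius, cacti_comp_totalRadius]
      -- The factor that fits `b` into the lobe `i` scales the whole composite of `b` and `c`, whose
      -- outside circle is as long as that of `b`.
      rw [insertVal_apply_block hkl i _ _ hj, map_insertVal, insertVal_assoc hkl hlm hn hn' i j j' hj]
      simp only [mul_div_assoc, mul_assoc]
    · simp only [cacti_comp_spin]
      rw [insertVal_apply_block hkl i _ _ hj, insertVal_assoc hkl hlm hn hn' i j j' hj]
  assoc_right hkl hkm hn hn' i j j' i' hij hj hi a b c := by
    refine cacti_ext ?_ fun t => ?_
    · simp only [cacti_comp_radius]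
      rw [insertVal_apply_of_gt hkl i _ _ hij hj, insertVal_apply_of_lt hkm j _ _ hij hi,
        -- The commutation of disjoint blocks with the roles of the two blocks exchanged.
        ← insertVal_comm hkm hkl hn' hn j i i' j' hij hi hj]
    · simp only [cacti_comp_spin]
      rw [insertVal_apply_of_gt hkl i _ _ hij hj, insertVal_apply_of_lt hkm j _ _ hij hi,
        ← insertVal_comm hkm hkl hn' hn j i i' j' hij hi hj]

/-! ### Quasi-operads obtained by deformation -/

namespace TopCollection

/-- The collection `B` is an equivariant deformation retract of `A` with the compositions
induced from those of `A`. -/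
structure IsDeformationRetract (A B : TopCollection) (r : ∀ n, A.space n → B.space n)
    (s : ∀ n, B.space n → A.space n) (H : ∀ n, unitInterval × A.space n → A.space n) : Prop where
  continuous_r : ∀ n, Continuous (r n)
  continuous_s : ∀ n, Continuous (s n)
  continuous_H : ∀ n, Continuous (H n)
  r_act : ∀ {n} (σ : Equiv.Perm (Fin (n + 1))) (a : A.space n), r n (A.act σ a) = B.act σ (r n a)
  s_act : ∀ {n} (σ : Equiv.Perm (Fin (n + 1))) (b : B.space n), s n (B.act σ b) = A.act σ (s n b)
  H_act : ∀ {n} (σ : Equiv.Perm (Fin (n + 1))) (t) (a : A.space n),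
    H n (t, A.act σ a) = A.act σ (H n (t, a))
  r_s : ∀ {n} (b : B.space n), r n (s n b) = b
  H_zero : ∀ {n} (a : A.space n), H n (0, a) = a
  H_one : ∀ {n} (a : A.space n), H n (1, a) = s n (r n a)
  comp : ∀ {m n l : ℕ} (h : m + n = l) (i : Fin (m + 1)) (a : B.space m) (b : B.space n),
    B.comp h i a b = r l (A.comp h i (s m a) (s n b))

lemma continuous_comp_comp {A : TopCollection} (hA : A.IsQuasiOperad) {X : Type}
    [TopologicalSpace X] {m n l : ℕ} (h : m + n = l) (i : Fin (m + 1)) {f : X → A.space m}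
    {g : X → A.space n} (hf : Continuous f) (hg : Continuous g) :
    Continuous fun x => A.comp h i (f x) (g x) :=
  (hA.continuous_comp h i).comp (hf.prodMk hg)

namespace IsDeformationRetract

variable {A B : TopCollection} {r : ∀ n, A.space n → B.space n} {s : ∀ n, B.space n → A.space n}
  {H : ∀ n, unitInterval × A.space n → A.space n} (hd : IsDeformationRetract A B r s H)
  (hA : A.IsQuasiOperad)

include hd hA

/-- The axioms of a quasi-operad involve each composition only once, so they pass through `r` and
`s`. Associativity would not, because `s ∘ r` would intervene between two compositions. -/
theorem isQuasiOperad : B.IsQuasiOperad where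
  continuous_act {n} σ := by
    refine ((hd.continuous_r n).comp ((hA.continuous_act σ).comp (hd.continuous_s n))).congr
      fun b => ?_
    simp only [Function.comp_apply, hd.r_act, hd.r_s]
  act_one b := by rw [← hd.r_s b, ← hd.r_act, hA.act_one]
  act_mul σ τ b := by rw [← hd.r_s b, ← hd.r_act, hA.act_mul, hd.r_act, hd.r_act]
  continuous_comp {m n l} h i := by
    simp only [hd.comp]
    exact (hd.continuous_r l).comp (continuous_comp_comp hA h i
      ((hd.continuous_s m).comp continuous_fst) ((hd.continuous_s n).comp continuous_snd))
  equivariant h i σ τ a b := by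
    rw [hd.comp, hd.comp, hd.s_act, hd.s_act, hA.equivariant, hd.r_act]

/-- Both arguments are deformed before they are composed. This is a homotopy through quasi-operads
on `A`, since only equivariance is demanded at each time; at its end, `r` is a morphism to `B`. -/
theorem homotopyEquivalent : HomotopyEquivalent A B := by
  have hB := hd.isQuasiOperad hA
  -- At `t = 0` these are the given compositions; at `t = 1` they depend only on the retractions of
  -- the arguments.
  let c : unitInterval → A.Compositions := fun t m n l h i a b =>
    A.comp h i (H m (t, a)) (H n (t, b))
  have hc : ∀ (m n l : ℕ) (h : m + n = l) (i : Fin (m + 1)),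
      Continuous fun p : unitInterval × A.space m × A.space n =>
        c p.1 m n l h i p.2.1 p.2.2 := fun m n l h i =>
    continuous_comp_comp hA h i
      ((hd.continuous_H m).comp (continuous_fst.prodMk continuous_snd.fst))
      ((hd.continuous_H n).comp (continuous_fst.prodMk continuous_snd.snd))
  have hq : ∀ t, (A.withComp (c t)).IsQuasiOperad := fun t =>
    { continuous_act := hA.continuous_act
      act_one := hA.act_one
      act_mul := hA.act_mul
      continuous_comp := fun {m n l} h i => (hc m n l h i).comp (continuous_const.prodMk continuous_id)
      equivariant := fun {m n l} h i σ τ =>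
        have key : ∀ (a : A.space m) (b : A.space n),
            A.comp h (σ i) (H m (t, A.act σ a)) (H n (t, A.act τ b)) =
              A.act (blockPerm h i σ τ) (A.comp h i (H m (t, a)) (H n (t, b))) := fun a b => by
          rw [hd.H_act, hd.H_act, hA.equivariant]
        key }
  have h0 : A = A.withComp (c 0) := by
    have : c 0 = fun m n l h i a b => A.comp h i a b := by
      funext m n l h i a b
      simp only [c, hd.H_zero]
    rw [this]
    rfl
  refine (Relation.EqvGen.rel _ _ (.homotopy ⟨c, hc, hq, h0, rfl⟩)).trans _ _ _
    (.rel _ _ (.equivalence (hq 1) hB r ⟨⟨hd.continuous_r, hd.r_act, fun {m n l} h i => ?_⟩,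
      fun n => ?_⟩))
  · have key : ∀ (a : A.space m) (b : A.space n),
        r l (A.comp h i (H m (1, a)) (H n (1, b))) = B.comp h i (r m a) (r n b) := fun a b => by
      rw [hd.H_one, hd.H_one, hd.comp]
    exact key
  -- The homotopy inverse is `s`; the deformation is run backwards because the homotopy has to end
  -- at the identity. The other composite is the identity, with constant homotopy.
  · refine ⟨s n, fun p => H n (unitInterval.symm p.1, p.2), fun p => p.2, hd.continuous_s n, ?_,
      continuous_snd, hd.s_act, ?_, fun _ _ _ => rfl, ?_, ?_, fun b => (hd.r_s b).symm,
      fun _ => rfl⟩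
    · exact (hd.continuous_H n).comp
        ((unitInterval.continuous_symm.comp continuous_fst).prodMk continuous_snd)
    · exact fun σ t a => hd.H_act σ _ a
    · intro a
      simp only [unitInterval.symm_zero]
      exact hd.H_one a
    · intro a
      simp only [unitInterval.symm_one]
      exact hd.H_zero a

end IsDeformationRetract

/-- A retract of an operad that is closed under the compositions is an operad. -/
theorem IsOperad.of_retract {A B : TopCollection} (hA : A.IsOperad)
    {r : ∀ n, A.space n → B.space n} {s : ∀ n, B.space n → A.space n}
    (hr : ∀ n, Continuous (r n)) (hs : ∀ n, Continuous (s n))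
    (hrs : ∀ {n} (b : B.space n), r n (s n b) = b)
    (hact : ∀ {n} (σ : Equiv.Perm (Fin (n + 1))) (b : B.space n),
      s n (B.act σ b) = A.act σ (s n b))
    (hcomp : ∀ {m n l : ℕ} (h : m + n = l) (i : Fin (m + 1)) (a : B.space m) (b : B.space n),
      s l (B.comp h i a b) = A.comp h i (s m a) (s n b)) : B.IsOperad := by
  -- The map `s` is injective, so each algebraic axiom may be verified in `A`.
  have hinj : ∀ {n} {a b : B.space n}, s n a = s n b → a = b := fun {n a b} h => by
    rw [← hrs a, h, hrs]
  refine { continuous_act := fun {n} σ => ?_, act_one := fun a => hinj ?_,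
           act_mul := fun σ τ a => hinj ?_, continuous_comp := fun {m n l} h i => ?_,
           equivariant := fun h i σ τ a b => hinj ?_
           assoc_left := fun hkl hkm hn hn' i j j' i' hij hj hi a b c => hinj ?_
           assoc_middle := fun hkl hlm hn hn' i j j' hj a b c => hinj ?_
           assoc_right := fun hkl hkm hn hn' i j j' i' hij hj hi a b c => hinj ?_ }
  · refine ((hr n).comp ((hA.continuous_act σ).comp (hs n))).congr fun b => ?_
    simp only [Function.comp_apply, ← hact, hrs]
  · rw [hact, hA.act_one]
  · simp only [hact, hA.act_mul]
  · refine ((hr l).comp (continuous_comp_comp hA.toIsQuasiOperad h i ((hs m).comp continuous_fst)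
      ((hs n).comp continuous_snd))).congr fun b => ?_
    simp only [Function.comp_apply, ← hcomp, hrs]
  · simp only [hact, hcomp, hA.equivariant]
  · simp only [hcomp]
    exact hA.assoc_left hkl hkm hn hn' i j j' i' hij hj hi _ _ _
  · simp only [hcomp]
    exact hA.assoc_middle hkl hlm hn hn' i j j' hj _ _ _
  · simp only [hcomp]
    exact hA.assoc_right hkl hkm hn hn' i j j' i' hij hj hi _ _ _

end TopCollection

/-! ### The deformation to normalized cacti -/

namespace SpinelessCactus

variable {ι κ : Type} [DecidableEq ι] [DecidableEq κ] [Fintype ι] [Nonempty ι]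
  [Fintype κ] [Nonempty κ]

/-- The factors by which the lobes are scaled at the time `t` of the deformation to normalized
spineless cacti. -/
noncomputable def deformFactor (t : unitInterval) (c : SpinelessCactus ι) (i : ι) : ℝ :=
  -- This factor moves the radius along the segment from its value to one.
  ((1 - t) * c.radius i + t) / c.radius i

lemma deformFactor_pos (t : unitInterval) (c : SpinelessCactus ι) (i : ι) :
    0 < deformFactor t c i := by
  have hr := c.radius_pos i
  refine div_pos ?_ hr
  have h0 := t.2.1
  have h1 := t.2.2
  rcases h1.lt_or_eq with h1 | h1
  · exact add_pos_of_pos_of_nonneg (mul_pos (by linarith) hr) h0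
  · rw [h1]; simp

/-- The deformation of spineless cacti to normalized ones. -/
noncomputable def deform (p : unitInterval × SpinelessCactus ι) : SpinelessCactus ι :=
  p.2.rescale (deformFactor p.1 p.2) (deformFactor_pos p.1 p.2)

lemma continuous_deform : Continuous (deform (ι := ι)) := by
  refine continuous_rescale continuous_snd _ (continuous_pi fun i => ?_)
  have hr := (continuous_radius_apply i).comp (continuous_snd (X := unitInterval))
  have ht := continuous_subtype_val.comp (continuous_fst (X := unitInterval) (Y := SpinelessCactus ι))
  exact (((continuous_const.sub ht).mul hr).add ht).div hr fun p => (p.2.radius_pos i).ne'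

lemma deform_zero (c : SpinelessCactus ι) : deform (0, c) = c := by
  have : deformFactor 0 c = fun _ => (1 : ℝ) := by
    funext i
    simp [deformFactor, (c.radius_pos i).ne']
  change c.rescale (deformFactor 0 c) (deformFactor_pos 0 c) = c
  rw [rescale_congr _ this, rescale_one]

lemma deform_one (c : SpinelessCactus ι) : deform (1, c) = c.normalize.1 := by
  have : deformFactor 1 c = fun i => 1 / c.radius i := by
    funext i
    simp [deformFactor]
  exact rescale_congr _ this _

/-- The factor of a lobe depends on the radius of that lobe alone. -/
lemma deform_relabel (e : ι ≃ κ) (t : unitInterval) (c : SpinelessCactus ι) :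
    deform (t, c.relabel e) = (deform (t, c)).relabel e := by
  refine (rescale_relabel _ _ _ _).trans (congrArg (relabel e) (rescale_congr _ (funext fun i => ?_) _))
  simp [deformFactor, relabel_radius]

lemma normalize_relabel (e : ι ≃ κ) (c : SpinelessCactus ι) :
    (c.relabel e).normalize = c.normalize.relabel e := by
  refine NormalizedSpinelessCactus.ext_val ((rescale_relabel e c _ fun k =>
    one_div_pos.2 ((c.relabel e).radius_pos k)).trans
    (congrArg (relabel e) (rescale_congr c (funext fun i => ?_) _)))
  simp [relabel_radius]

end SpinelessCactus

/-! ### Spineless cacti as a suboperad, and the deformation retracts to normalized cacti -/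

section

open TopCollection

/-- Spineless cacti are the cacti with all local zeros at the root points. They are closed under
composition, since then the inserted cactus is rotated by zero and no local zero is shifted;
forgetting the spines is only needed as a continuous retraction. -/
theorem isOperad_spinelessCacti : spinelessCacti.IsOperad := by
  refine isOperad_cacti.of_retract (r := fun _ => Prod.fst) (s := fun _ c => (c, fun _ => 0))
    (fun _ => continuous_fst) (fun _ => continuous_id.prodMk continuous_const) (fun _ => rfl)
    (fun _ _ => rfl) fun {m n l} h i a b => ?_
  refine Prod.ext ?_ (funext fun v => ?_)
  · have key : ∀ (a : SpinelessCactus (Fin (m + 1))) (b : SpinelessCactus (Fin (n + 1))),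
        (a.glue i b).relabel (insertEquiv h i) =
          (a.glue i (b.rotate (-0))).relabel (insertEquiv h i) := fun a b => by
      rw [neg_zero, SpinelessCactus.rotate_zero]
    exact key a b
  · obtain ⟨u, rfl⟩ := (insertEquiv h i).surjective v
    change 0 = Sum.elim (fun _ : {j : Fin (m + 1) // j ≠ i} => (0 : UnitAddCircle))
      (fun k => 0 - b.traversed (-0) k) ((insertEquiv h i).symm (insertEquiv h i u))
    rw [Equiv.symm_apply_apply, neg_zero]
    rcases u with j | k
    · rfl
    · have key : ∀ b : SpinelessCactus (Fin (n + 1)), 0 = 0 - b.traversed 0 k := fun b => by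
        rw [SpinelessCactus.traversed_zero, sub_zero]
      exact key b

/-- The substance is the last condition: normalized gluing is gluing followed by normalization. -/
theorem isDeformationRetract_normalizedSpinelessCacti :
    IsDeformationRetract spinelessCacti normalizedSpinelessCacti
      (fun _ c => c.normalize) (fun _ c => c.1) fun _ => SpinelessCactus.deform where
  continuous_r _ := SpinelessCactus.continuous_normalize
  continuous_s _ := NormalizedSpinelessCactus.continuous_val
  continuous_H _ := SpinelessCactus.continuous_deform
  r_act σ a := SpinelessCactus.normalize_relabel σ a
  s_act _ _ := rfl
  H_act σ t a := SpinelessCactus.deform_relabel σ t a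
  r_s b := NormalizedSpinelessCactus.normalize_val b
  H_zero := SpinelessCactus.deform_zero
  H_one := SpinelessCactus.deform_one
  comp h i a b := by
    refine (congrArg (NormalizedSpinelessCactus.relabel _)
      (NormalizedSpinelessCactus.glue_eq a i b)).trans ?_
    exact (SpinelessCactus.normalize_relabel _ _).symm

/-- Relative positions of the spines are unaffected by scaling, so the deformation of spineless
cacti is extended by the identity on the local zeros. -/
theorem isDeformationRetract_normalizedCacti :
    IsDeformationRetract cacti normalizedCacti (fun _ c => (c.1.normalize, c.2))
      (fun _ c => (c.1.1, c.2)) fun _ p => (SpinelessCactus.deform (p.1, p.2.1), p.2.2) where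
  continuous_r _ := (SpinelessCactus.continuous_normalize.comp continuous_fst).prodMk continuous_snd
  continuous_s _ :=
    (NormalizedSpinelessCactus.continuous_val.comp continuous_fst).prodMk continuous_snd
  continuous_H _ := (SpinelessCactus.continuous_deform.comp
    (continuous_fst.prodMk continuous_snd.fst)).prodMk continuous_snd.snd
  r_act σ a := Prod.ext (SpinelessCactus.normalize_relabel σ a.1) rfl
  s_act _ _ := rfl
  H_act σ t a := Prod.ext (SpinelessCactus.deform_relabel σ t a.1) rfl
  r_s b := Prod.ext (NormalizedSpinelessCactus.normalize_val b.1) rfl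
  H_zero a := Prod.ext (SpinelessCactus.deform_zero a.1) rfl
  H_one a := Prod.ext (SpinelessCactus.deform_one a.1) rfl
  comp h i a b := by
    refine Prod.ext ?_ rfl
    refine (congrArg (NormalizedSpinelessCactus.relabel _)
      -- The spineless comparison is applied after the rotation of `b`, which is the same in both
      -- structures.
      (NormalizedSpinelessCactus.glue_eq a.1 i (b.1.rotate (-a.2 i)))).trans ?_
    exact (SpinelessCactus.normalize_relabel _ _).symm

end

/-! ### Associativity and commutativity of shuffles -/

namespace ShufflePath

lemma fst_le_of_le {p q : ℕ} (φ : ShufflePath p q) {t u : ℕ} (h : t ≤ u) :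
    φ.fst u ≤ φ.fst t + (u - t) := by
  have := φ.fst_add_le t (u - t)
  rwa [Nat.add_sub_cancel' h] at this

/-- A discrete intermediate value theorem: the path starts at zero, ends at `p` and grows by at most
one in each step. -/
lemma exists_fst_eq {p q : ℕ} (φ : ShufflePath p q) {u : ℕ} (hu : u ≤ p) :
    ∃ t ≤ p + q, φ.fst t = u := by
  classical
  have hex : ∃ t, u ≤ φ.fst t := ⟨p + q, by rw [φ.final _ le_rfl]; exact hu⟩
  refine ⟨Nat.find hex, Nat.find_min' hex (by rw [φ.final _ le_rfl]; exact hu),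
    le_antisymm ?_ (Nat.find_spec hex)⟩
  rcases h : Nat.find hex with _ | t
  · rw [φ.zero]; exact Nat.zero_le _
  · have h1 := Nat.find_min hex (show t < Nat.find hex by omega)
    have h2 := φ.succ_le t
    omega

/-- Exchange the two directions. -/
def swap {p q : ℕ} (φ : ShufflePath p q) : ShufflePath q p where
  -- After the end of the path the second coordinate stays constant, hence the truncation of `t`.
  fst t := min t (p + q) - φ.fst t
  zero := by simp
  le_succ t := by
    have h1 := φ.succ_le t
    by_cases ht : p + q ≤ t
    · have h2 := φ.final t ht
      have h3 := φ.final (t + 1) (by omega)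
      omega
    · omega
  succ_le t := by
    have h1 := φ.le_succ t
    omega
  final t ht := by
    rw [φ.final t (by omega)]
    omega

lemma swap_fst {p q : ℕ} (φ : ShufflePath p q) {t : ℕ} (ht : t ≤ p + q) :
    φ.swap.fst t = t - φ.fst t := by
  change min t (p + q) - φ.fst t = _
  rw [min_eq_left ht]

lemma swap_swap {p q : ℕ} (φ : ShufflePath p q) : φ.swap.swap = φ := by
  ext t
  change min t (q + p) - (min t (p + q) - φ.fst t) = φ.fst t
  have h1 := φ.fst_le_self t
  have h2 := φ.fst_le t
  omega

/-- The squares on the two sides of the path fill the rectangle. -/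
lemma swap_area {p q : ℕ} (φ : ShufflePath p q) : φ.area + φ.swap.area = p * q := by
  -- For an initial part of the path, the rectangle spanned by its endpoint.
  have key : ∀ n ≤ p + q,
      ∑ t ∈ Finset.range n, (φ.fst (t + 1) - φ.fst t) * (t - φ.fst t) +
        ∑ t ∈ Finset.range n, (φ.swap.fst (t + 1) - φ.swap.fst t) * (t - φ.swap.fst t) =
      φ.fst n * (n - φ.fst n) := by
    intro n hn
    induction n with
    | zero => simp [φ.zero]
    | succ n ih =>
      rw [Finset.sum_range_succ, Finset.sum_range_succ, add_add_add_comm, ih (by omega),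
        φ.swap_fst (by omega), φ.swap_fst (by omega)]
      have h1 := φ.le_succ n
      have h2 := φ.succ_le n
      have h3 := φ.fst_le_self n
      obtain ⟨v, hv⟩ := Nat.exists_eq_add_of_le h3
      rcases h1.eq_or_lt with h | h
      · rw [← h]
        generalize φ.fst n = x at *
        subst hv
        rw [show x + v + 1 - x = v + 1 by omega, show x + v - x = v by omega]
        simp
        ring
      · have h : φ.fst (n + 1) = φ.fst n + 1 := by omega
        rw [h]
        generalize φ.fst n = x at *
        subst hv
        rw [show x + v + 1 - (x + 1) = v by omega, show x + v - x = v by omega]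
        simp
        ring
  have h := key (p + q) le_rfl
  rw [φ.final _ le_rfl, Nat.add_sub_cancel_left] at h
  rw [area, area, ← h, add_comm q p]

/-- A step function that grows only where another one grows factors through it. -/
lemma exists_factor {p q n : ℕ} {w g : ℕ → ℕ} (w0 : w 0 = 0) (w1 : ∀ t, w t ≤ w (t + 1))
    (w2 : ∀ t, w (t + 1) ≤ w t + 1) (w3 : ∀ t, n ≤ t → w t = p + q) (g0 : g 0 = 0)
    (g1 : ∀ t, g t ≤ g (t + 1)) (g2 : ∀ t, g (t + 1) + w t ≤ g t + w (t + 1))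
    (g3 : ∀ t, n ≤ t → g t = p) : ∃ φ : ShufflePath p q, ∀ t, φ.fst (w t) = g t := by
  have wm : Monotone w := monotone_nat_of_le_succ w1
  have gm : Monotone g := monotone_nat_of_le_succ g1
  have hg2 : ∀ t u, t ≤ u → g u + w t ≤ g t + w u := by
    intro t u h
    obtain ⟨v, rfl⟩ := Nat.exists_eq_add_of_le h
    clear h
    induction v with
    | zero => simp
    | succ v ih => have := g2 (t + v); rw [← add_assoc]; omega
  -- Consequently `g` is constant on the fibres of `w`, and the induced function grows at most as
  -- fast as its argument.
  have key : ∀ t u, w t ≤ w u → g t ≤ g u ∧ g u + w t ≤ g t + w u := by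
    intro t u h
    rcases le_total t u with h' | h'
    · exact ⟨gm h', hg2 t u h'⟩
    · have := wm h'
      have := hg2 u t h'
      have := gm h'
      omega
  have wle : ∀ t, w t ≤ p + q := fun t =>
    (wm (le_max_left t n)).trans (w3 _ (le_max_right t n)).le
  -- Since `w` climbs in steps of at most one, it takes every value up to `p + q`; the first time at
  -- which a value is reached serves as a section of `w`.
  have hex : ∀ u, ∃ t, w t = min u (p + q) := by
    intro u
    induction u with
    | zero => exact ⟨0, by simp [w0]⟩
    | succ u ih =>
      classical
      have hex : ∃ t, min (u + 1) (p + q) ≤ w t := ⟨n, by rw [w3 n le_rfl]; exact min_le_right _ _⟩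
      refine ⟨Nat.find hex, le_antisymm ?_ (Nat.find_spec hex)⟩
      rcases h : Nat.find hex with _ | t
      · rw [w0]; exact Nat.zero_le _
      · have h1 := Nat.find_min hex (show t < Nat.find hex by omega)
        have h2 := w2 t
        omega
  choose T hT using hex
  have hTg : ∀ t u, w t = min u (p + q) → g (T u) = g t := fun t u h =>
    le_antisymm (key _ _ ((hT u).trans h.symm).le).1 (key _ _ ((hT u).trans h.symm).ge).1
  refine ⟨⟨fun u => g (T u), ?_, fun u => ?_, fun u => ?_, fun u hu => ?_⟩, fun t => ?_⟩
  · rw [hTg 0 0 (by simp [w0]), g0]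
  · exact (key _ _ (by rw [hT, hT]; omega)).1
  · have := (key (T u) (T (u + 1)) (by rw [hT, hT]; omega)).2
    rw [hT, hT] at this
    omega
  · rw [hTg n u (by rw [w3 n le_rfl]; omega), g3 n le_rfl]
  · exact hTg t _ (min_eq_left (wle t)).symm

/-- A pair of shuffles of `p` and `q` and of `p + q` and `r`, and a pair of shuffles of `p` and
`q + r` and of `q` and `r` that give rise to the same shuffle of `p`, `q` and `r`. -/
def Assoc {p q r pq qr : ℕ} (_hpq : p + q = pq) (_hqr : q + r = qr)
    (x : ShufflePath p q × ShufflePath pq r) (y : ShufflePath p qr × ShufflePath q r) : Prop :=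
  ∀ t ≤ p + q + r, y.1.fst t = x.1.fst (x.2.fst t) ∧
    y.2.fst (t - y.1.fst t) = x.2.fst t - x.1.fst (x.2.fst t)

section Assoc

variable {p q r pq qr : ℕ} (hpq : p + q = pq) (hqr : q + r = qr)

include hpq hqr

/-- The pair `x` records a shuffle of three strings. Its progress in the first string gives one
path; its progress in the second string grows only where the progress in the last two grows, so it
factors through the latter. -/
lemma exists_assoc_right (x : ShufflePath p q × ShufflePath pq r) :
    ∃ y, Assoc hpq hqr x y := by
  subst hpq hqr
  obtain ⟨φ, ψ⟩ := x
  have hf : ∀ t, φ.fst (ψ.fst t) ≤ φ.fst (ψ.fst (t + 1)) := fun t => φ.mono (ψ.le_succ t)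
  have hf2 : ∀ t, φ.fst (ψ.fst (t + 1)) + ψ.fst t ≤ φ.fst (ψ.fst t) + ψ.fst (t + 1) := fun t => by
    have := φ.fst_le_of_le (ψ.le_succ t)
    have := ψ.le_succ t
    omega
  let φ' : ShufflePath p (q + r) :=
    ⟨fun t => φ.fst (ψ.fst t), by rw [ψ.zero, φ.zero], hf, fun t => by
      have := hf2 t
      have := ψ.succ_le t
      omega, fun t ht => by rw [ψ.final t (by omega), φ.final _ le_rfl]⟩
  have hφ' : ∀ t, φ'.fst t = φ.fst (ψ.fst t) := fun _ => rfl
  -- Here `w` counts the steps in the last two strings, `g` those in the second string.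
  obtain ⟨ψ', h⟩ := exists_factor (p := q) (q := r) (n := p + q + r)
    (w := fun t => min t (p + q + r) - φ.fst (ψ.fst t))
    (g := fun t => ψ.fst t - φ.fst (ψ.fst t)) (by simp)
    (fun t => by
      have h1 : φ.fst (ψ.fst (t + 1)) ≤ φ.fst (ψ.fst t) + 1 := φ'.succ_le t
      by_cases ht : p + q + r ≤ t
      · have h2 : φ.fst (ψ.fst t) = p := φ'.final t (by omega)
        have h3 : φ.fst (ψ.fst (t + 1)) = p := φ'.final (t + 1) (by omega)
        omega
      · omega)
    (fun t => by have := hf t; omega)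
    (fun t ht => by
      have h2 := φ'.final t (by omega)
      rw [hφ'] at h2
      omega) (by simp [ψ.zero])
    (fun t => by
      have := hf2 t
      omega)
    (fun t => by
      have h1 := hf2 t
      have h2 := hf t
      have h3 := ψ.succ_le t
      have h4 := φ.fst_le_self (ψ.fst t)
      have h5 := φ.fst_le_self (ψ.fst (t + 1))
      have h6 := ψ.fst_le_self t
      have h7 := ψ.fst_le t
      have h8 := ψ.le_succ t
      by_cases ht : p + q + r ≤ t
      · have h2 := ψ.final t (by omega)
        have h3 := ψ.final (t + 1) (by omega)
        rw [h2, h3]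
        omega
      · omega)
    (fun t ht => by rw [ψ.final t (by omega), φ.final _ le_rfl]; omega)
  refine ⟨(φ', ψ'), fun t ht => ⟨rfl, ?_⟩⟩
  have := h t
  dsimp only at this ⊢
  rwa [min_eq_left ht] at this

/-- The converse reading of a shuffle of three strings: the progress in the first two strings is the
sum of both counts, and the progress in the first string factors through it. -/
lemma exists_assoc_left (y : ShufflePath p qr × ShufflePath q r) :
    ∃ x, Assoc hpq hqr x y := by
  subst hpq hqr
  obtain ⟨φ', ψ'⟩ := y
  have hle : ∀ t ≤ p + q + r, t - φ'.fst t ≤ q + r := fun t ht => by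
    have := φ'.le_fst_add (t := t) (by omega)
    omega
  let ψ : ShufflePath (p + q) r :=
    ⟨fun t => φ'.fst t + ψ'.fst (t - φ'.fst t), by simp [φ'.zero, ψ'.zero], fun t => by
      have h1 := φ'.le_succ t
      have h2 := ψ'.mono (φ'.snd_mono (show t ≤ t + 1 by omega))
      omega, fun t => by
      have h1 := φ'.succ_le t
      have h2 := ψ'.fst_le_of_le (φ'.snd_mono (show t ≤ t + 1 by omega))
      have h3 := φ'.le_succ t
      have h4 := φ'.fst_le_self t
      have h5 := φ'.fst_le_self (t + 1)
      omega, fun t ht => by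
      rw [φ'.final t (by omega), ψ'.final _ (by omega)]⟩
  have hψ : ∀ t, ψ.fst t = φ'.fst t + ψ'.fst (t - φ'.fst t) := fun _ => rfl
  obtain ⟨φ, h⟩ := exists_factor (p := p) (q := q) (n := p + q + r) (w := ψ.fst) (g := φ'.fst)
    ψ.zero ψ.le_succ ψ.succ_le (fun t ht => ψ.final t ht) φ'.zero φ'.le_succ
    (fun t => by
      rw [hψ, hψ]
      have h2 := ψ'.mono (φ'.snd_mono (show t ≤ t + 1 by omega))
      omega) (fun t ht => φ'.final t (by omega))
  refine ⟨(φ, ψ), fun t ht => ⟨(h t).symm, ?_⟩⟩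
  dsimp only
  rw [h t, hψ]
  omega

/-- The relation gives the counts of steps in the first and in the second string at every time,
hence their sum, which is the outer path. The inner path is then known at all values of the outer
path, and these are all values there are. -/
lemma Assoc.left_unique {x x' : ShufflePath p q × ShufflePath pq r}
    {y : ShufflePath p qr × ShufflePath q r} (h : Assoc hpq hqr x y) (h' : Assoc hpq hqr x' y) :
    x = x' := by
  subst hpq hqr
  have h2 : x.2 = x'.2 := by
    ext t
    by_cases ht : t ≤ p + q + r
    · have h1 := h t ht
      have h1' := h' t ht
      have h3 := x.1.fst_le_self (x.2.fst t)
      have h3' := x'.1.fst_le_self (x'.2.fst t)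
      omega
    · rw [x.2.final t (by omega), x'.2.final t (by omega)]
  refine Prod.ext ?_ h2
  ext u
  by_cases hu : u ≤ p + q
  · obtain ⟨t, ht, rfl⟩ := x.2.exists_fst_eq hu
    rw [← (h t ht).1, (h' t ht).1, h2]
  · rw [x.1.final u (by omega), x'.1.final u (by omega)]

/-- The inner path is known at all values of the second coordinate of the outer one; exchanging
directions shows that every value occurs. -/
lemma Assoc.right_unique {x : ShufflePath p q × ShufflePath pq r}
    {y y' : ShufflePath p qr × ShufflePath q r} (h : Assoc hpq hqr x y) (h' : Assoc hpq hqr x y') :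
    y = y' := by
  subst hpq hqr
  have h1 : y.1 = y'.1 := by
    ext t
    by_cases ht : t ≤ p + q + r
    · rw [(h t ht).1, (h' t ht).1]
    · rw [y.1.final t (by omega), y'.1.final t (by omega)]
  refine Prod.ext h1 ?_
  ext u
  by_cases hu : u ≤ q + r
  · obtain ⟨t, ht, hut⟩ := y.1.swap.exists_fst_eq hu
    rw [y.1.swap_fst (by omega)] at hut
    have e := (h t (by omega)).2
    have e' := (h' t (by omega)).2
    rw [← h1, ← e, hut] at e'
    exact e'.symm
  · rw [y.2.final u (by omega), y'.2.final u (by omega)]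

-- A change of variables: each value of `w` is left by exactly one step, and the other steps
-- contribute zero.
omit hpq hqr in
lemma sum_range_comp {w : ℕ → ℕ} (w0 : w 0 = 0) (w1 : ∀ t, w t ≤ w (t + 1))
    (w2 : ∀ t, w (t + 1) ≤ w t + 1) (F : ℕ → ℕ) (n : ℕ) :
    ∑ t ∈ Finset.range n, (w (t + 1) - w t) * F (w t) = ∑ u ∈ Finset.range (w n), F u := by
  induction n with
  | zero => simp [w0]
  | succ n ih =>
    rw [Finset.sum_range_succ, ih]
    have h1 := w1 n
    have h2 := w2 n
    rcases h1.eq_or_lt with h | h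
    · rw [← h]; simp
    · have h : w (n + 1) = w n + 1 := by omega
      rw [h, Finset.sum_range_succ, Nat.add_sub_cancel_left, one_mul]

/-- Both sides count the inverted pairs among three strings. Written as sums over the times of the
common shuffle, they agree term by term, whichever string the step belongs to. -/
lemma Assoc.area {x : ShufflePath p q × ShufflePath pq r}
    {y : ShufflePath p qr × ShufflePath q r} (h : Assoc hpq hqr x y) :
    x.1.area + x.2.area = y.1.area + y.2.area := by
  subst hpq hqr
  obtain ⟨φ, ψ⟩ := x
  obtain ⟨φ', ψ'⟩ := y
  have e1 : φ.area = ∑ t ∈ Finset.range (p + q + r), (ψ.fst (t + 1) - ψ.fst t) *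
      ((φ.fst (ψ.fst t + 1) - φ.fst (ψ.fst t)) * (ψ.fst t - φ.fst (ψ.fst t))) := by
    rw [sum_range_comp ψ.zero ψ.le_succ ψ.succ_le
      (fun u => (φ.fst (u + 1) - φ.fst u) * (u - φ.fst u)), ψ.final _ le_rfl, ShufflePath.area]
  have e2 : ψ'.area = ∑ t ∈ Finset.range (p + q + r),
      (φ'.swap.fst (t + 1) - φ'.swap.fst t) *
      ((ψ'.fst (φ'.swap.fst t + 1) - ψ'.fst (φ'.swap.fst t)) *
        (φ'.swap.fst t - ψ'.fst (φ'.swap.fst t))) := by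
    rw [sum_range_comp φ'.swap.zero φ'.swap.le_succ φ'.swap.succ_le
      (fun u => (ψ'.fst (u + 1) - ψ'.fst u) * (u - ψ'.fst u)), φ'.swap.final _ (by omega),
      ShufflePath.area]
  rw [e1, e2, ShufflePath.area, ShufflePath.area, ← add_assoc p q r, ← Finset.sum_add_distrib,
    ← Finset.sum_add_distrib]
  refine Finset.sum_congr rfl fun t ht => ?_
  have ht := Finset.mem_range.1 ht
  obtain ⟨h1, h2⟩ := h t (by omega)
  obtain ⟨h3, h4⟩ := h (t + 1) (by omega)
  dsimp only at h1 h2 h3 h4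
  rw [φ'.swap_fst (by omega), φ'.swap_fst (by omega)]
  have a1 := ψ.le_succ t
  have a2 := ψ.succ_le t
  have a3 := ψ.fst_le_self t
  have a4 := φ.fst_le_self (ψ.fst t)
  have a5 := φ'.le_succ t
  have a6 := φ'.succ_le t
  have a7 := φ'.fst_le_self t
  -- A step in the third string contributes nothing; a step in the second one counts earlier steps
  -- in the third.
  rcases a1.eq_or_lt with h | h
  · rw [← h] at h3 h4 ⊢
    have h5 : φ'.fst (t + 1) = φ'.fst t := by omega
    rw [h5] at h4 ⊢
    rw [show t + 1 - φ'.fst t = t - φ'.fst t + 1 by omega] at h4 ⊢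
    rw [h4, h2]
    simp
  · have h : ψ.fst (t + 1) = ψ.fst t + 1 := by omega
    rw [h] at h3 h4 ⊢
    rw [← h1] at h2 a4 ⊢
    rw [← h3]
    rcases a5.eq_or_lt with h' | h'
    · rw [← h3, ← h'] at h4
      rw [← h']
      rw [show t + 1 - φ'.fst t = t - φ'.fst t + 1 by omega] at h4 ⊢
      rw [h4, h2]
      rw [show ψ.fst t + 1 - φ'.fst t - (ψ.fst t - φ'.fst t) = 1 by omega]
      simp
      omega
    -- A step in the first string counts earlier steps in the second and in the third.
    · have h' : φ'.fst (t + 1) = φ'.fst t + 1 := by omega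
      rw [h']
      rw [show t + 1 - (φ'.fst t + 1) = t - φ'.fst t by omega]
      simp
      omega

end Assoc

end ShufflePath

/-! ### The cross product on singular chains -/

namespace ShufflePath

open CategoryTheory Simplicial

section

variable {p q r pq qr s : ℕ} {hpq : p + q = pq} {hqr : q + r = qr}
  {x : ShufflePath p q × ShufflePath pq r} {y : ShufflePath p qr × ShufflePath q r}

lemma Assoc.homFst (h : Assoc hpq hqr x y) (hs : pq + r = s) (hs' : p + qr = s) :
    x.2.homFst hs ≫ x.1.homFst hpq = y.1.homFst hs' :=
  hom_ext_val fun t => ((h t (by omega)).1).symm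

/-- The middle string is the second direction of the inner shuffle in one description and the first
direction of the inner shuffle in the other. -/
lemma Assoc.homMiddle (h : Assoc hpq hqr x y) (hs : pq + r = s) (hs' : p + qr = s) :
    x.2.homFst hs ≫ x.1.homSnd hpq = y.1.homSnd hs' ≫ y.2.homFst hqr :=
  hom_ext_val fun t => ((h t (by omega)).2).symm

lemma Assoc.homSnd (h : Assoc hpq hqr x y) (hs : pq + r = s) (hs' : p + qr = s) :
    x.2.homSnd hs = y.1.homSnd hs' ≫ y.2.homSnd hqr :=
  hom_ext_val fun t => by
    obtain ⟨h1, h2⟩ := h t (by omega)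
    have h3 := x.1.fst_le_self (x.2.fst t)
    have h4 := x.2.fst_le_self t
    change (t : ℕ) - x.2.fst t = (t : ℕ) - y.1.fst t - y.2.fst (t - y.1.fst t)
    omega

end

lemma swap_homFst {p q s : ℕ} (φ : ShufflePath p q) (h : p + q = s) (h' : q + p = s) :
    φ.swap.homFst h' = φ.homSnd h :=
  hom_ext_val fun t => φ.swap_fst (h.symm ▸ Nat.le_of_lt_succ t.2)

lemma swap_homSnd {p q s : ℕ} (φ : ShufflePath p q) (h : p + q = s) (h' : q + p = s) :
    φ.swap.homSnd h' = φ.homFst h :=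
  hom_ext_val fun t => by
    have := φ.fst_le_self t
    change (t : ℕ) - φ.swap.fst t = φ.fst t
    rw [φ.swap_fst (h.symm ▸ Nat.le_of_lt_succ t.2)]
    omega

/-- The bijection between the two ways to describe shuffles of three strings. -/
noncomputable def assocEquiv {p q r pq qr : ℕ} (hpq : p + q = pq) (hqr : q + r = qr) :
    ShufflePath p q × ShufflePath pq r ≃ ShufflePath p qr × ShufflePath q r where
  toFun x := (exists_assoc_right hpq hqr x).choose
  invFun y := (exists_assoc_left hpq hqr y).choose
  left_inv x := Assoc.left_unique hpq hqr (exists_assoc_left hpq hqr _).choose_spec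
    (exists_assoc_right hpq hqr x).choose_spec
  right_inv y := Assoc.right_unique hpq hqr (exists_assoc_right hpq hqr _).choose_spec
    (exists_assoc_left hpq hqr y).choose_spec

lemma assoc_assocEquiv {p q r pq qr : ℕ} (hpq : p + q = pq) (hqr : q + r = qr)
    (x : ShufflePath p q × ShufflePath pq r) : Assoc hpq hqr x (assocEquiv hpq hqr x) :=
  (exists_assoc_right hpq hqr x).choose_spec

end ShufflePath

namespace SingularHomology

open CategoryTheory Simplicial MonoidalCategory SimplicialCross

variable (k : Type) [CommRing k]

/-- Singular simplices. -/
abbrev Simplex (X : Type) [TopologicalSpace X] (n : ℕ) : Type :=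
  (TopCat.toSSet.obj (TopCat.of X)) _⦋n⦌

/-- Singular chains. -/
noncomputable abbrev SingularChains (X : Type) [TopologicalSpace X] (n : ℕ) : ModuleCat.{0} k :=
  Chains k (TopCat.toSSet.obj (TopCat.of X)) n

variable {X Y Z X' Y' : Type} [TopologicalSpace X] [TopologicalSpace Y] [TopologicalSpace Z]
  [TopologicalSpace X'] [TopologicalSpace Y']

/-- The simplex of a product with given components. -/
noncomputable def prodSimplex {n : ℕ} (x : Simplex X n) (y : Simplex Y n) : Simplex (X × Y) n :=
  (prodMap X Y).app _ (pair x y)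

/-- The image of a singular simplex. -/
noncomputable def mapSimplex (f : C(X, Y)) {n : ℕ} (x : Simplex X n) : Simplex Y n :=
  (TopCat.toSSet.map (TopCat.ofHom f)).app _ x

/-- The map on singular chains induced by a continuous map. -/
noncomputable def chainMap (f : C(X, Y)) (n : ℕ) :
    SingularChains k X n →ₗ[k] SingularChains k Y n :=
  ((SSet.chainComplexMap (TopCat.toSSet.map (TopCat.ofHom f)) (ModuleCat.of k k)).f n).hom

lemma chainComplexMap_gen {S T : SSet.{0}} (f : S ⟶ T) {n : ℕ} (x : S _⦋n⦌) :
    ((SSet.chainComplexMap f (ModuleCat.of k k)).f n).hom (gen k x) = gen k (f.app _ x) :=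
  congrArg (fun g => g.hom (1 : k))
    (SSet.ι_chainComplexMap_f (C := ModuleCat.{0} k) S T f (ModuleCat.of k k) x)

lemma chainMap_gen (f : C(X, Y)) {n : ℕ} (x : Simplex X n) :
    chainMap k f n (gen k x) = gen k (mapSimplex f x) :=
  chainComplexMap_gen k _ x

/-- The cross product on singular chains. -/
noncomputable def chainCross (X Y : Type) [TopologicalSpace X] [TopologicalSpace Y] {p q s : ℕ}
    (h : p + q = s) :
    SingularChains k X p →ₗ[k] SingularChains k Y q →ₗ[k] SingularChains k (X × Y) s :=
  (SimplicialCross.cross k _ _ h).compr₂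
    ((SSet.chainComplexMap (prodMap X Y) (ModuleCat.of k k)).f s).hom

lemma chainCross_gen {p q s : ℕ} (h : p + q = s) (x : Simplex X p) (y : Simplex Y q) :
    chainCross k X Y h (gen k x) (gen k y) = ∑ φ : ShufflePath p q, (-1 : ℤ) ^ φ.area •
      gen k (prodSimplex
        ((TopCat.toSSet.obj (TopCat.of X)).map (φ.homFst h).op x)
        ((TopCat.toSSet.obj (TopCat.of Y)).map (φ.homSnd h).op y)) := by
  rw [chainCross, LinearMap.compr₂_apply, cross_gen, map_sum]
  refine Finset.sum_congr rfl fun φ _ => ?_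
  rw [map_zsmul, chainComplexMap_gen]
  rfl

variable {k} in
lemma chain_induction₂ {p q : ℕ} {M : Type} [AddCommGroup M] [Module k M]
    {f g : SingularChains k X p →ₗ[k] SingularChains k Y q →ₗ[k] M}
    (h : ∀ x y, f (gen k x) (gen k y) = g (gen k x) (gen k y)) : f = g :=
  hom_ext fun x => hom_ext fun y => h x y

/-- Shuffles act by degeneracies on the standard simplex, which commute with composing a singular
simplex with a continuous map. -/
lemma chainCross_naturality (f : C(X, X')) (g : C(Y, Y')) {p q s : ℕ} (h : p + q = s)
    (a : SingularChains k X p) (b : SingularChains k Y q) :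
    chainMap k (f.prodMap g) s (chainCross k X Y h a b) =
      chainCross k X' Y' h (chainMap k f p a) (chainMap k g q b) := by
  have : (chainCross k X Y h).compr₂ (chainMap k (f.prodMap g) s) =
      (chainCross k X' Y' h).compl₁₂ (chainMap k f p) (chainMap k g q) :=
    chain_induction₂ fun x y => by
      rw [LinearMap.compr₂_apply, LinearMap.compl₁₂_apply, chainMap_gen, chainMap_gen,
        chainCross_gen, chainCross_gen, map_sum]
      refine Finset.sum_congr rfl fun φ _ => ?_
      rw [map_zsmul, chainMap_gen]
      rfl
  exact congrArg (fun F => F a b) this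

/-- The shuffle product is graded commutative already on chains: exchanging directions permutes the
shuffles, and the two areas add up to `p * q`. -/
lemma chainCross_swap {p q s : ℕ} (h : p + q = s) (h' : q + p = s)
    (a : SingularChains k X p) (b : SingularChains k Y q) :
    chainMap k (ContinuousMap.prodSwap) s (chainCross k X Y h a b) =
      (-1 : ℤ) ^ (p * q) • chainCross k Y X h' b a := by
  have : (chainCross k X Y h).compr₂ (chainMap k ContinuousMap.prodSwap s) =
      (-1 : ℤ) ^ (p * q) • (chainCross k Y X h').flip :=
    chain_induction₂ fun x y => by
      rw [LinearMap.compr₂_apply, LinearMap.smul_apply, LinearMap.smul_apply,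
        LinearMap.flip_apply, chainCross_gen, chainCross_gen, map_sum, Finset.smul_sum]
      refine Fintype.sum_equiv
        ⟨ShufflePath.swap, ShufflePath.swap, fun φ => φ.swap_swap, fun φ => φ.swap_swap⟩ _ _
        fun φ => ?_
      rw [map_zsmul, chainMap_gen, smul_smul]
      congr 1
      -- The area of the exchanged shuffle occurs twice in the exponent and drops out.
      · rw [Equiv.coe_fn_mk, ← φ.swap_area, pow_add, mul_assoc, ← pow_add,
          Even.neg_one_pow ⟨_, rfl⟩, mul_one]
      · rw [Equiv.coe_fn_mk, φ.swap_homFst h, φ.swap_homSnd h]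
        rfl
  exact congrArg (fun F => F a b) this

lemma map_op_comp (S : SSet.{0}) {l m n : ℕ} (f : ⦋l⦌ ⟶ ⦋m⦌) (g : ⦋m⦌ ⟶ ⦋n⦌) (x : S _⦋n⦌) :
    S.map (f ≫ g).op x = S.map f.op (S.map g.op x) := by
  rw [op_comp, Functor.map_comp]
  rfl

/-- Associativity holds strictly on chains: both sides are the signed sum over all shuffles of three
strings, and the bijection between the two descriptions preserves all three coordinates and the
sign. -/
lemma chainCross_assoc {p q r pq qr s : ℕ} (hpq : p + q = pq) (hqr : q + r = qr)
    (hs : pq + r = s) (hs' : p + qr = s) (a : SingularChains k X p) (b : SingularChains k Y q)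
    (c : SingularChains k Z r) :
    chainMap k (Homeomorph.prodAssoc X Y Z : C((X × Y) × Z, X × Y × Z)) s
        (chainCross k (X × Y) Z hs (chainCross k X Y hpq a b) c) =
      chainCross k X (Y × Z) hs' a (chainCross k Y Z hqr b c) := by
  let M := chainMap k (Homeomorph.prodAssoc X Y Z : C((X × Y) × Z, X × Y × Z)) s
  have h1 : ∀ x y, M ∘ₗ chainCross k (X × Y) Z hs (chainCross k X Y hpq (gen k x) (gen k y)) =
      chainCross k X (Y × Z) hs' (gen k x) ∘ₗ chainCross k Y Z hqr (gen k y) := fun x y =>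
    hom_ext fun z => by
      have h3 : ∀ φ : ShufflePath p q, M (chainCross k (X × Y) Z hs
          ((-1 : ℤ) ^ φ.area • gen k (prodSimplex
            ((TopCat.toSSet.obj (TopCat.of X)).map (φ.homFst hpq).op x)
            ((TopCat.toSSet.obj (TopCat.of Y)).map (φ.homSnd hpq).op y))) (gen k z)) =
          ∑ ψ : ShufflePath pq r, (-1 : ℤ) ^ (φ.area + ψ.area) • gen k (prodSimplex
            ((TopCat.toSSet.obj (TopCat.of X)).map (ψ.homFst hs ≫ φ.homFst hpq).op x)
            (prodSimplex
              ((TopCat.toSSet.obj (TopCat.of Y)).map (ψ.homFst hs ≫ φ.homSnd hpq).op y)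
              ((TopCat.toSSet.obj (TopCat.of Z)).map (ψ.homSnd hs).op z))) := fun φ => by
        rw [map_zsmul, LinearMap.smul_apply, map_zsmul, chainCross_gen, map_sum, Finset.smul_sum]
        refine Finset.sum_congr rfl fun ψ _ => ?_
        rw [map_zsmul, chainMap_gen, smul_smul, pow_add, map_op_comp, map_op_comp]
        rfl
      have h4 : ∀ φ : ShufflePath q r, chainCross k X (Y × Z) hs' (gen k x)
          ((-1 : ℤ) ^ φ.area • gen k (prodSimplex
            ((TopCat.toSSet.obj (TopCat.of Y)).map (φ.homFst hqr).op y)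
            ((TopCat.toSSet.obj (TopCat.of Z)).map (φ.homSnd hqr).op z))) =
          ∑ ψ : ShufflePath p qr, (-1 : ℤ) ^ (ψ.area + φ.area) • gen k (prodSimplex
            ((TopCat.toSSet.obj (TopCat.of X)).map (ψ.homFst hs').op x)
            (prodSimplex
              ((TopCat.toSSet.obj (TopCat.of Y)).map (ψ.homSnd hs' ≫ φ.homFst hqr).op y)
              ((TopCat.toSSet.obj (TopCat.of Z)).map (ψ.homSnd hs' ≫ φ.homSnd hqr).op z))) :=
        fun φ => by
        rw [map_zsmul, chainCross_gen, Finset.smul_sum]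
        refine Finset.sum_congr rfl fun ψ _ => ?_
        rw [smul_smul, add_comm, pow_add, map_op_comp, map_op_comp]
        rfl
      rw [LinearMap.comp_apply, LinearMap.comp_apply, chainCross_gen k hpq, chainCross_gen k hqr,
        map_sum, LinearMap.sum_apply, map_sum, map_sum, Finset.sum_congr rfl fun φ _ => h3 φ,
        Finset.sum_congr rfl fun φ _ => h4 φ, ← Fintype.sum_prod_type',
        ← Fintype.sum_prod_type_right']
      refine Fintype.sum_equiv (ShufflePath.assocEquiv hpq hqr) _ _ fun w => ?_
      have hw := ShufflePath.assoc_assocEquiv hpq hqr w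
      rw [hw.area, hw.homFst hs hs', hw.homMiddle hs hs', hw.homSnd hs hs']
  -- From simplices to arbitrary chains, one variable at a time.
  have h2 : ∀ x, M ∘ₗ (chainCross k (X × Y) Z hs).flip c ∘ₗ chainCross k X Y hpq (gen k x) =
      chainCross k X (Y × Z) hs' (gen k x) ∘ₗ (chainCross k Y Z hqr).flip c := fun x =>
    hom_ext fun y => congrArg (fun F => F c) (h1 x y)
  have h3 : M ∘ₗ (chainCross k (X × Y) Z hs).flip c ∘ₗ (chainCross k X Y hpq).flip b =
      (chainCross k X (Y × Z) hs').flip (chainCross k Y Z hqr b c) :=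
    hom_ext fun x => congrArg (fun F => F b) (h2 x)
  exact congrArg (fun F => F a) h3

end SingularHomology

/-! ### The cross product in singular homology -/

namespace SimplicialCross

open CategoryTheory Simplicial MonoidalCategory

variable {k : Type} [CommRing k]

/-- The cycle `a` represents the homology class `h`. -/
def Represents {X : SSet.{0}} {n : ℕ} (a : Chains k X n)
    (h : (X.chainComplex (ModuleCat.of k k)).homology n) : Prop :=
  ∃ z : LinearMap.ker ((X.chainComplex (ModuleCat.of k k)).sc n).g.hom, z.1 = a ∧
    ((X.chainComplex (ModuleCat.of k k)).sc n).moduleCatHomologyIso.inv.hom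
      (Submodule.Quotient.mk z) = h

lemma exists_represents {X : SSet.{0}} {n : ℕ}
    (h : (X.chainComplex (ModuleCat.of k k)).homology n) : ∃ a : Chains k X n, Represents a h := by
  let e := ((X.chainComplex (ModuleCat.of k k)).sc n).moduleCatHomologyIso
  obtain ⟨z, hz⟩ := Submodule.Quotient.mk_surjective _ (e.hom.hom h)
  refine ⟨z.1, z, rfl, ?_⟩
  rw [hz]
  exact e.hom_inv_id_apply h

lemma Represents.eq {X : SSet.{0}} {n : ℕ} {a : Chains k X n}
    {h h' : (X.chainComplex (ModuleCat.of k k)).homology n} (H : Represents a h)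
    (H' : Represents a h') : h = h' := by
  obtain ⟨z, hz, rfl⟩ := H
  obtain ⟨z', hz', rfl⟩ := H'
  rw [Subtype.ext (hz.trans hz'.symm)]

lemma Represents.smul {X : SSet.{0}} {n : ℕ} {a : Chains k X n}
    {h : (X.chainComplex (ModuleCat.of k k)).homology n} (H : Represents a h) (c : ℤ) :
    Represents (c • a) (c • h) := by
  obtain ⟨z, rfl, rfl⟩ := H
  exact ⟨c • z, rfl, map_zsmul
    ((X.chainComplex (ModuleCat.of k k)).sc n).moduleCatHomologyIso.inv.hom c
      (Submodule.Quotient.mk z : HomologyQuot k X n)⟩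

/-- The identification of homology with cycles modulo boundaries is made separately for each
complex, so its naturality is derived from that of the projection from cycles to homology. -/
lemma Represents.map {X Y : SSet.{0}} (f : X ⟶ Y) {n : ℕ} {a : Chains k X n}
    {h : (X.chainComplex (ModuleCat.of k k)).homology n} (H : Represents a h) :
    Represents (((SSet.chainComplexMap f (ModuleCat.of k k)).f n).hom a)
      ((SSet.homologyMap f (ModuleCat.of k k) n).hom h) := by
  obtain ⟨z, rfl, rfl⟩ := H
  let F := SSet.chainComplexMap f (ModuleCat.of k k)
  let S := (X.chainComplex (ModuleCat.of k k)).sc n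
  let T := (Y.chainComplex (ModuleCat.of k k)).sc n
  let φ : S ⟶ T := (HomologicalComplex.shortComplexFunctor _ _ n).map F
  let z' : LinearMap.ker T.g.hom := ⟨(F.f n).hom z.1, by
    have h1 := congrArg (fun g => g.hom z.1) φ.comm₂₃
    have h2 : S.g.hom z.1 = 0 := z.2
    refine LinearMap.mem_ker.2 (h1.trans ?_)
    exact (congrArg φ.τ₃.hom h2).trans (map_zero _)⟩
  refine ⟨z', rfl, ?_⟩
  have e1 : ∀ (U : ShortComplex (ModuleCat.{0} k)) (w : LinearMap.ker U.g.hom),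
      U.moduleCatHomologyIso.inv.hom (Submodule.Quotient.mk w) =
        U.homologyπ.hom (U.moduleCatCyclesIso.inv.hom w) := fun U w =>
    (congrArg (fun g => g.hom w) U.moduleCatCyclesIso_inv_π).symm
  have e2 : ∀ (U : ShortComplex (ModuleCat.{0} k)) (w : LinearMap.ker U.g.hom),
      U.iCycles.hom (U.moduleCatCyclesIso.inv.hom w) = w.1 := fun U w =>
    congrArg (fun g => g.hom w) U.moduleCatCyclesIso_inv_iCycles
  -- Two cycles agree if they agree as chains, the inclusion of cycles being injective.
  have e3 : T.moduleCatCyclesIso.inv.hom z' =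
      (ShortComplex.cyclesMap φ).hom (S.moduleCatCyclesIso.inv.hom z) := by
    apply (ModuleCat.mono_iff_injective T.iCycles).1 inferInstance
    refine (e2 T z').trans ?_
    refine Eq.trans ?_ (congrArg (fun g => g.hom (S.moduleCatCyclesIso.inv.hom z))
      (ShortComplex.cyclesMap_i φ)).symm
    exact congrArg φ.τ₂.hom (e2 S z).symm
  refine (e1 T z').trans ?_
  rw [e3]
  refine (congrArg (fun g => g.hom (S.moduleCatCyclesIso.inv.hom z))
    (ShortComplex.homologyπ_naturality φ)).symm.trans ?_
  exact congrArg (ShortComplex.homologyMap φ).hom (e1 S z).symm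

/-- The product in homology was defined through representing cycles; this is what allows identities
of chains to pass to homology. -/
lemma Represents.cross {X Y : SSet.{0}} {p q s : ℕ} (hs : p + q = s) {a : Chains k X p}
    {b : Chains k Y q} {h : (X.chainComplex (ModuleCat.of k k)).homology p}
    {h' : (Y.chainComplex (ModuleCat.of k k)).homology q} (H : Represents a h)
    (H' : Represents b h') :
    Represents (cross k X Y hs a b) (crossHomology k X Y hs h h') := by
  obtain ⟨z, rfl, rfl⟩ := H
  obtain ⟨z', rfl, rfl⟩ := H'
  refine ⟨crossCycles k X Y hs z z', rfl, ?_⟩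
  have e : ∀ (U : ShortComplex (ModuleCat.{0} k)) (w : U.moduleCatLeftHomologyData.H),
    U.moduleCatHomologyIso.hom.hom (U.moduleCatHomologyIso.inv.hom w) = w := fun U w =>
      U.moduleCatHomologyIso.inv_hom_id_apply w
  refine congrArg
    (((X ⊗ Y : SSet.{0}).chainComplex (ModuleCat.of k k)).sc s).moduleCatHomologyIso.inv.hom ?_
  refine Eq.trans ?_ (congrArg₂ (fun u v => crossQuot k X Y hs u v) (e _ _) (e _ _)).symm
  rfl

end SimplicialCross

namespace SingularHomology

open CategoryTheory SimplicialCross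

variable {k : Type} [CommRing k] {X Y Z X' Y' : Type} [TopologicalSpace X] [TopologicalSpace Y]
  [TopologicalSpace Z] [TopologicalSpace X'] [TopologicalSpace Y']

lemma represents_map (f : C(X, Y)) {n : ℕ} {a : SingularChains k X n} {h : SingularHomology k X n}
    (H : Represents a h) : Represents (chainMap k f n a) (map k f n h) :=
  H.map _

lemma represents_cross {p q s : ℕ} (hs : p + q = s) {a : SingularChains k X p}
    {b : SingularChains k Y q} {h : SingularHomology k X p} {h' : SingularHomology k Y q}
    (H : Represents a h) (H' : Represents b h') :
    Represents (chainCross k X Y hs a b) (cross k X Y hs h h') :=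
  (H.cross hs H').map _

lemma map_id (n : ℕ) (h : SingularHomology k X n) : map k (ContinuousMap.id X) n h = h := by
  have : TopCat.toSSet.map (TopCat.ofHom (ContinuousMap.id X)) = 𝟙 _ :=
    TopCat.toSSet.map_id (TopCat.of X)
  rw [map, this, SSet.homologyMap_id]
  rfl

lemma map_map (f : C(X, Y)) (g : C(Y, Z)) (n : ℕ) (h : SingularHomology k X n) :
    map k g n (map k f n h) = map k (g.comp f) n h := by
  have : TopCat.toSSet.map (TopCat.ofHom (g.comp f)) =
      TopCat.toSSet.map (TopCat.ofHom f) ≫ TopCat.toSSet.map (TopCat.ofHom g) :=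
    TopCat.toSSet.map_comp (TopCat.ofHom f) (TopCat.ofHom g)
  rw [map, map, map, this, SSet.homologyMap_comp]
  rfl

lemma map_eq_of_homotopy {f g : C(X, Y)} (H : f.Homotopy g) (n : ℕ) : map k f n = map k g n := by
  have H' : TopCat.Homotopy (TopCat.ofHom f) (TopCat.ofHom g) := H
  rw [map, map, H'.toSSet.congr_homologyMap]

lemma map_cross (f : C(X, X')) (g : C(Y, Y')) {p q s : ℕ} (hs : p + q = s)
    (h : SingularHomology k X p) (h' : SingularHomology k Y q) :
    map k (f.prodMap g) s (cross k X Y hs h h') = cross k X' Y' hs (map k f p h) (map k g q h') := by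
  obtain ⟨a, ha⟩ := exists_represents h
  obtain ⟨b, hb⟩ := exists_represents h'
  refine (represents_map _ (represents_cross hs ha hb)).eq ?_
  rw [chainCross_naturality]
  exact represents_cross hs (represents_map f ha) (represents_map g hb)

lemma cross_swap {p q s : ℕ} (hs : p + q = s) (hs' : q + p = s)
    (h : SingularHomology k X p) (h' : SingularHomology k Y q) :
    map k ContinuousMap.prodSwap s (cross k X Y hs h h') =
      (-1 : ℤ) ^ (p * q) • cross k Y X hs' h' h := by
  obtain ⟨a, ha⟩ := exists_represents h
  obtain ⟨b, hb⟩ := exists_represents h'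
  refine (represents_map _ (represents_cross hs ha hb)).eq ?_
  rw [chainCross_swap k hs hs']
  exact (represents_cross hs' hb ha).smul _

lemma cross_assoc {p q r pq qr s : ℕ} (hpq : p + q = pq) (hqr : q + r = qr)
    (hs : pq + r = s) (hs' : p + qr = s) (h : SingularHomology k X p)
    (h' : SingularHomology k Y q) (h'' : SingularHomology k Z r) :
    map k (Homeomorph.prodAssoc X Y Z : C((X × Y) × Z, X × Y × Z)) s
        (cross k (X × Y) Z hs (cross k X Y hpq h h') h'') =
      cross k X (Y × Z) hs' h (cross k Y Z hqr h' h'') := by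
  obtain ⟨a, ha⟩ := exists_represents h
  obtain ⟨b, hb⟩ := exists_represents h'
  obtain ⟨c, hc⟩ := exists_represents h''
  refine (represents_map _ (represents_cross hs (represents_cross hpq ha hb) hc)).eq ?_
  rw [chainCross_assoc k hpq hqr hs hs']
  exact represents_cross hs' ha (represents_cross hqr hb hc)

end SingularHomology

/-! ### The interchange of two factors of a triple cross product -/

namespace SingularHomology

variable {k : Type} [CommRing k] {X Y Z V W : Type} [TopologicalSpace X] [TopologicalSpace Y]
  [TopologicalSpace Z] [TopologicalSpace V] [TopologicalSpace W]

lemma cross_map_left (f : C(X, W)) {p q s : ℕ} (hs : p + q = s) (x : SingularHomology k X p)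
    (y : SingularHomology k Y q) :
    cross k W Y hs (map k f p x) y =
      map k (f.prodMap (ContinuousMap.id Y)) s (cross k X Y hs x y) := by
  rw [map_cross, map_id]

lemma cross_map_right (f : C(Y, W)) {p q s : ℕ} (hs : p + q = s) (x : SingularHomology k X p)
    (y : SingularHomology k Y q) :
    cross k X W hs x (map k f q y) =
      map k ((ContinuousMap.id X).prodMap f) s (cross k X Y hs x y) := by
  rw [map_cross, map_id]

/-- Reassociate, exchange the last two factors, reassociate back. The only sign comes from the
exchange and is the Koszul sign of the parallel associativity relations. -/
lemma cross_cross_swap {p q r pq pr s : ℕ} (hpq : p + q = pq) (hpr : p + r = pr)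
    (hs : pq + r = s) (hs' : pr + q = s) (x : SingularHomology k X p) (y : SingularHomology k Y q)
    (z : SingularHomology k Z r) :
    map k (⟨fun v => ((v.1.1, v.2), v.1.2), by fun_prop⟩ : C((X × Y) × Z, (X × Z) × Y)) s
        (cross k (X × Y) Z hs (cross k X Y hpq x y) z) =
      (-1 : ℤ) ^ (q * r) • cross k (X × Z) Y hs' (cross k X Z hpr x z) y := by
  have h1 := cross_assoc hpq rfl hs (by omega) x y z
  have h2 := cross_assoc hpr (add_comm r q) hs' (by omega) x z y
  have h3 := congrArg (map k ((ContinuousMap.id X).prodMap ContinuousMap.prodSwap) s) h1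
  rw [← cross_map_right, cross_swap rfl (add_comm r q), map_zsmul, ← h2, ← map_zsmul] at h3
  have h4 := congrArg (map k ((Homeomorph.prodAssoc X Z Y).symm : C(X × Z × Y, (X × Z) × Y)) s) h3
  rw [map_map, map_map, map_map] at h4
  refine Eq.trans ?_ (h4.trans ?_)
  · rfl
  -- On the other side, the reassociation and its inverse cancel.
  · exact map_id _ _

end SingularHomology

/-! ### Transport of the operad axioms along isomorphisms -/

namespace GradedCollection

lemma Isomorphic.isOperad {k : Type} [CommRing k] {A B : GradedCollection k}
    (h : Isomorphic B A) (hA : A.IsOperad) : B.IsOperad := by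
  obtain ⟨f, hact, hcomp⟩ := h
  refine ⟨⟨?_, ?_, ?_⟩, ?_, ?_, ?_⟩
  · intro n p a
    apply (f n p).injective
    rw [hact, hA.act_one]
  · intro n σ τ p a
    apply (f n p).injective
    rw [hact, hact, hact, hA.act_mul]
  · intro m n l h i σ τ p q s hs a b
    apply (f l s).injective
    rw [hact, hcomp, hcomp, hact, hact, hA.equivariant]
  · intro k l m kl km n hkl hkm hn hn' i j j' i' h h' h'' p q r pq pr s hpq hpr hs hs' a b c
    apply (f n s).injective
    rw [map_zsmul, hcomp, hcomp, hcomp, hcomp,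
      hA.assoc_left hkl hkm hn hn' i j j' i' h h' h'' hpq hpr hs hs']
  · intro k l m kl lm n hkl hlm hn hn' i j j' h p q r pq qr s hpq hqr hs hs' a b c
    apply (f n s).injective
    rw [hcomp, hcomp, hcomp, hcomp,
      hA.assoc_middle hkl hlm hn hn' i j j' h hpq hqr hs hs']
  · intro k l m kl km n hkl hkm hn hn' i j j' i' h h' h'' p q r pq pr s hpq hpr hs hs' a b c
    apply (f n s).injective
    rw [map_zsmul, hcomp, hcomp, hcomp, hcomp,
      hA.assoc_right hkl hkm hn hn' i j j' i' h h' h'' hpq hpr hs hs']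

end GradedCollection

/-! ### The homology of topological operads and of deformation retracts -/

namespace TopCollection

open SingularHomology

/-- The compositions as continuous maps. -/
def compMap {A : TopCollection} (hA : A.IsQuasiOperad) {m n l : ℕ} (h : m + n = l)
    (i : Fin (m + 1)) : C(A.space m × A.space n, A.space l) :=
  ⟨fun x => A.comp h i x.1 x.2, hA.continuous_comp h i⟩

/-- The action of a permutation as a continuous map. -/
def actMap {A : TopCollection} (hA : A.IsQuasiOperad) {n : ℕ} (σ : Equiv.Perm (Fin (n + 1))) :
    C(A.space n, A.space n) :=
  ⟨A.act σ, hA.continuous_act σ⟩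

variable {k : Type} [CommRing k] {A B : TopCollection}

attribute [local irreducible] SingularHomology.map SingularHomology.cross

section Laws

variable {m n l kl km j : ℕ} {p q r pq qr pr s : ℕ} (hA : A.IsQuasiOperad)

lemma map_actMap_one (a : SingularHomology k (A.space n) p) : map k (actMap hA 1) p a = a := by
  have : actMap hA (1 : Equiv.Perm (Fin (n + 1))) = ContinuousMap.id _ :=
    ContinuousMap.ext fun a => hA.act_one a
  rw [this, map_id]

lemma map_actMap_mul (σ τ : Equiv.Perm (Fin (n + 1))) (a : SingularHomology k (A.space n) p) :
    map k (actMap hA (σ * τ)) p a = map k (actMap hA σ) p (map k (actMap hA τ) p a) := by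
  have : actMap hA (σ * τ) = (actMap hA σ).comp (actMap hA τ) :=
    ContinuousMap.ext fun a => hA.act_mul σ τ a
  rw [this, map_map]

lemma map_compMap_equivariant (h : m + n = l) (i : Fin (m + 1)) (σ : Equiv.Perm (Fin (m + 1)))
    (τ : Equiv.Perm (Fin (n + 1))) (hs : p + q = s) (a : SingularHomology k (A.space m) p)
    (b : SingularHomology k (A.space n) q) :
    map k (compMap hA h (σ i)) s
        (cross k _ _ hs (map k (actMap hA σ) p a) (map k (actMap hA τ) q b)) =
      map k (actMap hA (blockPerm h i σ τ)) s
        (map k (compMap hA h i) s (cross k _ _ hs a b)) := by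
  rw [← map_cross, map_map, map_map]
  refine congrArg (fun f => map k f s _) (ContinuousMap.ext fun x => ?_)
  exact hA.equivariant h i σ τ x.1 x.2

/-- Both iterated compositions are moved behind a triple cross product, where they are induced by
maps that agree after the interchange of the last two factors. The two parallel relations are both
instances. -/
lemma map_compMap_swap (hkl : m + n = kl) (hkm : m + l = km) (hn : kl + l = j) (hn' : km + n = j)
    (i i₂ : Fin (m + 1)) (j' : Fin (kl + 1)) (i' : Fin (km + 1))
    (hcomp : ∀ a b c, A.comp hn j' (A.comp hkl i a b) c = A.comp hn' i' (A.comp hkm i₂ a c) b)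
    (hpq : p + q = pq) (hpr : p + r = pr) (hs : pq + r = s) (hs' : pr + q = s)
    (a : SingularHomology k (A.space m) p) (b : SingularHomology k (A.space n) q)
    (c : SingularHomology k (A.space l) r) :
    map k (compMap hA hn j') s
        (cross k _ _ hs (map k (compMap hA hkl i) pq (cross k _ _ hpq a b)) c) =
      (-1 : ℤ) ^ (q * r) • map k (compMap hA hn' i') s
        (cross k _ _ hs' (map k (compMap hA hkm i₂) pr (cross k _ _ hpr a c)) b) := by
  rw [cross_map_left, cross_map_left, map_map, map_map, ← map_zsmul,
    ← cross_cross_swap hpq hpr hs hs', map_map]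
  refine congrArg (fun f => map k f s _) (ContinuousMap.ext fun x => ?_)
  exact hcomp x.1.1 x.1.2 x.2

/-- As in the parallel case, but the two triple cross products differ only by the bracketing, so no
sign occurs. -/
lemma map_compMap_assoc (hkl : m + n = kl) (hlm : n + l = km) (hn : kl + l = j) (hn' : m + km = j)
    (i : Fin (m + 1)) (i₂ : Fin (n + 1)) (j' : Fin (kl + 1))
    (hcomp : ∀ a b c, A.comp hn j' (A.comp hkl i a b) c = A.comp hn' i a (A.comp hlm i₂ b c))
    (hpq : p + q = pq) (hqr : q + r = qr) (hs : pq + r = s) (hs' : p + qr = s)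
    (a : SingularHomology k (A.space m) p) (b : SingularHomology k (A.space n) q)
    (c : SingularHomology k (A.space l) r) :
    map k (compMap hA hn j') s
        (cross k _ _ hs (map k (compMap hA hkl i) pq (cross k _ _ hpq a b)) c) =
      map k (compMap hA hn' i) s
        (cross k _ _ hs' a (map k (compMap hA hlm i₂) qr (cross k _ _ hqr b c))) := by
  rw [cross_map_left, cross_map_right, map_map, map_map, ← cross_assoc hpq hqr hs hs', map_map]
  refine congrArg (fun f => map k f s _) (ContinuousMap.ext fun x => ?_)
  exact hcomp x.1.1 x.1.2 x.2

end Laws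

lemma isQuasiOperad_homology (hA : A.IsQuasiOperad) : (homology k hA).IsQuasiOperad where
  act_one _ a := map_actMap_one hA a
  act_mul σ τ _ a := map_actMap_mul hA σ τ a
  equivariant h i σ τ _ _ _ hs a b := map_compMap_equivariant hA h i σ τ hs a b

theorem isOperad_homology (hA : A.IsOperad) : (homology k hA.toIsQuasiOperad).IsOperad where
  toIsQuasiOperad := isQuasiOperad_homology hA.toIsQuasiOperad
  assoc_left hkl hkm hn hn' i j j' i' h h' h'' _ _ _ _ _ _ hpq hpr hs hs' a b c :=
    map_compMap_swap hA.toIsQuasiOperad hkl hkm hn hn' i j j' i'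
      (hA.assoc_left hkl hkm hn hn' i j j' i' h h' h'') hpq hpr hs hs' a b c
  assoc_middle hkl hlm hn hn' i j j' h _ _ _ _ _ _ hpq hqr hs hs' a b c :=
    map_compMap_assoc hA.toIsQuasiOperad hkl hlm hn hn' i j j'
      (hA.assoc_middle hkl hlm hn hn' i j j' h) hpq hqr hs hs' a b c
  assoc_right hkl hkm hn hn' i j j' i' h h' h'' _ _ _ _ _ _ hpq hpr hs hs' a b c :=
    map_compMap_swap hA.toIsQuasiOperad hkl hkm hn hn' i j j' i'
      (hA.assoc_right hkl hkm hn hn' i j j' i' h h' h'') hpq hpr hs hs' a b c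

/-- The inclusion `s` need not be a morphism, but `s (a ∘ᵢ b)` is `s ∘ r` applied to the composite
in `A`, and `H` joins this to the composite itself. So `s` respects compositions in homology, where
it is inverse to `r`. -/
theorem IsDeformationRetract.isomorphic_homology {r : ∀ n, A.space n → B.space n}
    {s : ∀ n, B.space n → A.space n} {H : ∀ n, unitInterval × A.space n → A.space n}
    (hd : IsDeformationRetract A B r s H) (hA : A.IsQuasiOperad) (hB : B.IsQuasiOperad) :
    GradedCollection.Isomorphic (homology k hB) (homology k hA) := by
  let R : ∀ n, C(A.space n, B.space n) := fun n => ⟨r n, hd.continuous_r n⟩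
  let S : ∀ n, C(B.space n, A.space n) := fun n => ⟨s n, hd.continuous_s n⟩
  have hRS : ∀ n, (R n).comp (S n) = ContinuousMap.id _ := fun n =>
    ContinuousMap.ext fun b => hd.r_s b
  have hSR : ∀ n, (ContinuousMap.id _).Homotopy ((S n).comp (R n)) := fun n =>
    { toFun := H n
      continuous_toFun := hd.continuous_H n
      map_zero_left := fun a => hd.H_zero a
      map_one_left := fun a => hd.H_one a }
  -- The deformation `H` applied to the composite in `A` of the included elements.
  have hc : ∀ {m n l : ℕ} (h : m + n = l) (i : Fin (m + 1)),
      ((compMap hA h i).comp ((S m).prodMap (S n))).Homotopy ((S l).comp (compMap hB h i)) :=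
    fun {m n l} h i =>
    { toFun := fun x => H l (x.1, A.comp h i (s m x.2.1) (s n x.2.2))
      continuous_toFun := (hd.continuous_H l).comp (continuous_fst.prodMk
        (continuous_comp_comp hA h i ((hd.continuous_s m).comp continuous_snd.fst)
          ((hd.continuous_s n).comp continuous_snd.snd)))
      map_zero_left := fun x => hd.H_zero _
      map_one_left := fun x => (hd.H_one _).trans (congrArg (s l) (hd.comp h i x.1 x.2).symm) }
  have h1 : ∀ n p, map k (S n) p ∘ₗ map k (R n) p = LinearMap.id := fun n p =>
    LinearMap.ext fun a => by
      rw [LinearMap.comp_apply, map_map, ← map_eq_of_homotopy (hSR n), map_id, LinearMap.id_apply]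
  have h2 : ∀ n p, map k (R n) p ∘ₗ map k (S n) p = LinearMap.id := fun n p =>
    LinearMap.ext fun a => by
      rw [LinearMap.comp_apply, map_map, hRS, map_id, LinearMap.id_apply]
  have h3 : ∀ {n} (σ : Equiv.Perm (Fin (n + 1))) (p) (b : SingularHomology k (B.space n) p),
      map k (S n) p (map k (actMap hB σ) p b) = map k (actMap hA σ) p (map k (S n) p b) :=
    fun σ p b => by
      rw [map_map, map_map]
      exact congrArg (fun f => map k f p b) (ContinuousMap.ext fun b => hd.s_act σ b)
  have h4 : ∀ {m n l : ℕ} (h : m + n = l) (i : Fin (m + 1)) {p q u : ℕ} (hs : p + q = u)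
      (a : SingularHomology k (B.space m) p) (b : SingularHomology k (B.space n) q),
      map k (S l) u (map k (compMap hB h i) u (cross k _ _ hs a b)) =
        map k (compMap hA h i) u (cross k _ _ hs (map k (S m) p a) (map k (S n) q b)) :=
    fun h i _ _ _ hs a b => by
      rw [map_map, ← map_cross, map_map, map_eq_of_homotopy (hc h i)]
  exact ⟨fun n p => LinearEquiv.ofLinearMap (map k (S n) p) (map k (R n) p) (h1 n p) (h2 n p),
    fun σ p b => h3 σ p b, fun h i _ _ _ hs a b => h4 h i hs a b⟩

end TopCollection

theorem mainTheorem10 :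
    ∃ (hCact : spinelessCacti.IsOperad) (hCact1 : normalizedSpinelessCacti.IsQuasiOperad)
      (hCacti : cacti.IsOperad) (hCacti1 : normalizedCacti.IsQuasiOperad),
      TopCollection.HomotopyEquivalent spinelessCacti normalizedSpinelessCacti ∧
      TopCollection.HomotopyEquivalent cacti normalizedCacti ∧
      ∀ (k : Type) [CommRing k],
        ((TopCollection.homology k hCact1).IsOperad ∧
          (TopCollection.homology k hCact.toIsQuasiOperad).IsOperad ∧
          GradedCollection.Isomorphic (TopCollection.homology k hCact1)
            (TopCollection.homology k hCact.toIsQuasiOperad)) ∧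
        ((TopCollection.homology k hCacti1).IsOperad ∧
          (TopCollection.homology k hCacti.toIsQuasiOperad).IsOperad ∧
          GradedCollection.Isomorphic (TopCollection.homology k hCacti1)
            (TopCollection.homology k hCacti.toIsQuasiOperad)) := by
  have h := isDeformationRetract_normalizedSpinelessCacti
  have h' := isDeformationRetract_normalizedCacti
  have hA := isOperad_spinelessCacti
  have hA' := isOperad_cacti
  refine ⟨hA, h.isQuasiOperad hA.toIsQuasiOperad, hA', h'.isQuasiOperad hA'.toIsQuasiOperad,
    h.homotopyEquivalent hA.toIsQuasiOperad, h'.homotopyEquivalent hA'.toIsQuasiOperad,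
    fun k _ => ⟨⟨?_, TopCollection.isOperad_homology hA, ?_⟩, ⟨?_, TopCollection.isOperad_homology hA', ?_⟩⟩⟩
  -- Associativity of the normalized structure, which is only required up to homotopy, is
  -- transported in homology from spineless cacti.
  · exact (h.isomorphic_homology _ _).isOperad (TopCollection.isOperad_homology hA)
  · exact h.isomorphic_homology _ _
  · exact (h'.isomorphic_homology _ _).isOperad (TopCollection.isOperad_homology hA')
  · exact h'.isomorphic_homology _ _
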